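/- Let $E$ be a finite ground set with $|E|=n\ge 2$, and let $\varepsilon\in(0,1)$. An algorithm accesses a matroid $\mathcal M=(E,\mathcal I)$ and a function $f:2^E\to\mathbb R_{\ge 0}$ only through a value oracle ($S\mapsto f(S)$) and a span oracle (on input $S\subseteq E$, $e\in E$, it tells whether $S\cup\{e\}$ has the same rank as $S$). It works in adaptive rounds: in each round it submits a finite set of queries to the two oracles, and the choice of the queries may depend only on its own randomness and on the answers received in strictly earlier rounds. There are absolute constants $C$ and $d$ such that the following holds for all such $E,n,\varepsilon$. The algorithms below may depend on $E$ and $\varepsilon$, but not on $\mathcal M$ and $f$; their guarantees hold for every matroid $\mathcal M=(E,\mathcal I)$ and every normalized ($f(\emptyset)=0$), monotone, submodular $f:2^E\to\mathbb R_{\ge0}$. Put $\mathrm{OPT}=\max_{I\in\mathcal I}f(I)$, and for $x\in\mathbb R_{\ge0}^E$ let $F(x)$ be the multilinear extension of $f$, i.e. the expected value of $f$ on the random set that contains each $e$ independently with probability $\min(x_e,1)$. Each algorithm makes at most $C(n/\varepsilon)^d$ oracle queries in expectation. 1. There is a randomized algorithm that always outputs a set $I\in\mathcal I$, with $\mathbb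 E[f(I)]\ge(\tfrac12-\varepsilon)\,\mathrm{OPT}$, and whose expected number of adaptive rounds is at most $C\,\log^2 n/\varepsilon^2$. 2. There is a randomized algorithm that always outputs a convex combination $x=\sum_{i=1}^{\ell}w_i\mathbf 1_{I_i}$ ($w_i\ge0$, $\sum_i w_i=1$) of $\ell\le C/\varepsilon$ independent sets $I_1,\dots,I_\ell\in\mathcal I$, with $\mathbb E[F(x)]\ge(1-e^{-1}-\varepsilon)\,\mathrm{OPT}$, and whose expected number of adaptive rounds is at most $C\,\log^2 n/\varepsilon^3$. 3. Consequently one can compute a $(1-e^{-1}-\varepsilon)$-approximation to $\mathrm{OPT}$: there is a randomized algorithm that outputs a number $v\ge0$ with $\mathbb E[\min(v,\mathrm{OPT})]\ge(1-e^{-1}-\varepsilon)\,\mathrm{OPT}$ and $\Pr[v>\mathrm{OPT}]\le\varepsilon$, and whose expected number of adaptive rounds is at most $C\,\log^2 n/\varepsilon^3$. -/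

import Mathlib

universe u v

open scoped ENNReal NNReal

/-! ## Set functions, multilinear extension, optimum -/

/-- A normalized, monotone, submodular set function on the subsets of `E`.  Normalization and
monotonicity make such a function nonnegative. -/
structure IsMonotoneSubmodular {E : Type*} [DecidableEq E] (f : Finset E → ℝ) : Prop where
  normalized : f ∅ = 0
  monotone : ∀ S T : Finset E, S ⊆ T → f S ≤ f T
  submodular : ∀ S T : Finset E, f (S ∪ T) + f (S ∩ T) ≤ f S + f T

/-- The multilinear extension `F` of `f`: the expected value of `f` on the random set that contains
each `e` independently with probability `min (x e) 1`.  It is meant for nonnegative `x`. -/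
noncomputable def multilinear {E : Type*} [Fintype E] [DecidableEq E]
    (f : Finset E → ℝ) (x : E → ℝ) : ℝ :=
  ∑ S : Finset E, ((∏ e ∈ S, min (x e) 1) * ∏ e ∈ Sᶜ, (1 - min (x e) 1)) * f S

/-- The maximum of `f` over the independent sets of `M`. -/
noncomputable def opt {E : Type*} (M : Matroid E) (f : Finset E → ℝ) : ℝ :=
  sSup {y | ∃ I : Finset E, M.Indep (I : Set E) ∧ f I = y}

/-- For a finite ground type the supremum in `opt` is attained. -/
theorem opt_isGreatest {E : Type*} [Fintype E] (M : Matroid E) (f : Finset E → ℝ) :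
    IsGreatest {y | ∃ I : Finset E, M.Indep (I : Set E) ∧ f I = y} (opt M f) := by
  have hfin : {y | ∃ I : Finset E, M.Indep (I : Set E) ∧ f I = y}.Finite :=
    (Set.finite_range f).subset (by rintro y ⟨I, -, rfl⟩; exact ⟨I, rfl⟩)
  have hne : {y | ∃ I : Finset E, M.Indep (I : Set E) ∧ f I = y}.Nonempty :=
    ⟨f ∅, ∅, by simp, rfl⟩
  exact ⟨hne.csSup_mem hfin, fun y hy => le_csSup hfin.bddAbove hy⟩

/-- A convex combination of `size` sets. -/
structure ConvexCombination (E : Type*) where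
  size : ℕ
  sets : Fin size → Finset E
  weight : Fin size → ℝ
  weight_nonneg : ∀ i, 0 ≤ weight i
  weight_sum : ∑ i, weight i = 1

/-- The point `∑ i, weight i • 1_{sets i}` of the cube. -/
def ConvexCombination.point {E : Type*} [DecidableEq E] (c : ConvexCombination E) : E → ℝ :=
  fun e => ∑ i, c.weight i * if e ∈ c.sets i then 1 else 0

/-! ## Randomized adaptive algorithms with a value oracle and a span oracle -/

/-- The two kinds of oracle queries: the value `f S`, and whether `e` lies in the span of `S`. -/
inductive Query (E : Type*) where
  | value (S : Finset E)
  | span (S : Finset E) (e : E)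

/-- The type of the answer to a query. -/
def Query.Answer {E : Type*} : Query E → Type
  | .value _ => ℝ
  | .span _ _ => Prop

/-- The answers of the value oracle of `f` and of the span oracle of `M`.  (For a matroid on all of
`E`, one has `e ∈ M.closure S` iff `S` and `S ∪ {e}` have the same rank.) -/
def Query.answer {E : Type*} (M : Matroid E) (f : Finset E → ℝ) : (q : Query E) → q.Answer
  | .value S => f S
  | .span S e => e ∈ M.closure (S : Set E)

/-- A randomized adaptive algorithm on the ground set `E`.  It may stop with an output, draw a
fresh random sample from a distribution of its choice, or carry out one adaptive round: it
submits a finite set of queries all at once, and continues in dependence on all the answers.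
It has no access to the function and the matroid except through the answers. -/
inductive AdaptiveAlgorithm (E : Type u) (Out : Type v) : Type (max (u + 1) v) where
  | output (o : Out) : AdaptiveAlgorithm E Out
  | sample {Ω : Type u} (p : PMF Ω) (next : Ω → AdaptiveAlgorithm E Out) : AdaptiveAlgorithm E Out
  | round (Q : Finset (Query E)) (next : ((q : Q) → q.1.Answer) → AdaptiveAlgorithm E Out) :
      AdaptiveAlgorithm E Out

/-- What is recorded about one execution: the output, the number of adaptive rounds, and the total
number of oracle queries. -/
structure Execution (Out : Type*) where
  output : Out
  rounds : ℕ
  queries : ℕ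

/-- The distribution of the execution of an algorithm with oracles for `M` and `f`. -/
noncomputable def AdaptiveAlgorithm.run {E : Type u} {Out : Type v} (M : Matroid E)
    (f : Finset E → ℝ) : AdaptiveAlgorithm E Out → PMF (Execution Out)
  | .output o => PMF.pure ⟨o, 0, 0⟩
  | .sample p next => p.bind fun i => (next i).run M f
  | .round Q next =>
      ((next fun q => q.1.answer M f).run M f).map
        fun r => ⟨r.output, r.rounds + 1, r.queries + Q.card⟩

/-- The expectation of a nonnegative extended real quantity. -/
noncomputable def PMF.expect {α : Type*} (p : PMF α) (g : α → ℝ≥0∞) : ℝ≥0∞ :=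
  ∑' a, p a * g a

/-! Everything rests on one estimate, `GreedyGuarantee`. For a monotone submodular `g`, a parallel
greedy procedure returns a random independent `S` such that `E[g S - (1-δ)² ∑_{o∈O} gain S o] ≥ g ∅
- (1-δ)² δ Δ` for every independent `O`, where `Δ` is the largest gain of a nonloop at `∅`. No
matching between `S` and `O` is needed. The proof follows a potential at a threshold `τ`: the
excesses of the gains of `O` over `τ`, plus `τ |S|`. When all elements of gain above `τ'` are
spanned by `T`, at most `|T|` elements of `O` have such a gain, so lowering the threshold does not
increase the potential, and each insertion raises it by at most the old threshold
(`MonoSubmod.potential_le`).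

Parallelism comes from adaptive sequencing. The candidates at a threshold are put into random order
and inserted until their number has dropped by the factor `1-δ`. Up to then a random remaining
element is a candidate with probability above `1-δ`, so insertions earn almost `τ` on average
(`le_mean_shuffle_process`). `O(log n / δ)` such steps exhaust a threshold, and `O(log n / δ)`
thresholds suffice. A step takes three rounds: skipped elements are spanned and do not change
closures, so all span queries can refer to prefixes of the order that are known in advance
(`process_congr`); the chain of sets is then known and its values are queried together.

For the factor 1/2, combine the guarantee with `∑ gain S o ≥ OPT - f S`.

For `1 - 1/e`, the multilinear extension at the average of `I_1, ..., I_l` is the mean of `f (pick I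
u)` over uniform index vectors `u`. All index vectors are drawn once, at the start. For fixed
samples the empirical mean is monotone submodular in each single set, so the greedy guarantee
applies to it exactly, and concentration is only needed uniformly over the `2^(n l)` families
(`card_not_goodSample_le`). One stage shrinks the gap to `(1-2δ) OPT` by the factor `1 + (1-δ)²/l`,
and `l = ⌈1/δ⌉` stages leave about `1/e` of it.

For the estimate of `OPT`, the empirical value is divided by `1+δ`. On a good sample the result is
at most `OPT`, because averages of independent sets have multilinear value at most `OPT`
(`pickMean_le_opt`). This is proved by a pipage-type exchange between bases. -/

/-! ## Sequencing, real expectations and resource bounds of adaptive algorithms -/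

namespace AdaptiveAlgorithm

universe w

variable {E : Type u} {α : Type v} {β : Type w}

/-- Run an algorithm and continue with another one that depends on its output. -/
def bind : AdaptiveAlgorithm E α → (α → AdaptiveAlgorithm E β) → AdaptiveAlgorithm E β
  | .output o, k => k o
  | .sample p next, k => .sample p fun ω => (next ω).bind k
  | .round Q next, k => .round Q fun a => (next a).bind k

/-- The expectation of a real function of the output. -/
noncomputable def mean (M : Matroid E) (f : Finset E → ℝ) (h : α → ℝ) :
    AdaptiveAlgorithm E α → ℝ
  | .output o => h o
  | .sample p next => ∑' ω, (p ω).toReal * (next ω).mean M f h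
  | .round _ next => (next fun q => q.1.answer M f).mean M f h

/-- The output satisfies `P` in every execution of positive probability. -/
def Always (M : Matroid E) (f : Finset E → ℝ) (P : α → Prop) : AdaptiveAlgorithm E α → Prop
  | .output o => P o
  | .sample p next => ∀ ω ∈ p.support, (next ω).Always M f P
  | .round _ next => (next fun q => q.1.answer M f).Always M f P

/-- The sample spaces are finite, there are at most `r` rounds, and each of them submits at most
`q` queries. -/
def Cost (q : ℕ) : AdaptiveAlgorithm E α → ℕ → Prop
  | .output _, _ => True
  | .sample (Ω := Ω) _ next, r => Finite Ω ∧ ∀ ω, (next ω).Cost q r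
  | .round Q next, r => Q.card ≤ q ∧ 1 ≤ r ∧ ∀ a, (next a).Cost q (r - 1)

theorem Cost.mono {q : ℕ} {A : AdaptiveAlgorithm E α} {r r' : ℕ} (h : A.Cost q r)
    (hr : r ≤ r') : A.Cost q r' := by
  induction A generalizing r r' with
  | output o => trivial
  | sample p next ih => exact ⟨h.1, fun ω => ih ω (h.2 ω) hr⟩
  | round Q next ih =>
    exact ⟨h.1, h.2.1.trans hr, fun a => ih a (h.2.2 a) (Nat.sub_le_sub_right hr 1)⟩

theorem Cost.bind {q : ℕ} {A : AdaptiveAlgorithm E α} {k : α → AdaptiveAlgorithm E β} {r r' : ℕ}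
    (h : A.Cost q r) (hk : ∀ o, (k o).Cost q r') : (A.bind k).Cost q (r + r') := by
  induction A generalizing r with
  | output o => exact (hk o).mono (Nat.le_add_left _ _)
  | sample p next ih => exact ⟨h.1, fun ω => ih ω (h.2 ω)⟩
  | round Q next ih =>
    refine ⟨h.1, h.2.1.trans (Nat.le_add_right _ _), fun a => ?_⟩
    have := ih a (h.2.2 a)
    rwa [← Nat.sub_add_comm h.2.1] at this

section

variable {M : Matroid E} {f : Finset E → ℝ}

@[simp]
theorem mean_bind (A : AdaptiveAlgorithm E α) (k : α → AdaptiveAlgorithm E β) (h : β → ℝ) :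
    (A.bind k).mean M f h = A.mean M f fun o => (k o).mean M f h := by
  induction A with
  | output o => rfl
  | sample p next ih => simp only [bind, mean, ih]
  | round Q next ih => simp only [bind, mean, ih]

theorem always_bind {A : AdaptiveAlgorithm E α} {k : α → AdaptiveAlgorithm E β} {P : β → Prop} :
    (A.bind k).Always M f P ↔ A.Always M f fun o => (k o).Always M f P := by
  induction A with
  | output o => rfl
  | sample p next ih => simp only [bind, Always, ih]
  | round Q next ih => simp only [bind, Always, ih]

theorem Always.mono {A : AdaptiveAlgorithm E α} {P P' : α → Prop} (h : A.Always M f P)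
    (hP : ∀ o, P o → P' o) : A.Always M f P' := by
  induction A with
  | output o => exact hP o h
  | sample p next ih => exact fun ω hω => ih ω (h ω hω)
  | round Q next ih => exact ih _ h

theorem always_of_forall {A : AdaptiveAlgorithm E α} {P : α → Prop} (hP : ∀ o, P o) :
    A.Always M f P := by
  induction A with
  | output o => exact hP o
  | sample p next ih => exact fun ω _ => ih ω
  | round Q next ih => exact ih _

theorem mean_sample_fintype {Ω : Type u} [Fintype Ω] (p : PMF Ω)
    (next : Ω → AdaptiveAlgorithm E α) (h : α → ℝ) :
    (sample p next).mean M f h = ∑ ω, (p ω).toReal * (next ω).mean M f h := by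
  rw [mean, tsum_fintype]

theorem sum_toReal_pmf {Ω : Type*} [Fintype Ω] (p : PMF Ω) : ∑ ω, (p ω).toReal = 1 := by
  rw [← ENNReal.toReal_sum fun ω _ => p.apply_ne_top ω]
  have := p.tsum_coe
  rw [tsum_fintype] at this
  rw [this, ENNReal.toReal_one]

/-- Monotonicity of the expectation. -/
theorem Always.mean_le_mean {A : AdaptiveAlgorithm E α} {P : α → Prop} (hA : A.Always M f P)
    {q r : ℕ} (hc : A.Cost q r) {h h' : α → ℝ} (hh : ∀ o, P o → h o ≤ h' o) :
    A.mean M f h ≤ A.mean M f h' := by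
  induction A generalizing r with
  | output o => exact hh o hA
  | @sample Ω p next ih =>
    have := hc.1
    have := Fintype.ofFinite Ω
    rw [mean_sample_fintype, mean_sample_fintype]
    refine Finset.sum_le_sum fun ω _ => ?_
    by_cases hω : p ω = 0
    · simp [hω]
    · exact mul_le_mul_of_nonneg_left (ih ω (hA ω hω) (hc.2 ω)) ENNReal.toReal_nonneg
  | round Q next ih => exact ih _ hA (hc.2.2 _)

/-- The sample spaces are finite by `Cost`, so `mean` is an honest finite average. In general the
`tsum` could be the default value 0, and affine maps would not pass through. -/
theorem mean_mul_add {A : AdaptiveAlgorithm E α} {q r : ℕ} (hc : A.Cost q r) (h : α → ℝ)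
    (a b : ℝ) : A.mean M f (fun o => a * h o + b) = a * A.mean M f h + b := by
  induction A generalizing r with
  | output o => rfl
  | @sample Ω p next ih =>
    have := hc.1
    have := Fintype.ofFinite Ω
    rw [mean_sample_fintype, mean_sample_fintype, Finset.mul_sum]
    calc _ = ∑ ω, (a * ((p ω).toReal * (next ω).mean M f h) + (p ω).toReal * b) :=
          Finset.sum_congr rfl fun ω _ => by rw [ih ω (hc.2 ω)]; ring
      _ = _ := by rw [Finset.sum_add_distrib, ← Finset.sum_mul, sum_toReal_pmf, one_mul]
  | round Q next ih => exact ih _ (hc.2.2 _)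

theorem mean_nonneg (A : AdaptiveAlgorithm E α) {h : α → ℝ} (hh : ∀ o, 0 ≤ h o) :
    0 ≤ A.mean M f h := by
  induction A with
  | output o => exact hh o
  | sample p next ih => exact tsum_nonneg fun ω => mul_nonneg ENNReal.toReal_nonneg (ih ω)
  | round Q next ih => exact ih _

end

/-! ### Iteration -/

/-- Run `body 0`, ..., `body (k - 1)` one after the other. -/
def loop (body : ℕ → α → AdaptiveAlgorithm E α) : ℕ → α → AdaptiveAlgorithm E α
  | 0, s => .output s
  | k + 1, s => (loop body k s).bind (body k)

theorem Cost.loop {body : ℕ → α → AdaptiveAlgorithm E α} {q r : ℕ}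
    (h : ∀ i s, (body i s).Cost q r) (k : ℕ) (s : α) : (loop body k s).Cost q (k * r) := by
  induction k with
  | zero => trivial
  | succ k ih => rw [Nat.succ_mul]; exact ih.bind (h k)

theorem Always.loop {M : Matroid E} {f : Finset E → ℝ} {body : ℕ → α → AdaptiveAlgorithm E α}
    {P : ℕ → α → Prop} {s : α} (h0 : P 0 s) {k : ℕ}
    (h : ∀ i < k, ∀ s, P i s → (body i s).Always M f (P (i + 1))) :
    (loop body k s).Always M f (P k) := by
  induction k with
  | zero => exact h0
  | succ k ih =>
    exact always_bind.2 ((ih fun i hi => h i (hi.trans k.lt_succ_self)).mono (h k k.lt_succ_self))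

/-- A submartingale argument: `Ψ` may depend on the step, and its growth in expectation is only
required at states that satisfy the invariant `P`. -/
theorem le_mean_loop {M : Matroid E} {f : Finset E → ℝ} {body : ℕ → α → AdaptiveAlgorithm E α}
    {P : ℕ → α → Prop} {Ψ : ℕ → α → ℝ} {q r : ℕ} {s : α} (hc : ∀ i s, (body i s).Cost q r)
    (h0 : P 0 s) {k : ℕ} (h : ∀ i < k, ∀ s, P i s → (body i s).Always M f (P (i + 1)))
    (hΨ : ∀ i < k, ∀ s, P i s → Ψ i s ≤ (body i s).mean M f (Ψ (i + 1))) :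
    Ψ 0 s ≤ (loop body k s).mean M f (Ψ k) := by
  induction k with
  | zero => exact le_rfl
  | succ k ih =>
    rw [AdaptiveAlgorithm.loop, mean_bind]
    exact (ih (fun i hi => h i (hi.trans k.lt_succ_self))
      fun i hi => hΨ i (hi.trans k.lt_succ_self)).trans
      ((Always.loop h0 fun i hi => h i (hi.trans k.lt_succ_self)).mean_le_mean
        (Cost.loop hc k s) (hΨ k k.lt_succ_self))

/-! ### Rounds with totalized answers, and uniform samples -/

open Classical in
/-- Submit the queries `Q`, and continue in dependence on the answers, which are extended by
`0` and `False` to the queries that have not been submitted. -/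
noncomputable def ask (Q : Finset (Query E))
    (next : (Finset E → ℝ) → (Finset E → E → Prop) → AdaptiveAlgorithm E α) :
    AdaptiveAlgorithm E α :=
  .round Q fun a => next
    (fun S => if h : .value S ∈ Q then a ⟨.value S, h⟩ else (0 : ℝ))
    (fun S e => if h : .span S e ∈ Q then a ⟨.span S e, h⟩ else False)

theorem Cost.ask {Q : Finset (Query E)}
    {next : (Finset E → ℝ) → (Finset E → E → Prop) → AdaptiveAlgorithm E α} {q r : ℕ}
    (hQ : Q.card ≤ q) (h : ∀ a b, (next a b).Cost q r) : (ask Q next).Cost q (r + 1) :=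
  ⟨hQ, Nat.le_add_left _ _, fun _ => h _ _⟩

/-- The values that are learned from the queries `Q`. -/
noncomputable def known (Q : Finset (Query E)) (f : Finset E → ℝ) (S : Finset E) : ℝ :=
  open Classical in if .value S ∈ Q then f S else 0

/-- The spans that are learned from the queries `Q`. -/
def knownSpan (Q : Finset (Query E)) (M : Matroid E) (S : Finset E) (e : E) : Prop :=
  .span S e ∈ Q ∧ e ∈ M.closure (S : Set E)

theorem answers_ask (Q : Finset (Query E)) (M : Matroid E) (f : Finset E → ℝ)
    (next : (Finset E → ℝ) → (Finset E → E → Prop) → AdaptiveAlgorithm E α) :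
    ∃ next', ask Q next = .round Q next' ∧
      (next' fun q => q.1.answer M f) = next (known Q f) (knownSpan Q M) := by
  refine ⟨_, rfl, ?_⟩
  congr 1
  funext S e
  by_cases h : Query.span S e ∈ Q <;> simp [knownSpan, h, Query.answer]

theorem mean_ask {Q : Finset (Query E)} {M : Matroid E} {f : Finset E → ℝ}
    {next : (Finset E → ℝ) → (Finset E → E → Prop) → AdaptiveAlgorithm E α} {h : α → ℝ} :
    (ask Q next).mean M f h = (next (known Q f) (knownSpan Q M)).mean M f h := by
  obtain ⟨next', h1, h2⟩ := answers_ask Q M f next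
  rw [h1, mean, h2]

theorem always_ask {Q : Finset (Query E)} {M : Matroid E} {f : Finset E → ℝ}
    {next : (Finset E → ℝ) → (Finset E → E → Prop) → AdaptiveAlgorithm E α} {P : α → Prop} :
    (ask Q next).Always M f P ↔ (next (known Q f) (knownSpan Q M)).Always M f P := by
  obtain ⟨next', h1, h2⟩ := answers_ask Q M f next
  rw [h1, Always, h2]

/-- Draw an element of a nonempty finite set uniformly at random. -/
noncomputable def unif {Ω : Type u} (s : Finset Ω) (hs : s.Nonempty)
    (next : Ω → AdaptiveAlgorithm E α) : AdaptiveAlgorithm E α :=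
  .sample (PMF.uniformOfFinset s hs) next

theorem mean_unif {Ω : Type u} [Fintype Ω] {s : Finset Ω} {hs : s.Nonempty}
    {next : Ω → AdaptiveAlgorithm E α} {M : Matroid E} {f : Finset E → ℝ} {h : α → ℝ} :
    (unif s hs next).mean M f h = (∑ ω ∈ s, (next ω).mean M f h) / s.card := by
  classical
  rw [unif, mean_sample_fintype, Finset.sum_div, ← Finset.sum_subset (Finset.subset_univ s)]
  · refine Finset.sum_congr rfl fun ω hω => ?_
    rw [PMF.uniformOfFinset_apply_of_mem _ hω]
    simp [div_eq_inv_mul]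
  · intro ω _ hω
    rw [PMF.uniformOfFinset_apply_of_notMem _ hω]
    simp

theorem always_unif {Ω : Type u} {s : Finset Ω} {hs : s.Nonempty}
    {next : Ω → AdaptiveAlgorithm E α} {M : Matroid E} {f : Finset E → ℝ} {P : α → Prop} :
    (unif s hs next).Always M f P ↔ ∀ ω ∈ s, (next ω).Always M f P := by
  rw [unif, Always]
  simp

/-! ### The distribution of the executions -/

section

variable {M : Matroid E} {f : Finset E → ℝ}

theorem Always.of_mem_support {A : AdaptiveAlgorithm E α} {P : α → Prop} (h : A.Always M f P)
    {r : Execution α} (hr : r ∈ (A.run M f).support) : P r.output := by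
  induction A generalizing r with
  | output o =>
    rw [run, PMF.mem_support_pure_iff] at hr
    rw [hr]
    exact h
  | sample p next ih =>
    rw [run, PMF.mem_support_bind_iff] at hr
    obtain ⟨ω, hω, hr⟩ := hr
    exact ih ω (h ω hω) hr
  | round Q next ih =>
    rw [run, PMF.mem_support_map_iff] at hr
    obtain ⟨r', hr', rfl⟩ := hr
    exact ih _ h (r := r') hr'

theorem Cost.of_mem_support {q : ℕ} {A : AdaptiveAlgorithm E α} {r : ℕ} (h : A.Cost q r)
    {e : Execution α} (he : e ∈ (A.run M f).support) : e.rounds ≤ r ∧ e.queries ≤ r * q := by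
  induction A generalizing r e with
  | output o =>
    rw [run, PMF.mem_support_pure_iff] at he
    simp [he]
  | sample p next ih =>
    rw [run, PMF.mem_support_bind_iff] at he
    obtain ⟨ω, hω, he⟩ := he
    exact ih ω (h.2 ω) he
  | round Q next ih =>
    rw [run, PMF.mem_support_map_iff] at he
    obtain ⟨e', he', rfl⟩ := he
    obtain ⟨h1, h2⟩ := ih _ (h.2.2 _) he'
    obtain ⟨r, rfl⟩ := Nat.exists_eq_succ_of_ne_zero (Nat.one_le_iff_ne_zero.1 h.2.1)
    have := h.1
    simp only [Nat.succ_eq_add_one, Nat.add_sub_cancel] at h1 h2 ⊢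
    exact ⟨Nat.succ_le_succ h1, by linarith⟩

theorem _root_.PMF.expect_le_of_support {α : Type*} {p : PMF α} {g : α → ℝ≥0∞} {c : ℝ≥0∞}
    (h : ∀ a ∈ p.support, g a ≤ c) : p.expect g ≤ c := by
  calc p.expect g ≤ ∑' a, p a * c := by
        refine ENNReal.tsum_le_tsum fun a => ?_
        by_cases ha : p a = 0
        · simp [ha]
        · exact mul_le_mul_right (h a ha) _
    _ = c := by rw [ENNReal.tsum_mul_right, p.tsum_coe, one_mul]

theorem Cost.expect_rounds_le {q : ℕ} {A : AdaptiveAlgorithm E α} {r : ℕ} (h : A.Cost q r)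
    {c : ℝ} (hc : (r : ℝ) ≤ c) :
    (A.run M f).expect (fun e => (e.rounds : ℝ≥0∞)) ≤ ENNReal.ofReal c := by
  refine PMF.expect_le_of_support fun e he => ?_
  rw [← ENNReal.ofReal_natCast]
  exact ENNReal.ofReal_le_ofReal ((Nat.cast_le.2 (h.of_mem_support he).1).trans hc)

theorem Cost.expect_queries_le {q : ℕ} {A : AdaptiveAlgorithm E α} {r : ℕ} (h : A.Cost q r)
    {c : ℝ} (hc : ((r * q : ℕ) : ℝ) ≤ c) :
    (A.run M f).expect (fun e => (e.queries : ℝ≥0∞)) ≤ ENNReal.ofReal c := by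
  refine PMF.expect_le_of_support fun e he => ?_
  rw [← ENNReal.ofReal_natCast]
  exact ENNReal.ofReal_le_ofReal ((Nat.cast_le.2 (h.of_mem_support he).2).trans hc)

theorem _root_.PMF.expect_bind {α β : Type*} (p : PMF α) (k : α → PMF β) (g : β → ℝ≥0∞) :
    (p.bind k).expect g = p.expect fun a => (k a).expect g := by
  simp only [PMF.expect, PMF.bind_apply, ← ENNReal.tsum_mul_right, ← ENNReal.tsum_mul_left]
  rw [ENNReal.tsum_comm]
  simp only [mul_assoc]

theorem _root_.PMF.expect_pure {α : Type*} (a : α) (g : α → ℝ≥0∞) : (PMF.pure a).expect g = g a := by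
  rw [PMF.expect, tsum_eq_single a]
  · simp
  · intro b hb
    simp [hb]

theorem _root_.PMF.expect_map {α β : Type*} (p : PMF α) (k : α → β) (g : β → ℝ≥0∞) :
    (p.map k).expect g = p.expect fun a => g (k a) := by
  rw [PMF.map, PMF.expect_bind]
  simp only [Function.comp, PMF.expect_pure]

/-- Only this inequality holds without summability: a divergent real series has `tsum` 0. It is all
that is needed, since every guarantee on the output is a lower bound for a mean. -/
theorem ofReal_mean_le_expect (A : AdaptiveAlgorithm E α) {h : α → ℝ} (hh : ∀ o, 0 ≤ h o) :
    ENNReal.ofReal (A.mean M f h) ≤ (A.run M f).expect fun e => ENNReal.ofReal (h e.output) := by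
  induction A with
  | output o => rw [run, PMF.expect_pure, mean]
  | sample p next ih =>
    rw [run, PMF.expect_bind, mean]
    have h1 : ENNReal.ofReal (∑' ω, (p ω).toReal * (next ω).mean M f h) ≤
        ∑' ω, ENNReal.ofReal ((p ω).toReal * (next ω).mean M f h) := by
      by_cases hs : Summable fun ω => (p ω).toReal * (next ω).mean M f h
      · rw [ENNReal.ofReal_tsum_of_nonneg _ hs]
        exact fun ω => mul_nonneg ENNReal.toReal_nonneg ((next ω).mean_nonneg hh)
      · rw [tsum_eq_zero_of_not_summable hs]
        simp
    refine h1.trans (ENNReal.tsum_le_tsum fun ω => ?_)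
    rw [ENNReal.ofReal_mul ENNReal.toReal_nonneg, ENNReal.ofReal_toReal (p.apply_ne_top ω)]
    exact mul_le_mul_right (ih ω) _
  | round Q next ih =>
    rw [run, PMF.expect_map, mean]
    exact ih _

/-- Since only lower bounds for means carry over to `run`, the probability of an event is bounded
through the indicator of its complement. -/
theorem toOuterMeasure_le_of_mean {A : AdaptiveAlgorithm E α} {s : Set α} [DecidablePred (· ∈ s)]
    {ε : ℝ} (h : 1 - ε ≤ A.mean M f fun o => if o ∈ s then 0 else 1) :
    (A.run M f).toOuterMeasure {e | e.output ∈ s} ≤ ENNReal.ofReal ε := by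
  have h1 := (ENNReal.ofReal_le_ofReal h).trans (A.ofReal_mean_le_expect (M := M) (f := f)
    (h := fun o => if o ∈ s then 0 else 1) fun o => by split_ifs <;> norm_num)
  set p := A.run M f
  have h2 : p.toOuterMeasure {e | e.output ∈ s} +
      p.expect (fun e => ENNReal.ofReal (if e.output ∈ s then 0 else 1)) = 1 := by
    rw [PMF.toOuterMeasure_apply, PMF.expect, ← ENNReal.tsum_add, ← p.tsum_coe]
    refine tsum_congr fun e => ?_
    by_cases he : e.output ∈ s <;> simp [he]
  have h3 : p.toOuterMeasure {e | e.output ∈ s} ≠ ⊤ :=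
    ne_top_of_le_ne_top ENNReal.one_ne_top (h2 ▸ le_self_add)
  have h4 : p.expect (fun e => ENNReal.ofReal (if e.output ∈ s then 0 else 1)) ≠ ⊤ :=
    ne_top_of_le_ne_top ENNReal.one_ne_top (h2 ▸ le_add_self)
  rw [← ENNReal.ofReal_toReal h3]
  refine ENNReal.ofReal_le_ofReal ?_
  have h5 := congrArg ENNReal.toReal h2
  rw [ENNReal.toReal_add h3 h4, ENNReal.toReal_one] at h5
  have h6 := (ENNReal.ofReal_le_iff_le_toReal h4).1 h1
  linarith

end

end AdaptiveAlgorithm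

/-! ## Monotone submodular functions and the greedy potential -/

/-- A monotone submodular set function, not necessarily normalized. -/
structure MonoSubmod {E : Type*} [DecidableEq E] (g : Finset E → ℝ) : Prop where
  monotone : ∀ S T : Finset E, S ⊆ T → g S ≤ g T
  submodular : ∀ S T : Finset E, g (S ∪ T) + g (S ∩ T) ≤ g S + g T

/-- The difference that the element `a` makes to the set `S`, to which it may belong. -/
def gain {E : Type*} [DecidableEq E] (g : Finset E → ℝ) (S : Finset E) (a : E) : ℝ :=
  g (insert a S) - g (S.erase a)

section

variable {E : Type*} [DecidableEq E] {g : Finset E → ℝ}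

theorem gain_of_notMem {S : Finset E} {a : E} (h : a ∉ S) : gain g S a = g (insert a S) - g S := by
  rw [gain, Finset.erase_eq_of_notMem h]

namespace MonoSubmod

theorem gain_nonneg (hg : MonoSubmod g) (S : Finset E) (a : E) : 0 ≤ gain g S a :=
  sub_nonneg.2 (hg.monotone _ _ ((S.erase_subset a).trans (S.subset_insert a)))

/-- Submodularity for `insert a S` and `T.erase a`, whose union and intersection are `insert a T`
and `S.erase a`. This covers the cases where `a` lies in one of the sets. -/
theorem gain_anti (hg : MonoSubmod g) {S T : Finset E} (h : S ⊆ T) (a : E) :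
    gain g T a ≤ gain g S a := by
  have h1 := hg.submodular (insert a S) (T.erase a)
  have h2 : insert a S ∪ T.erase a = insert a T := by
    ext x
    by_cases hx : x = a
    · simp [hx]
    · simp only [Finset.mem_union, Finset.mem_insert, Finset.mem_erase, hx]
      have := @h x
      tauto
  have h3 : insert a S ∩ T.erase a = S.erase a := by
    ext x
    by_cases hx : x = a
    · simp [hx]
    · simp only [Finset.mem_inter, Finset.mem_insert, Finset.mem_erase, hx]
      have := @h x
      tauto
  rw [h2, h3] at h1
  simp only [gain]
  linarith

theorem sub_le_sum_gain (hg : MonoSubmod g) (S O : Finset E) :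
    g (S ∪ O) - g S ≤ ∑ o ∈ O, gain g S o := by
  induction O using Finset.induction_on with
  | empty => simp
  | insert a O ha ih =>
    rw [Finset.sum_insert ha, Finset.union_insert]
    have h1 := hg.gain_anti (S := S) (T := S ∪ O) Finset.subset_union_left a
    have h2 : g (insert a (S ∪ O)) - g (S ∪ O) ≤ gain g (S ∪ O) a :=
      sub_le_sub_left (hg.monotone _ _ (Finset.erase_subset _ _)) _
    linarith

end MonoSubmod

/-- The potential of a set `S` at threshold `τ` in comparison with the set `O`. -/
def potential (g : Finset E → ℝ) (O : Finset E) (τ : ℝ) (S : Finset E) : ℝ :=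
  ∑ o ∈ O, max (gain g S o - τ) 0 + τ * S.card

theorem sum_gain_le_potential {O S : Finset E} {τ : ℝ} (hτ : 0 ≤ τ) :
    ∑ o ∈ O, gain g S o ≤ potential g O τ S + O.card * τ := by
  have h1 : ∑ o ∈ O, gain g S o ≤ ∑ o ∈ O, (max (gain g S o - τ) 0 + τ) :=
    Finset.sum_le_sum fun o _ => by linarith [le_max_left (gain g S o - τ) 0]
  rw [Finset.sum_add_distrib, Finset.sum_const, nsmul_eq_mul] at h1
  have : 0 ≤ τ * (S.card : ℝ) := by positivity
  rw [potential]
  linarith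

end

/-! ### Spans, independence and the change of the potential -/

namespace Matroid

variable {E : Type*} {M : Matroid E}

theorem mem_closure_finset (hM : M.E = Set.univ) {S : Finset E} {a : E} (h : a ∈ S) :
    a ∈ M.closure (S : Set E) :=
  M.subset_closure (S : Set E) (by simp [hM]) h

theorem Indep.insert_finset [DecidableEq E] (hM : M.E = Set.univ) {S : Finset E}
    (hS : M.Indep (S : Set E)) {a : E} (h : a ∉ M.closure (S : Set E)) :
    M.Indep (insert a S : Finset E) := by
  rw [Finset.coe_insert]
  exact ((hS.notMem_closure_iff (by simp [hM])).1 h).1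

theorem Indep.card_le_of_subset_closure {O S : Finset E} (hO : M.Indep (O : Set E))
    (h : (O : Set E) ⊆ M.closure (S : Set E)) : O.card ≤ S.card := by
  have h1 : M.eRk (O : Set E) ≤ M.eRk (S : Set E) := by
    rw [← M.eRk_closure_eq S]
    exact M.eRk_mono h
  rw [hO.eRk_eq_encard] at h1
  have h2 := h1.trans (M.eRk_le_encard _)
  simpa using h2

end Matroid

/-- When the threshold drops from `τ` to `τ'`, the excess of `o` grows by at most `τ - τ'`, and only
if its gain at `T` is above `τ'`. These `o` form an independent set inside the closure of `T`, so
there are at most `|T|` of them. The total growth `|T| (τ - τ')` is offset by the change from `τ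
|T|` to `τ' |T|`. -/
theorem MonoSubmod.potential_le {E : Type*} [DecidableEq E] {g : Finset E → ℝ}
    (hg : MonoSubmod g) {M : Matroid E} {O S T : Finset E} (hO : M.Indep (O : Set E))
    (hST : S ⊆ T) {τ τ' : ℝ} (hτ : τ' ≤ τ)
    (hT : ∀ a, τ' < gain g T a → a ∈ M.closure (T : Set E)) :
    potential g O τ' T ≤ potential g O τ S + τ * (T.card - S.card) := by
  have h1 : ∀ o ∈ O, max (gain g T o - τ') 0 ≤
      max (gain g S o - τ) 0 + if τ' < gain g T o then τ - τ' else 0 := by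
    intro o _
    have := hg.gain_anti hST o
    split_ifs with h
    · refine max_le ?_ (add_nonneg (le_max_right _ _) (by linarith))
      linarith [le_max_left (gain g S o - τ) 0]
    · rw [max_eq_right (by linarith), add_zero]
      exact le_max_right _ _
  have h2 := Finset.sum_le_sum h1
  rw [Finset.sum_add_distrib, ← Finset.sum_filter, Finset.sum_const, nsmul_eq_mul] at h2
  have h3 : (O.filter fun o => τ' < gain g T o).card ≤ T.card := by
    refine Matroid.Indep.card_le_of_subset_closure (M := M) (hO.subset ?_) ?_
    · exact_mod_cast Finset.filter_subset _ _
    · intro o ho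
      exact hT o (Finset.mem_filter.1 (Finset.mem_coe.1 ho)).2
  have h4 : ((O.filter fun o => τ' < gain g T o).card : ℝ) * (τ - τ') ≤ T.card * (τ - τ') :=
    mul_le_mul_of_nonneg_right (Nat.cast_le.2 h3) (by linarith)
  simp only [potential]
  linarith

/-! ### The largest gain of an element outside the span -/

/-- The largest marginal value of an element outside the span of `S`, and `0` if there is none. -/
noncomputable def topGain {E : Type*} [DecidableEq E] (sp : Finset E → E → Prop)
    (g : Finset E → ℝ) (S : Finset E) : ℝ :=
  ⨆ a : {a // ¬ sp S a}, (g (insert a.1 S) - g S)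

section

variable {E : Type*} [DecidableEq E] {sp : Finset E → E → Prop} {g : Finset E → ℝ}
  {S : Finset E}

theorem le_topGain [Finite E] {a : E} (ha : ¬ sp S a) : g (insert a S) - g S ≤ topGain sp g S :=
  le_ciSup (f := fun a : {a // ¬ sp S a} => g (insert a.1 S) - g S)
    (Set.finite_range _).bddAbove ⟨a, ha⟩

theorem topGain_le {c : ℝ} (hc : 0 ≤ c) (h : ∀ a, ¬ sp S a → g (insert a S) - g S ≤ c) :
    topGain sp g S ≤ c :=
  Real.iSup_le (fun a => h a.1 a.2) hc

theorem MonoSubmod.topGain_nonneg (hg : MonoSubmod g) : 0 ≤ topGain sp g S :=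
  Real.iSup_nonneg fun a => sub_nonneg.2 (hg.monotone _ _ (S.subset_insert a.1))

theorem exists_eq_topGain [Finite E] (h : ∃ a, ¬ sp S a) :
    ∃ a, ¬ sp S a ∧ g (insert a S) - g S = topGain sp g S := by
  have : Nonempty {a // ¬ sp S a} := let ⟨a, ha⟩ := h; ⟨⟨a, ha⟩⟩
  obtain ⟨a, ha⟩ := exists_eq_ciSup_of_finite (f := fun a : {a // ¬ sp S a} => g (insert a.1 S) - g S)
  exact ⟨a.1, a.2, ha⟩

theorem topGain_congr {sp' : Finset E → E → Prop} {g' : Finset E → ℝ}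
    (h1 : ∀ a, sp S a ↔ sp' S a) (h2 : g S = g' S) (h3 : ∀ a, g (insert a S) = g' (insert a S)) :
    topGain sp g S = topGain sp' g' S := by
  have h : sp S = sp' S := funext fun a => propext (h1 a)
  simp only [topGain, h2, h3]
  rw [h]

end

/-! ## Virtual value oracles -/

section

variable {E : Type*} [DecidableEq E] {ι : Type*} [Fintype ι]

/-- The average of the values of `f` at the sets `enc j T`. -/
noncomputable def avg (enc : ι → Finset E → Finset E) (f : Finset E → ℝ) (T : Finset E) : ℝ :=
  (∑ j, f (enc j T)) / Fintype.card ι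

open Classical in
/-- The queries that reveal which elements `S` spans, and their virtual marginal values. -/
noncomputable def probe [Fintype E] (enc : ι → Finset E → Finset E) (S : Finset E) :
    Finset (Query E) :=
  Finset.univ.image (fun a => .span S a) ∪ (Finset.univ.image (fun j => .value (enc j S)) ∪
    Finset.univ.image (fun p : ι × E => .value (enc p.1 (insert p.2 S))))

theorem card_probe_le [Fintype E] (enc : ι → Finset E → Finset E) (S : Finset E) :
    (probe enc S).card ≤ (Fintype.card ι + 1) * (Fintype.card E + 1) := by
  classical
  refine (Finset.card_union_le _ _).trans ((add_le_add Finset.card_image_le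
    ((Finset.card_union_le _ _).trans (add_le_add Finset.card_image_le
      Finset.card_image_le))).trans ?_)
  simp only [Finset.card_univ, Fintype.card_prod]
  linarith

variable [Fintype E] {enc : ι → Finset E → Finset E} {S : Finset E} {Q : Finset (Query E)}

open AdaptiveAlgorithm

theorem avg_known (h : probe enc S ⊆ Q) (f : Finset E → ℝ) :
    avg enc (known Q f) S = avg enc f S := by
  have : ∀ j, known Q f (enc j S) = f (enc j S) := fun j =>
    if_pos (h (by simp [probe]))
  simp only [avg, this]

theorem avg_known_insert (h : probe enc S ⊆ Q) (f : Finset E → ℝ) (a : E) :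
    avg enc (known Q f) (insert a S) = avg enc f (insert a S) := by
  have : ∀ j, known Q f (enc j (insert a S)) = f (enc j (insert a S)) := fun j =>
    if_pos (h (by
      simp only [probe, Finset.mem_union, Finset.mem_image]
      exact Or.inr (Or.inr ⟨(j, a), Finset.mem_univ _, rfl⟩)))
  simp only [avg, this]

theorem knownSpan_iff (h : probe enc S ⊆ Q) (M : Matroid E) (a : E) :
    knownSpan Q M S a ↔ a ∈ M.closure (S : Set E) :=
  and_iff_right (h (by simp [probe]))

end

/-! ## Adaptive sequencing -/

section

variable {E : Type*} [DecidableEq E]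

open Classical in
/-- The elements outside the span of `S` whose marginal value is at least `τ`. -/
noncomputable def candidates [Fintype E] (sp : Finset E → E → Prop) (g : Finset E → ℝ) (τ : ℝ)
    (S : Finset E) : Finset E :=
  Finset.univ.filter fun a => ¬ sp S a ∧ τ ≤ g (insert a S) - g S

open Classical in
/-- Insert the elements of the list into `S` one by one, except for those that are spanned already,
until the condition `halt` holds. -/
noncomputable def process (sp : Finset E → E → Prop) (halt : Finset E → Prop) :
    Finset E → List E → Finset E
  | S, [] => S
  | S, a :: L =>
    if halt S then S else if sp S a then process sp halt S L else process sp halt (insert a S) L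

open Classical in
/-- The queries that tell which elements of the list are spanned by `P` and the elements in front
of them. -/
noncomputable def prefixSpans : Finset E → List E → Finset (Query E)
  | _, [] => ∅
  | P, a :: L => insert (.span P a) (prefixSpans (insert a P) L)

open Classical in
/-- The sets that arise when the unspanned elements of the list are inserted into `S` one by one,
where the spans refer to `P` and all elements of the list. -/
noncomputable def prefixChain (sp : Finset E → E → Prop) :
    Finset E → Finset E → List E → Finset (Finset E)
  | _, S, [] => {S}
  | P, S, a :: L => insert S (if sp P a then prefixChain sp (insert a P) S L
      else prefixChain sp (insert a P) (insert a S) L)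

theorem card_prefixSpans_le (P : Finset E) (L : List E) :
    (prefixSpans P L).card ≤ L.length := by
  induction L generalizing P with
  | nil => simp [prefixSpans]
  | cons a L ih =>
    classical
    exact (Finset.card_insert_le _ _).trans (Nat.succ_le_succ (ih _))

theorem card_prefixChain_le (sp : Finset E → E → Prop) (P S : Finset E) (L : List E) :
    (prefixChain sp P S L).card ≤ L.length + 1 := by
  induction L generalizing P S with
  | nil => simp [prefixChain]
  | cons a L ih =>
    refine (Finset.card_insert_le _ _).trans (Nat.succ_le_succ ?_)
    split_ifs <;> exact ih _ _

theorem mem_prefixChain (sp : Finset E → E → Prop) (P S : Finset E) (L : List E) :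
    S ∈ prefixChain sp P S L := by
  cases L <;> simp [prefixChain]

theorem process_of_halt {sp : Finset E → E → Prop} {halt : Finset E → Prop} {S : Finset E}
    (h : halt S) (L : List E) : process sp halt S L = S := by
  cases L <;> simp [process, h]

-- Here `P` plays the role of `S` together with all elements read so far, including the skipped
-- ones. Skipped elements are spanned, so `P` and `S` keep the same closure, and answers about `P`,
-- which does not depend on earlier answers, decide what happens to `S`. The process visits only
-- sets of the prefix chain, so the oracles need to be correct only there.
open AdaptiveAlgorithm in
theorem process_congr {M : Matroid E} {Q : Finset (Query E)} {sp : Finset E → E → Prop}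
    {halt halt' : Finset E → Prop} {P S : Finset E} {L : List E}
    (hPS : M.closure (P : Set E) = M.closure (S : Set E)) (hQ : prefixSpans P L ⊆ Q)
    (hsp : ∀ T ∈ prefixChain (knownSpan Q M) P S L, ∀ a, sp T a ↔ a ∈ M.closure (T : Set E))
    (hhalt : ∀ T ∈ prefixChain (knownSpan Q M) P S L, halt T ↔ halt' T) :
    process sp halt S L = process (fun T a => a ∈ M.closure (T : Set E)) halt' S L := by
  induction L generalizing P S with
  | nil => rfl
  | cons a L ih =>
    have hS := mem_prefixChain (knownSpan Q M) P S (a :: L)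
    have hQ1 : Query.span P a ∈ Q := hQ (by simp [prefixSpans])
    have hQ2 : prefixSpans (insert a P) L ⊆ Q := fun x hx => hQ (by simp [prefixSpans, hx])
    have hk : knownSpan Q M P a ↔ a ∈ M.closure (S : Set E) := by
      rw [knownSpan, and_iff_right hQ1, hPS]
    have hs1 := hhalt S hS
    have hs2 := hsp S hS a
    simp only [process]
    by_cases hs : halt S
    · rw [if_pos hs, if_pos (hs1.1 hs)]
    rw [if_neg hs, if_neg (mt hs1.2 hs)]
    by_cases ha : a ∈ M.closure (S : Set E)
    · have hins : M.closure ((insert a P : Finset E) : Set E) = M.closure (S : Set E) := by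
        rw [Finset.coe_insert, Matroid.closure_insert_eq_of_mem_closure (hPS ▸ ha), hPS]
      simp only [prefixChain, hk.2 ha, if_true] at hsp hhalt
      rw [if_pos (hs2.2 ha), if_pos ha, ih hins hQ2 (fun T hT => hsp T (Finset.mem_insert_of_mem hT))
        (fun T hT => hhalt T (Finset.mem_insert_of_mem hT))]
    · have hins : M.closure ((insert a P : Finset E) : Set E) =
          M.closure ((insert a S : Finset E) : Set E) := by
        rw [Finset.coe_insert, Finset.coe_insert, Matroid.closure_insert_congr_right hPS]
      simp only [prefixChain, mt hk.1 ha, if_false] at hsp hhalt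
      rw [if_neg (mt hs2.1 ha), if_neg ha, ih hins hQ2 (fun T hT => hsp T (Finset.mem_insert_of_mem hT))
        (fun T hT => hhalt T (Finset.mem_insert_of_mem hT))]

end

section

variable {E : Type*} [Fintype E] [DecidableEq E] {M : Matroid E} {g : Finset E → ℝ}

/-- The candidates with respect to the spans in `M`. -/
noncomputable abbrev Matroid.candidates (M : Matroid E) (g : Finset E → ℝ) (τ : ℝ) (S : Finset E) :
    Finset E :=
  _root_.candidates (fun T a => a ∈ M.closure (T : Set E)) g τ S

theorem mem_candidates {τ : ℝ} {S : Finset E} {a : E} :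
    a ∈ M.candidates g τ S ↔ a ∉ M.closure (S : Set E) ∧ τ ≤ g (insert a S) - g S := by
  simp [Matroid.candidates, candidates]

theorem MonoSubmod.candidates_anti (hg : MonoSubmod g) (hM : M.E = Set.univ) (τ : ℝ)
    {S T : Finset E} (h : S ⊆ T) : M.candidates g τ T ⊆ M.candidates g τ S := by
  intro a ha
  rw [mem_candidates] at ha ⊢
  have h1 : a ∉ M.closure (S : Set E) :=
    fun h' => ha.1 (M.closure_subset_closure (Finset.coe_subset.2 h) h')
  refine ⟨h1, ha.2.trans ?_⟩
  rw [← gain_of_notMem (mt (Matroid.mem_closure_finset hM) ha.1),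
    ← gain_of_notMem (mt (Matroid.mem_closure_finset hM) h1)]
  exact hg.gain_anti h a

theorem candidates_congr {sp : Finset E → E → Prop} {g' : Finset E → ℝ} {τ : ℝ} {S : Finset E}
    (h1 : ∀ a, sp S a ↔ a ∈ M.closure (S : Set E)) (h2 : g' S = g S)
    (h3 : ∀ a, g' (insert a S) = g (insert a S)) :
    candidates sp g' τ S = M.candidates g τ S := by
  ext a
  rw [mem_candidates]
  simp only [candidates, Finset.mem_filter, Finset.mem_univ, true_and, h1, h2, h3]

end

/-! ### Random orders of the candidates -/

namespace AdaptiveAlgorithm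

variable {E : Type u} [DecidableEq E] {α : Type v}

/-- Draw up to `m` elements of `X` one after the other without replacement. -/
noncomputable def shuffle : ℕ → Finset E → (List E → AdaptiveAlgorithm E α) → AdaptiveAlgorithm E α
  | 0, _, k => k []
  | m + 1, X, k =>
    open Classical in
    if h : X.Nonempty then unif X h fun a => shuffle m (X.erase a) fun L => k (a :: L) else k []

variable {M : Matroid E} {f : Finset E → ℝ}

theorem Cost.shuffle [Finite E] {q r m : ℕ} {X : Finset E} {k : List E → AdaptiveAlgorithm E α}
    (h : ∀ L : List E, L.length ≤ m → (k L).Cost q r) : (shuffle m X k).Cost q r := by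
  induction m generalizing X k with
  | zero => exact h [] le_rfl
  | succ m ih =>
    rw [AdaptiveAlgorithm.shuffle]
    split_ifs
    · exact ⟨inferInstance, fun a => ih fun L hL => h (a :: L) (Nat.succ_le_succ hL)⟩
    · exact h [] (Nat.zero_le _)

theorem always_shuffle_of_forall {m : ℕ} {X : Finset E} {k : List E → AdaptiveAlgorithm E α}
    {P : α → Prop} (h : ∀ L, (k L).Always M f P) : (shuffle m X k).Always M f P := by
  induction m generalizing X k with
  | zero => exact h []
  | succ m ih =>
    rw [shuffle]
    split_ifs
    · exact always_unif.2 fun a _ => ih fun L => h (a :: L)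
    · exact h []

theorem mean_shuffle_of_forall [Fintype E] {m : ℕ} {X : Finset E} {k : List E → AdaptiveAlgorithm E α}
    {h : α → ℝ} {c : ℝ} (hk : ∀ L, (k L).mean M f h = c) : (shuffle m X k).mean M f h = c := by
  induction m generalizing X k with
  | zero => exact hk []
  | succ m ih =>
    rw [shuffle]
    split_ifs with hX
    · rw [mean_unif, Finset.sum_congr rfl fun a _ => ih fun L => hk (a :: L), Finset.sum_const,
        nsmul_eq_mul, mul_div_cancel_left₀]
      exact_mod_cast hX.card_ne_zero
    · exact hk []

variable [Fintype E] {g : Finset E → ℝ}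

/-- Every element that has been read is spanned and never a candidate again, so the candidates stay
inside the unread set `X`. As `X.card ≤ m`, the list can exhaust `X`; with no candidates left the
condition holds because `0 ≤ thr`. Hence the process never ends merely because the list is too
short. -/
theorem always_shuffle_process (hM : M.E = Set.univ) (hg : MonoSubmod g) {τ thr : ℝ}
    (hthr : 0 ≤ thr) {m : ℕ} {X S : Finset E} {k : List E → AdaptiveAlgorithm E α} {P : α → Prop}
    {R : Finset E → Prop}
    (hk : ∀ L, R (process (fun T a => a ∈ M.closure (T : Set E))
      (fun T => ((M.candidates g τ T).card : ℝ) ≤ thr) S L) → (k L).Always M f P)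
    (hX : X.card ≤ m) (hSX : M.candidates g τ S ⊆ X) (hS : M.Indep (S : Set E))
    (hR : ∀ T, S ⊆ T → M.Indep (T : Set E) → ((M.candidates g τ T).card : ℝ) ≤ thr → R T) :
    (shuffle m X k).Always M f P := by
  by_cases hhalt : ((M.candidates g τ S).card : ℝ) ≤ thr
  · refine always_shuffle_of_forall fun L => hk L ?_
    rw [process_of_halt hhalt]
    exact hR S subset_rfl hS hhalt
  have hne : (M.candidates g τ S).Nonempty := by
    rw [Finset.nonempty_iff_ne_empty]
    intro h
    rw [h] at hhalt
    simp [hthr] at hhalt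
  induction m generalizing X S k with
  | zero =>
    rw [Nat.le_zero, Finset.card_eq_zero] at hX
    rw [hX, Finset.subset_empty] at hSX
    simp [hSX] at hne
  | succ m ih =>
    rw [shuffle, dif_pos (hne.mono hSX), always_unif]
    intro a ha
    have hstep : ∀ T, S ⊆ T → M.Indep (T : Set E) → a ∈ M.closure (T : Set E) →
        (∀ L, process (fun T a => a ∈ M.closure (T : Set E))
          (fun T => ((M.candidates g τ T).card : ℝ) ≤ thr) S (a :: L) =
          process (fun T a => a ∈ M.closure (T : Set E))
          (fun T => ((M.candidates g τ T).card : ℝ) ≤ thr) T L) →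
        (shuffle m (X.erase a) fun L => k (a :: L)).Always M f P := by
      intro T hST hT haT hp
      by_cases hhalt' : ((M.candidates g τ T).card : ℝ) ≤ thr
      · refine always_shuffle_of_forall fun L => hk _ ?_
        rw [hp, process_of_halt hhalt']
        exact hR T hST hT hhalt'
      refine ih (fun L hL => hk _ ((hp L).symm ▸ hL)) ?_ ?_ hT
        (fun T' hT' => hR T' (hST.trans hT')) hhalt' ?_
      · rw [Finset.card_erase_of_mem ha]
        omega
      · intro b hb
        refine Finset.mem_erase.2 ⟨?_, hSX (hg.candidates_anti hM τ hST hb)⟩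
        rintro rfl
        exact (mem_candidates.1 hb).1 haT
      · rw [Finset.nonempty_iff_ne_empty]
        intro h
        rw [h] at hhalt'
        simp [hthr] at hhalt'
    by_cases haS : a ∈ M.closure (S : Set E)
    · exact hstep S subset_rfl hS haS fun L => by simp only [process, if_neg hhalt, if_pos haS]
    · exact hstep (insert a S) (Finset.subset_insert _ _) (hS.insert_finset hM haS)
        (Matroid.mem_closure_finset hM (Finset.mem_insert_self _ _))
        fun L => by simp only [process, if_neg hhalt, if_neg haS]

/-- Deferred decisions: the next element is uniform in the unread set `X`. Before the halt more than
`thr ≥ (1-δ)|X|` elements of `X` are candidates, so one draw earns at least `(1-δ) τ` on average,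
which pays for the at most one inserted element. -/
theorem le_mean_shuffle_process (hM : M.E = Set.univ) (hg : MonoSubmod g) {τ thr δ : ℝ}
    (hτ : 0 ≤ τ) {m : ℕ} {X S : Finset E} {k : List E → AdaptiveAlgorithm E α}
    {h : α → ℝ} {h' : Finset E → ℝ} (hh' : ∀ T, h' T = g T - (1 - δ) * τ * T.card)
    (hk : ∀ L, (k L).mean M f h = h' (process (fun T a => a ∈ M.closure (T : Set E))
      (fun T => ((M.candidates g τ T).card : ℝ) ≤ thr) S L))
    (hδ : δ ≤ 1) (hX : (1 - δ) * X.card ≤ thr) (hSX : M.candidates g τ S ⊆ X) :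
    h' S ≤ (shuffle m X k).mean M f h := by
  induction m generalizing X S k with
  | zero => rw [shuffle, hk]; exact le_rfl
  | succ m ih =>
    by_cases hhalt : ((M.candidates g τ S).card : ℝ) ≤ thr
    · exact (mean_shuffle_of_forall fun L => by rw [hk, process_of_halt hhalt]).ge
    rw [shuffle]
    split_ifs with hne
    swap
    · rw [hk]; exact le_rfl
    classical
    -- A spanned element is not inserted, but it is charged `(1-δ) τ` all the same; this only
    -- weakens the bound.
    have hstep : ∀ a ∈ X, h' S + ((if a ∈ M.candidates g τ S then τ else 0) - (1 - δ) * τ) ≤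
        (shuffle m (X.erase a) fun L => k (a :: L)).mean M f h := by
      intro a ha
      have hcard : (1 - δ) * ((X.erase a).card : ℝ) ≤ thr := by
        refine (mul_le_mul_of_nonneg_left ?_ (by linarith)).trans hX
        exact_mod_cast Finset.card_le_card (X.erase_subset a)
      by_cases haS : a ∈ M.closure (S : Set E)
      · have := ih (X := X.erase a) (S := S) (k := fun L => k (a :: L))
          (fun L => by rw [hk]; simp only [process, if_neg hhalt, if_pos haS]) hcard ?_
        · rw [if_neg (fun hc => (mem_candidates.1 hc).1 haS)]
          have : 0 ≤ (1 - δ) * τ := mul_nonneg (by linarith) hτ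
          linarith
        · refine fun b hb => Finset.mem_erase.2 ⟨?_, hSX hb⟩
          rintro rfl
          exact (mem_candidates.1 hb).1 haS
      · have h1 := ih (X := X.erase a) (S := insert a S) (k := fun L => k (a :: L))
          (fun L => by rw [hk]; simp only [process, if_neg hhalt, if_neg haS]) hcard ?_
        · refine le_trans ?_ h1
          rw [hh', hh', Finset.card_insert_of_notMem (mt (Matroid.mem_closure_finset hM) haS)]
          push_cast
          have h2 : (if a ∈ M.candidates g τ S then τ else 0) ≤ g (insert a S) - g S := by
            split_ifs with hc
            · exact (mem_candidates.1 hc).2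
            · exact sub_nonneg.2 (hg.monotone _ _ (S.subset_insert a))
          linarith
        · refine fun b hb => Finset.mem_erase.2 ⟨?_, hSX (hg.candidates_anti hM τ
            (Finset.subset_insert a S) hb)⟩
          rintro rfl
          exact (mem_candidates.1 hb).1
            (Matroid.mem_closure_finset hM (Finset.mem_insert_self _ _))
    have hpos : (0 : ℝ) < X.card := by exact_mod_cast hne.card_pos
    rw [mean_unif, le_div_iff₀ hpos]
    refine le_trans ?_ (Finset.sum_le_sum hstep)
    rw [Finset.sum_add_distrib, Finset.sum_sub_distrib, Finset.sum_ite_mem,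
      Finset.inter_eq_right.2 hSX]
    simp only [Finset.sum_const, nsmul_eq_mul]
    have h1 : (1 - δ) * (X.card : ℝ) * τ ≤ (M.candidates g τ S).card * τ :=
      mul_le_mul_of_nonneg_right (hX.trans (not_le.1 hhalt).le) hτ
    linarith

/-! ### One filtering step -/

variable {ι : Type*} [Fintype ι]

open Classical in
/-- Insert elements into `S` until the number of candidates at threshold `τ` has dropped by the
factor `1 - δ`. -/
noncomputable def filterStep (enc : ι → Finset E → Finset E) (δ τ : ℝ) (S : Finset E) :
    AdaptiveAlgorithm E (Finset E) :=
  ask (probe enc S) fun f₀ sp₀ =>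
    shuffle (Fintype.card E) (candidates sp₀ (avg enc f₀) τ S) fun L =>
      ask (prefixSpans S L) fun _ sp₁ =>
        ask ((prefixChain sp₁ S S L).biUnion (probe enc)) fun f₂ sp₂ =>
          output (process sp₂ (fun T => ((candidates sp₂ (avg enc f₂) τ T).card : ℝ) ≤
            (1 - δ) * (candidates sp₀ (avg enc f₀) τ S).card) S L)

theorem cost_filterStep (enc : ι → Finset E → Finset E) (δ τ : ℝ) (S : Finset E) :
    (filterStep enc δ τ S).Cost
      ((Fintype.card E + 1) * ((Fintype.card ι + 1) * (Fintype.card E + 1))) 3 := by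
  refine Cost.ask ((card_probe_le enc S).trans (Nat.le_mul_of_pos_left _ (Nat.succ_pos _)))
    fun _ _ => Cost.shuffle fun L hL => ?_
  refine Cost.ask ?_ fun _ _ => Cost.ask (r := 0) ?_ fun _ _ => trivial
  · refine (card_prefixSpans_le S L).trans (hL.trans ?_)
    exact (Nat.le_succ _).trans (Nat.le_mul_of_pos_right _ (by positivity))
  · classical
    refine (Finset.card_biUnion_le_card_mul _ _ _ fun T _ => card_probe_le enc T).trans ?_
    exact Nat.mul_le_mul_right _ ((card_prefixChain_le _ _ _ _).trans (Nat.succ_le_succ hL))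

/-- The last round has probed every set that the process can visit, so the simulated run coincides
with the true one. -/
theorem process_known (enc : ι → Finset E → Finset E) (τ thr : ℝ) (S : Finset E) (L : List E)
    {Q : Finset (Query E)}
    (hQ : ∀ T ∈ prefixChain (knownSpan (prefixSpans S L) M) S S L, probe enc T ⊆ Q) :
    process (knownSpan Q M)
      (fun T => ((candidates (knownSpan Q M) (avg enc (known Q f)) τ T).card : ℝ) ≤ thr) S L =
    process (fun T a => a ∈ M.closure (T : Set E))
      (fun T => ((M.candidates (avg enc f) τ T).card : ℝ) ≤ thr) S L := by
  refine process_congr rfl subset_rfl (fun T hT a => knownSpan_iff (hQ T hT) M a)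
    fun T hT => ?_
  rw [candidates_congr (knownSpan_iff (hQ T hT) M) (avg_known (hQ T hT) f)
    (avg_known_insert (hQ T hT) f)]

theorem always_filterStep {enc : ι → Finset E → Finset E} (hM : M.E = Set.univ)
    (hg : MonoSubmod (avg enc f)) {δ τ : ℝ} (hδ : δ ≤ 1) {S : Finset E}
    (hS : M.Indep (S : Set E)) :
    (filterStep enc δ τ S).Always M f fun T => S ⊆ T ∧ M.Indep (T : Set E) ∧
      ((M.candidates (avg enc f) τ T).card : ℝ) ≤
        (1 - δ) * (M.candidates (avg enc f) τ S).card := by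
  classical
  rw [filterStep, always_ask, candidates_congr (knownSpan_iff subset_rfl M)
    (avg_known subset_rfl f) (avg_known_insert subset_rfl f)]
  refine always_shuffle_process (R := fun T => S ⊆ T ∧ M.Indep (T : Set E) ∧
      ((M.candidates (avg enc f) τ T).card : ℝ) ≤
        (1 - δ) * (M.candidates (avg enc f) τ S).card) (τ := τ) hM hg
    (mul_nonneg (by linarith) (Nat.cast_nonneg _)) (fun L hL => ?_) (Finset.card_le_univ _)
    subset_rfl hS fun T h1 h2 h3 => ⟨h1, h2, h3⟩
  rw [always_ask, always_ask]
  rw [process_known enc τ _ S L (fun T hT => Finset.subset_biUnion_of_mem _ hT)]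
  exact hL

theorem le_mean_filterStep {enc : ι → Finset E → Finset E} (hM : M.E = Set.univ)
    (hg : MonoSubmod (avg enc f)) {δ τ : ℝ} (hδ : δ ≤ 1) (hτ : 0 ≤ τ) (S : Finset E) :
    avg enc f S - (1 - δ) * τ * S.card ≤
      (filterStep enc δ τ S).mean M f fun T => avg enc f T - (1 - δ) * τ * T.card := by
  classical
  rw [filterStep, mean_ask, candidates_congr (knownSpan_iff subset_rfl M)
    (avg_known subset_rfl f) (avg_known_insert subset_rfl f)]
  refine le_mean_shuffle_process (h' := fun T => avg enc f T - (1 - δ) * τ * T.card) (τ := τ) hM hg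
    hτ (fun T => rfl) (fun L => ?_) hδ le_rfl subset_rfl
  rw [mean_ask, mean_ask]
  rw [process_known enc τ _ S L (fun T hT => Finset.subset_biUnion_of_mem _ hT)]
  rfl

end AdaptiveAlgorithm

/-! ## Parallel greedy algorithms -/

namespace AdaptiveAlgorithm

variable {E : Type u} [Fintype E] [DecidableEq E] {ι : Type*} [Fintype ι]

/-- Insert elements of large gain, for `K` thresholds that decrease by the factor `1 - δ`, and with
`K` filtering steps for each of them. -/
noncomputable def thresholdGreedy (enc : ι → Finset E → Finset E) (δ : ℝ) (K : ℕ) :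
    AdaptiveAlgorithm E (Finset E) :=
  ask (probe enc ∅) fun f₀ sp₀ =>
    loop (fun i => loop
      (fun _ => filterStep enc δ ((1 - δ) ^ (i + 1) * topGain sp₀ (avg enc f₀) ∅)) K) K ∅

open Classical in
/-- The set `S` together with an unspanned element of largest gain, if there is one. -/
noncomputable def greedyInsert (sp : Finset E → E → Prop) (g : Finset E → ℝ) (S : Finset E) :
    Finset E :=
  if h : ∃ a, ¬ sp S a ∧ g (insert a S) - g S = topGain sp g S then insert h.choose S else S

/-- Insert an unspanned element of largest gain. -/
noncomputable def greedyStep (enc : ι → Finset E → Finset E) (S : Finset E) :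
    AdaptiveAlgorithm E (Finset E) :=
  ask (probe enc S) fun f₀ sp₀ => output (greedyInsert sp₀ (avg enc f₀) S)

open Classical in
/-- The sequential greedy algorithm if `δ` is tiny, and the algorithm with decreasing thresholds
otherwise. -/
noncomputable def parallelGreedy (enc : ι → Finset E → Finset E) (δ : ℝ) :
    AdaptiveAlgorithm E (Finset E) :=
  if δ * Fintype.card E < 1 then loop (fun _ => greedyStep enc) (Fintype.card E) ∅
  else thresholdGreedy enc δ ⌈2 * Real.log (Fintype.card E) / δ⌉₊

/-- A bound for the number of queries in one round of the greedy algorithms. -/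
abbrev greedyQueries (n N : ℕ) : ℕ := (n + 1) * ((N + 1) * (n + 1))

/-- A bound for the number of rounds of `parallelGreedy`. -/
noncomputable abbrev greedyRounds (n : ℕ) (δ : ℝ) : ℕ := ⌊64 * (Real.log n ^ 2 / δ ^ 2)⌋₊

theorem cost_thresholdGreedy (enc : ι → Finset E → Finset E) (δ : ℝ) (K : ℕ) :
    (thresholdGreedy enc δ K).Cost (greedyQueries (Fintype.card E) (Fintype.card ι))
      (K * (K * 3) + 1) :=
  Cost.ask ((card_probe_le enc ∅).trans (Nat.le_mul_of_pos_left _ (Nat.succ_pos _))) fun _ _ =>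
    Cost.loop (fun _ _ => Cost.loop (fun _ _ => cost_filterStep _ _ _ _) _ _) _ _

theorem cost_greedyStep (enc : ι → Finset E → Finset E) (S : Finset E) :
    (greedyStep enc S).Cost (greedyQueries (Fintype.card E) (Fintype.card ι)) 1 :=
  Cost.ask (r := 0) ((card_probe_le enc S).trans (Nat.le_mul_of_pos_left _ (Nat.succ_pos _)))
    fun _ _ => trivial

theorem log_two_bound {n : ℕ} (hn : 2 ≤ n) : 1 / 2 ≤ Real.log n := by
  have h1 : Real.log 2 ≤ Real.log n :=
    Real.log_le_log (by norm_num) (by exact_mod_cast hn)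
  linarith [Real.log_two_gt_d9]

theorem cost_parallelGreedy (hn : 2 ≤ Fintype.card E) (enc : ι → Finset E → Finset E) {δ : ℝ}
    (hδ : 0 < δ) (hδ' : δ < 1) :
    (parallelGreedy enc δ).Cost (greedyQueries (Fintype.card E) (Fintype.card ι))
      (greedyRounds (Fintype.card E) δ) := by
  have hlog := log_two_bound hn
  set n := Fintype.card E with hn'
  set l := Real.log n with hl
  rw [parallelGreedy]
  split_ifs with h
  · refine (Cost.loop (fun _ => cost_greedyStep enc) _ _).mono ?_
    rw [mul_one]
    refine Nat.le_floor ?_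
    rw [← mul_div_assoc, le_div_iff₀ (by positivity)]
    -- In this case `n δ < 1`, so the `n` rounds are fewer than `1/δ`.
    have h1 : (n : ℝ) * δ ^ 2 ≤ 1 := by nlinarith
    nlinarith
  · refine (cost_thresholdGreedy enc δ _).mono (Nat.le_floor ?_)
    set K := ⌈2 * l / δ⌉₊ with hK
    have h0 : 1 ≤ 2 * l / δ := by
      rw [le_div_iff₀ hδ]
      linarith
    have h1 : (K : ℝ) ≤ 4 * l / δ := by
      have := (Nat.ceil_lt_add_one (by linarith : (0 : ℝ) ≤ 2 * l / δ)).le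
      have h2 : 4 * l / δ = 2 * l / δ + 2 * l / δ := by ring
      rw [h2]
      linarith
    have h2 : (1 : ℝ) ≤ K := h0.trans (Nat.le_ceil _)
    have h3 : (K : ℝ) ^ 2 ≤ (4 * l / δ) ^ 2 := pow_le_pow_left₀ (by linarith) h1 2
    have h4 : (4 * l / δ) ^ 2 = 16 * (l ^ 2 / δ ^ 2) := by ring
    -- `3K² + 1 ≤ 4K² ≤ 64 l²/δ²`, which is the origin of the constant in `greedyRounds`.
    push_cast
    nlinarith

variable {M : Matroid E} {f : Finset E → ℝ} {enc : ι → Finset E → Finset E}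

/-- The largest gain with respect to the spans in `M`. -/
noncomputable abbrev _root_.Matroid.topGain (M : Matroid E) (g : Finset E → ℝ) (S : Finset E) : ℝ :=
  _root_.topGain (fun T a => a ∈ M.closure (T : Set E)) g S

/-- Elements of an independent set are not loops, so no gain at `∅` exceeds the first threshold. -/
theorem potential_empty_le {g : Finset E → ℝ} {O : Finset E} (hO : M.Indep (O : Set E)) :
    potential g O (M.topGain g ∅) ∅ ≤ 0 := by
  rw [potential, Finset.card_empty, Nat.cast_zero, mul_zero, add_zero]
  refine Finset.sum_nonpos fun o ho => max_le ?_ le_rfl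
  rw [gain_of_notMem (Finset.notMem_empty _)]
  refine sub_nonpos.2 (le_topGain fun h => ?_)
  have h1 := hO.notMem_closure_sdiff_of_mem (e := o) (by exact_mod_cast ho)
  exact h1 (M.closure_subset_closure (by simp) h)

/-! ### Filtering at one threshold -/

/-- After `K` steps fewer than one candidate is left. Unspanned elements of gain at least `τ` are
candidates, so there are none. -/
theorem always_level (hM : M.E = Set.univ) (hg : MonoSubmod (avg enc f)) {δ τ : ℝ} (hδ : δ ≤ 1)
    {K : ℕ} (hK : (1 - δ) ^ K * Fintype.card E < 1) {S : Finset E} (hS : M.Indep (S : Set E)) :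
    (loop (fun _ => filterStep enc δ τ) K S).Always M f fun T => S ⊆ T ∧ M.Indep (T : Set E) ∧
      ∀ a, τ ≤ gain (avg enc f) T a → a ∈ M.closure (T : Set E) := by
  have h := Always.loop (M := M) (f := f) (body := fun _ => filterStep enc δ τ)
    (P := fun i T => S ⊆ T ∧ M.Indep (T : Set E) ∧
      ((M.candidates (avg enc f) τ T).card : ℝ) ≤ (1 - δ) ^ i * Fintype.card E) (s := S)
    ⟨subset_rfl, hS, by
      rw [pow_zero, one_mul]; exact_mod_cast Finset.card_le_univ _⟩ (k := K) (by
    rintro i - T ⟨h1, h2, h3⟩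
    refine (always_filterStep hM hg hδ h2).mono ?_
    rintro T' ⟨h4, h5, h6⟩
    refine ⟨h1.trans h4, h5, h6.trans ?_⟩
    rw [pow_succ', mul_assoc]
    exact mul_le_mul_of_nonneg_left h3 (by linarith))
  refine h.mono ?_
  rintro T ⟨h1, h2, h3⟩
  refine ⟨h1, h2, fun a ha => ?_⟩
  by_contra hc
  rw [gain_of_notMem (mt (Matroid.mem_closure_finset hM) hc)] at ha
  have h4 : 0 < (M.candidates (avg enc f) τ T).card :=
    Finset.card_pos.2 ⟨a, mem_candidates.2 ⟨hc, ha⟩⟩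
  have h5 : (1 : ℝ) ≤ (M.candidates (avg enc f) τ T).card := by exact_mod_cast h4
  linarith

theorem le_mean_level (hM : M.E = Set.univ) (hg : MonoSubmod (avg enc f)) {δ τ : ℝ} (hδ : δ ≤ 1)
    (hτ : 0 ≤ τ) (K : ℕ) (S : Finset E) :
    avg enc f S - (1 - δ) * τ * S.card ≤ (loop (fun _ => filterStep enc δ τ) K S).mean M f
      fun T => avg enc f T - (1 - δ) * τ * T.card :=
  le_mean_loop (P := fun _ _ => True)
    (Ψ := fun _ T => avg enc f T - (1 - δ) * τ * T.card) (fun _ => cost_filterStep enc δ τ) trivial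
    (fun _ _ _ _ => always_of_forall fun _ => trivial)
    fun _ _ T _ => le_mean_filterStep hM hg hδ hτ T

/-! ### The guarantees -/

/-- What the greedy algorithms guarantee for `g = avg enc f`. -/
def GreedyGuarantee (M : Matroid E) (f : Finset E → ℝ) (g : Finset E → ℝ) (δ : ℝ)
    (A : AdaptiveAlgorithm E (Finset E)) : Prop :=
  A.Always M f (fun S : Finset E => M.Indep (S : Set E)) ∧
    ∀ (O : Finset E), M.Indep (O : Set E) →
      g ∅ - (1 - δ) ^ 2 * (δ * M.topGain g ∅) ≤
        A.mean M f fun S => g S - (1 - δ) ^ 2 * ∑ o ∈ O, gain g S o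

/-- `g S - (1-δ)² potential` does not decrease in expectation from level to level. One factor `1-δ`
is the loss of sequencing. The other arises because an insertion raises the potential by up to the
old threshold `τ`, whereas elements are inserted at the new threshold `(1-δ) τ`. -/
theorem guarantee_thresholdGreedy (hM : M.E = Set.univ) (hg : MonoSubmod (avg enc f)) {δ : ℝ}
    (hδ : 0 < δ) (hδ' : δ < 1) {K : ℕ} (hK : (1 - δ) ^ K * Fintype.card E < 1)
    (hK' : (1 - δ) ^ K * Fintype.card E ≤ δ) :
    GreedyGuarantee M f (avg enc f) δ (thresholdGreedy enc δ K) := by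
  set g := avg enc f with hg'
  set Δ := M.topGain g ∅ with hΔ
  have hΔ0 : 0 ≤ Δ := hg.topGain_nonneg
  have hΔ' : topGain (knownSpan (probe enc ∅) M) (avg enc (known (probe enc ∅) f)) ∅ = Δ :=
    topGain_congr (fun a => knownSpan_iff subset_rfl M a) (avg_known subset_rfl f)
      (avg_known_insert subset_rfl f)
  set body : ℕ → Finset E → AdaptiveAlgorithm E (Finset E) :=
    fun i => loop (fun _ => filterStep enc δ ((1 - δ) ^ (i + 1) * Δ)) K with hbody
  have hind : ∀ i < K, ∀ S : Finset E, M.Indep (S : Set E) →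
      (body i S).Always M f fun S : Finset E => M.Indep (S : Set E) := fun i _ S hS =>
    (always_level hM hg hδ'.le hK hS).mono fun T hT => hT.2.1
  have hcost : ∀ i S, (body i S).Cost (greedyQueries (Fintype.card E) (Fintype.card ι)) (K * 3) :=
    fun i S => Cost.loop (fun _ _ => cost_filterStep _ _ _ _) _ _
  have h0 : M.Indep ((∅ : Finset E) : Set E) := by simp
  have hall : (loop body K ∅).Always M f fun S : Finset E => M.Indep (S : Set E) :=
    Always.loop (P := fun _ (S : Finset E) => M.Indep (S : Set E)) h0 hind
  refine ⟨by rw [thresholdGreedy, always_ask, hΔ']; exact hall, fun O hO => ?_⟩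
  rw [thresholdGreedy, mean_ask, hΔ']
  have hmain := le_mean_loop (P := fun _ (S : Finset E) => M.Indep (S : Set E))
    (Ψ := fun i S => g S - (1 - δ) ^ 2 * potential g O ((1 - δ) ^ i * Δ) S) hcost h0 hind (by
    intro i _ S hS
    set τ := (1 - δ) ^ i * Δ with hτ
    have hτ0 : 0 ≤ τ := mul_nonneg (pow_nonneg (by linarith) _) hΔ0
    have hτ' : (1 - δ) ^ (i + 1) * Δ = (1 - δ) * τ := by rw [hτ, pow_succ']; ring
    have hτ1 : (1 - δ) * τ ≤ τ := by nlinarith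
    simp only [hbody, hτ']
    have h1 := le_mean_level (K := K) hM hg hδ'.le (τ := (1 - δ) * τ)
      (mul_nonneg (by linarith) hτ0) S
    have h2 := (always_level (τ := (1 - δ) * τ) hM hg hδ'.le hK hS).mean_le_mean
      (q := greedyQueries (Fintype.card E) (Fintype.card ι)) (r := K * 3)
      (h := fun T => 1 * (avg enc f T - (1 - δ) * ((1 - δ) * τ) * T.card) +
        ((1 - δ) ^ 2 * (τ * S.card - potential g O τ S)))
      (h' := fun T => g T - (1 - δ) ^ 2 * potential g O ((1 - δ) * τ) T)
      (Cost.loop (fun _ _ => cost_filterStep _ _ _ _) _ _) (by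
        rintro T ⟨hT1, hT2, hT3⟩
        have h3 := hg.potential_le hO hT1 hτ1 fun a ha => hT3 a ha.le
        have h4 := mul_le_mul_of_nonneg_left h3 (sq_nonneg (1 - δ))
        linarith)
    rw [mean_mul_add (q := greedyQueries (Fintype.card E) (Fintype.card ι)) (r := K * 3)
      (Cost.loop (fun _ _ => cost_filterStep _ _ _ _) _ _)] at h2
    linarith)
  -- The elements of `O` may each keep a gain up to the last threshold, altogether at most `n
  -- (1-δ)^K Δ ≤ δ Δ`.
  have hfin := hall.mean_le_mean (Cost.loop hcost K ∅)
    (h := fun S => g S - (1 - δ) ^ 2 * potential g O ((1 - δ) ^ K * Δ) S)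
    (h' := fun S => 1 * (g S - (1 - δ) ^ 2 * ∑ o ∈ O, gain g S o) + (1 - δ) ^ 2 * (δ * Δ)) (by
      intro S _
      have h1 := sum_gain_le_potential (g := g) (O := O) (S := S) (τ := (1 - δ) ^ K * Δ)
        (mul_nonneg (pow_nonneg (by linarith) _) hΔ0)
      have h2 : (O.card : ℝ) * ((1 - δ) ^ K * Δ) ≤ δ * Δ := by
        have h3 : (O.card : ℝ) ≤ Fintype.card E := by exact_mod_cast O.card_le_univ
        have h4 : (1 - δ) ^ K * (O.card : ℝ) ≤ δ :=
          (mul_le_mul_of_nonneg_left h3 (pow_nonneg (by linarith) _)).trans hK'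
        calc _ = (1 - δ) ^ K * (O.card : ℝ) * Δ := by ring
          _ ≤ _ := mul_le_mul_of_nonneg_right h4 hΔ0
      have h5 := mul_le_mul_of_nonneg_left (h1.trans (add_le_add_right h2 _)) (sq_nonneg (1 - δ))
      linarith)
  rw [mean_mul_add (Cost.loop hcost K ∅)] at hfin
  have h1 := mul_le_mul_of_nonneg_left (potential_empty_le (g := g) hO) (sq_nonneg (1 - δ))
  simp only [pow_zero, one_mul] at hmain
  simp only [hΔ] at h1 hmain hfin ⊢
  linarith

theorem greedyStep_eq (enc : ι → Finset E → Finset E) (M : Matroid E) (f : Finset E → ℝ)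
    (S : Finset E) : ∃ T : Finset E,
      (∀ P, (greedyStep enc S).Always M f P ↔ P T) ∧ (∀ h, (greedyStep enc S).mean M f h = h T) ∧
      ((∀ a, a ∈ M.closure (S : Set E)) ∧ T = S ∨ ∃ a, a ∉ M.closure (S : Set E) ∧
        avg enc f (insert a S) - avg enc f S = M.topGain (avg enc f) S ∧ T = insert a S) := by
  refine ⟨greedyInsert (knownSpan (probe enc S) M) (avg enc (known (probe enc S) f)) S,
    fun P => ?_, fun h => ?_, ?_⟩
  · rw [greedyStep, always_ask, Always]
  · rw [greedyStep, mean_ask, mean]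
  · have h1 := knownSpan_iff (enc := enc) (S := S) subset_rfl M
    have h2 : topGain (knownSpan (probe enc S) M) (avg enc (known (probe enc S) f)) S =
        M.topGain (avg enc f) S :=
      topGain_congr h1 (avg_known subset_rfl f) (avg_known_insert subset_rfl f)
    rw [greedyInsert]
    split_ifs with h
    · refine Or.inr ⟨h.choose, ?_, ?_, rfl⟩
      · exact mt (h1 _).2 h.choose_spec.1
      · have := h.choose_spec.2
        generalize h.choose = b at this ⊢
        rwa [avg_known subset_rfl, avg_known_insert subset_rfl, h2] at this
    · refine Or.inl ⟨fun a => ?_, rfl⟩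
      by_contra ha
      obtain ⟨b, hb⟩ := exists_eq_topGain (sp := knownSpan (probe enc S) M)
        (g := avg enc (known (probe enc S) f)) (S := S) ⟨a, mt (h1 a).1 ha⟩
      exact h ⟨b, hb⟩

/-- The same potential argument with the current largest gain as threshold: an insertion earns
exactly that threshold, so nothing is lost. Every step inserts an element unless the set is
spanning, so after `n` steps everything is spanned and the threshold is 0. -/
theorem guarantee_sequentialGreedy (hM : M.E = Set.univ) (hg : MonoSubmod (avg enc f)) {δ : ℝ}
    (hδ : 0 < δ) (hδ' : δ < 1) :
    GreedyGuarantee M f (avg enc f) δ (loop (fun _ => greedyStep enc) (Fintype.card E) ∅) := by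
  set g := avg enc f with hg'
  set P : ℕ → Finset E → Prop := fun i S =>
    M.Indep (S : Set E) ∧ (i ≤ S.card ∨ ∀ a, a ∈ M.closure (S : Set E)) with hP
  have h0 : P 0 ∅ := ⟨by simp, Or.inl (Nat.zero_le _)⟩
  have hind : ∀ i < Fintype.card E, ∀ S : Finset E, P i S →
      (greedyStep enc S).Always M f (P (i + 1)) := by
    intro i _ S hS
    obtain ⟨T, h1, -, h3⟩ := greedyStep_eq enc M f S
    rw [h1]
    obtain ⟨h3, rfl⟩ | ⟨a, h3, -, rfl⟩ := h3
    · exact ⟨hS.1, Or.inr h3⟩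
    · refine ⟨hS.1.insert_finset hM h3, Or.inl ?_⟩
      rw [Finset.card_insert_of_notMem (mt (Matroid.mem_closure_finset hM) h3)]
      exact Nat.succ_le_succ (hS.2.resolve_right fun h => h3 (h a))
  have hall := Always.loop (M := M) (f := f) h0 hind
  refine ⟨hall.mono fun S hS => hS.1, fun O hO => ?_⟩
  have hcost : ∀ (i : ℕ) S, (greedyStep enc S).Cost
    (greedyQueries (Fintype.card E) (Fintype.card ι)) 1 := fun _ => cost_greedyStep enc
  have hmain := le_mean_loop
    (Ψ := fun _ S => g S - potential g O (M.topGain g S) S) hcost h0 hind (by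
      intro i _ S hS
      obtain ⟨T, -, h2, h3⟩ := greedyStep_eq enc M f S
      rw [h2]
      obtain ⟨h3, rfl⟩ | ⟨a, h3, h4, rfl⟩ := h3
      · exact le_rfl
      have haS := mt (Matroid.mem_closure_finset hM) h3
      have h5 := hg.potential_le hO (Finset.subset_insert a S) (τ := M.topGain g S)
        (τ' := M.topGain g (insert a S)) ?_ ?_
      · rw [Finset.card_insert_of_notMem haS] at h5
        push_cast at h5
        rw [← hg'] at h4
        linarith
      · refine topGain_le hg.topGain_nonneg fun b hb => ?_
        have hb' : b ∉ M.closure (S : Set E) := fun h => hb (M.closure_subset_closure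
          (by exact_mod_cast Finset.subset_insert a S) h)
        refine le_trans ?_ (le_topGain hb')
        rw [← gain_of_notMem (mt (Matroid.mem_closure_finset hM) hb),
          ← gain_of_notMem (mt (Matroid.mem_closure_finset hM) hb')]
        exact hg.gain_anti (Finset.subset_insert a S) b
      · intro b hb
        by_contra hc
        rw [gain_of_notMem (mt (Matroid.mem_closure_finset hM) hc)] at hb
        exact (le_topGain hc).not_gt hb)
  have hfin := hall.mean_le_mean (Cost.loop hcost _ ∅)
    (h := fun S => g S - potential g O (M.topGain g S) S)
    (h' := fun S => g S - (1 - δ) ^ 2 * ∑ o ∈ O, gain g S o) (by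
      rintro S ⟨-, hS⟩
      have hS' : ∀ a, a ∈ M.closure (S : Set E) := by
        refine hS.elim (fun h a => ?_) id
        rw [(Finset.card_eq_iff_eq_univ S).1 (le_antisymm S.card_le_univ h)]
        exact Matroid.mem_closure_finset hM (Finset.mem_univ a)
      have h1 : M.topGain g S = 0 :=
        le_antisymm (topGain_le le_rfl fun a ha => (ha (hS' a)).elim) hg.topGain_nonneg
      have h2 := sum_gain_le_potential (g := g) (O := O) (S := S) (le_refl (0 : ℝ))
      have h3 : 0 ≤ ∑ o ∈ O, gain g S o := Finset.sum_nonneg fun o _ => hg.gain_nonneg S o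
      have h4 : (1 - δ) ^ 2 ≤ 1 := pow_le_one₀ (by linarith) (by linarith)
      have h5 := mul_le_mul_of_nonneg_right h4 h3
      rw [h1]
      linarith)
  have h1 := potential_empty_le (g := g) hO
  have h2 : 0 ≤ (1 - δ) ^ 2 * (δ * M.topGain g ∅) :=
    mul_nonneg (sq_nonneg _) (mul_nonneg hδ.le hg.topGain_nonneg)
  linarith

theorem guarantee_parallelGreedy (hn : 2 ≤ Fintype.card E) (hM : M.E = Set.univ)
    (hg : MonoSubmod (avg enc f)) {δ : ℝ} (hδ : 0 < δ) (hδ' : δ < 1) :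
    GreedyGuarantee M f (avg enc f) δ (parallelGreedy enc δ) := by
  rw [parallelGreedy]
  split_ifs with h
  · exact guarantee_sequentialGreedy hM hg hδ hδ'
  have hn0 : (0 : ℝ) < Fintype.card E := by
    exact_mod_cast (by omega : 0 < Fintype.card E)
  have hn2 : (2 : ℝ) ≤ Fintype.card E := by exact_mod_cast hn
  set n : ℝ := (Fintype.card E : ℝ) with hn'
  set K := ⌈2 * Real.log n / δ⌉₊ with hK
  have h1 : (1 - δ) ^ K ≤ 1 / n ^ 2 := by
    have h2 : 2 * Real.log n ≤ δ * K := by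
      rw [← div_le_iff₀' hδ]
      exact Nat.le_ceil _
    calc (1 - δ) ^ K ≤ (Real.exp (-δ)) ^ K :=
          pow_le_pow_left₀ (by linarith) (Real.one_sub_le_exp_neg δ) _
      _ = Real.exp (-(δ * K)) := by rw [← Real.exp_nat_mul]; ring_nf
      _ ≤ Real.exp (-(2 * Real.log n)) := Real.exp_le_exp.2 (by linarith)
      _ = 1 / n ^ 2 := by
        rw [Real.exp_neg, two_mul, Real.exp_add, Real.exp_log hn0, one_div, sq]
  -- One factor `n` of `n²` absorbs the size of the ground set. The remaining `1/n` is below 1, and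
  -- at most `δ` by the case distinction in `parallelGreedy`.
  have h2 : (1 - δ) ^ K * n ≤ 1 / n := by
    calc (1 - δ) ^ K * n ≤ 1 / n ^ 2 * n := mul_le_mul_of_nonneg_right h1 hn0.le
      _ = 1 / n := by field_simp
  refine guarantee_thresholdGreedy hM hg hδ hδ' (h2.trans_lt ?_) (h2.trans ?_)
  · rw [div_lt_one hn0]
    linarith
  · rw [div_le_iff₀ hn0]
    exact not_lt.1 h

end AdaptiveAlgorithm

/-! ## The multilinear extension at averages of independent sets -/

/-- The fundamental circuit of `e` in `B₂` without `e` spans `e`, but `B₁ \ {e}` does not. So some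
other element of the circuit lies outside the closure of `B₁ \ {e}`, and it can be exchanged with
`e` in both bases. -/
theorem Matroid.IsBase.symm_exchange {E : Type*} {M : Matroid E} {B₁ B₂ : Set E}
    (h₁ : M.IsBase B₁) (h₂ : M.IsBase B₂) {e : E} (he : e ∈ B₁) (he' : e ∉ B₂) :
    ∃ f, f ∈ B₂ ∧ f ∉ B₁ ∧ M.IsBase (insert f (B₁ \ {e})) ∧ M.IsBase (insert e (B₂ \ {f})) := by
  have heE := h₁.subset_ground he
  have hC := h₂.fundCircuit_isCircuit heE he'
  have heC := M.mem_fundCircuit e B₂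
  have h3 : e ∉ M.closure (B₁ \ {e}) := h₁.indep.notMem_closure_sdiff_of_mem he
  have h4 : e ∈ M.closure (M.fundCircuit e B₂ \ {e}) := hC.mem_closure_sdiff_singleton_of_mem heC
  obtain ⟨f, hf, hf'⟩ : ∃ f ∈ M.fundCircuit e B₂ \ {e}, f ∉ M.closure (B₁ \ {e}) := by
    by_contra! h
    exact h3 (M.closure_subset_closure_of_subset_closure h h4)
  have hfe : f ≠ e := hf.2
  have hf2 : f ∈ B₂ := (M.fundCircuit_subset_insert e B₂ hf.1).resolve_left hfe
  have hf1 : f ∉ B₁ := fun h => hf' (M.mem_closure_of_mem' ⟨h, hfe⟩ (h₁.subset_ground h))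
  refine ⟨f, hf2, hf1, h₁.exchange_base_of_notMem_closure he hf' (h₂.subset_ground hf2), ?_⟩
  refine h₂.exchange_isBase_of_indep he' ?_
  have h5 := (h₂.indep.mem_fundCircuit_iff (by rwa [h₂.closure_eq]) he').1 hf.1
  rwa [Set.insert_sdiff_singleton_comm (Ne.symm hfe)]

/-! ### Sets picked by uniformly random indices -/

section

variable {E : Type*} [DecidableEq E] {κ : Type*}

/-- The set of elements `e` that belong to the member of the family with index `u e`. -/
def pick [Fintype E] (I : κ → Finset E) (u : E → κ) : Finset E := Finset.univ.filter fun e => e ∈ I (u e)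

theorem mem_pick [Fintype E] {I : κ → Finset E} {u : E → κ} {e : E} : e ∈ pick I u ↔ e ∈ I (u e) := by
  simp [pick]

/-- The expected value of `f` at the set that is picked with uniformly random indices. -/
noncomputable def pickMean [Fintype E] [Fintype κ] (f : Finset E → ℝ) (I : κ → Finset E) : ℝ :=
  (∑ u : E → κ, f (pick I u)) / Fintype.card (E → κ)

variable [DecidableEq κ]

/-- Apply the transposition of `c` and `d` to the coordinate `o`. -/
def coordSwap (o : E) (c d : κ) : (E → κ) ≃ (E → κ) :=
  Equiv.piCongrRight fun e => if e = o then Equiv.swap c d else Equiv.refl κ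

theorem coordSwap_self (o : E) (c d : κ) (u : E → κ) :
    coordSwap o c d u o = Equiv.swap c d (u o) := by
  simp [coordSwap]

theorem coordSwap_of_ne {o e : E} (h : e ≠ o) (c d : κ) (u : E → κ) :
    coordSwap o c d u e = u e := by
  simp [coordSwap, h]

variable [Fintype E] [Fintype κ]

/-- Independence: `φ` ignores the coordinate `o`, and transposing two values of this coordinate
shows that all values contribute equally. -/
theorem sum_indicator_coord {φ : (E → κ) → ℝ} {o : E}
    (hφ : ∀ u v : E → κ, (∀ e, e ≠ o → u e = v e) → φ u = φ v) (k : κ) :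
    (Fintype.card κ : ℝ) * ∑ u : E → κ, (if u o = k then φ u else 0) = ∑ u, φ u := by
  have h1 : ∀ c : κ, ∑ u : E → κ, (if u o = c then φ u else 0) =
      ∑ u : E → κ, (if u o = k then φ u else 0) := by
    intro c
    rw [← Equiv.sum_comp (coordSwap o c k)]
    refine Finset.sum_congr rfl fun u _ => ?_
    rw [hφ (coordSwap o c k u) u fun e he => coordSwap_of_ne he c k u, coordSwap_self]
    have : Equiv.swap c k (u o) = c ↔ u o = k := by
      rw [← Equiv.eq_symm_apply]
      simp
    simp only [this]
  have h2 : ∑ c : κ, ∑ u : E → κ, (if u o = c then φ u else 0) = ∑ u, φ u := by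
    rw [Finset.sum_comm]
    simp
  rw [← h2, Finset.sum_congr rfl fun c _ => h1 c]
  simp

omit [DecidableEq κ] in
theorem pickMean_mono {f : Finset E → ℝ} (hf : ∀ S T, S ⊆ T → f S ≤ f T) {I J : κ → Finset E}
    (h : ∀ k, I k ⊆ J k) : pickMean f I ≤ pickMean f J := by
  refine div_le_div_of_nonneg_right (Finset.sum_le_sum fun u _ => hf _ _ fun e he => ?_)
    (Nat.cast_nonneg _)
  rw [mem_pick] at he ⊢
  exact h _ he

/-- Only index vectors with `u o = k` notice whether `o` is in the set with index `k`, and this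
event, of probability `1/|κ|`, is independent of the gain of `o`. -/
theorem pickMean_insert_sub_erase (f : Finset E → ℝ) (I : κ → Finset E) (k : κ) (T : Finset E)
    (o : E) :
    pickMean f (Function.update I k (insert o T)) - pickMean f (Function.update I k (T.erase o)) =
      (∑ u : E → κ, gain f (pick (Function.update I k T) u) o) / Fintype.card (E → κ) /
        Fintype.card κ := by
  have hκ : (0 : ℝ) < Fintype.card κ := by exact_mod_cast Fintype.card_pos_iff.2 ⟨k⟩
  have h1 : ∀ u : E → κ, f (pick (Function.update I k (insert o T)) u) -
      f (pick (Function.update I k (T.erase o)) u) =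
      if u o = k then gain f (pick (Function.update I k T) u) o else 0 := by
    intro u
    split_ifs with h
    · rw [gain]
      congr 2 <;>
      · ext e
        simp only [mem_pick, Finset.mem_insert, Finset.mem_erase]
        by_cases he : e = o
        · subst he
          simp [h]
        · by_cases hk : u e = k <;> simp [he, hk, Function.update]
    · rw [sub_eq_zero]
      congr 1
      ext e
      simp only [mem_pick]
      by_cases he : e = o
      · subst he
        simp [h, Function.update]
      · by_cases hk : u e = k <;> simp [he, hk, Function.update]
  have h2 : ∀ u v : E → κ, (∀ e, e ≠ o → u e = v e) →
      gain f (pick (Function.update I k T) u) o = gain f (pick (Function.update I k T) v) o := by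
    intro u v huv
    rw [gain, gain]
    congr 2 <;>
    · ext e
      simp only [mem_pick, Finset.mem_insert, Finset.mem_erase]
      by_cases he : e = o
      · simp [he]
      · simp [he, huv e he]
  rw [pickMean, pickMean, ← sub_div, ← Finset.sum_sub_distrib,
    Finset.sum_congr rfl fun u _ => h1 u, ← sum_indicator_coord h2 k, div_right_comm,
    mul_div_cancel_left₀ _ hκ.ne']

/-- Adding the elements of `O` to the set with index `k` recovers a fraction of the distance to
the value of `O`. -/
theorem MonoSubmod.le_sum_pickMean {f : Finset E → ℝ} (hf : MonoSubmod f) (I : κ → Finset E)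
    (k : κ) (T O : Finset E) :
    (f O - pickMean f (Function.update I k T)) / Fintype.card κ ≤
      ∑ o ∈ O, (pickMean f (Function.update I k (insert o T)) -
        pickMean f (Function.update I k (T.erase o))) := by
  have : Nonempty κ := ⟨k⟩
  simp only [pickMean_insert_sub_erase]
  rw [← Finset.sum_div, ← Finset.sum_div, Finset.sum_comm]
  refine div_le_div_of_nonneg_right ?_ (Nat.cast_nonneg _)
  have hpos : (0 : ℝ) < Fintype.card (E → κ) := by exact_mod_cast Fintype.card_pos
  rw [le_div_iff₀ hpos, pickMean, sub_mul, div_mul_cancel₀ _ hpos.ne']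
  have h1 : f O * (Fintype.card (E → κ) : ℝ) = ∑ _u : E → κ, f O := by
    simp [mul_comm]
  rw [h1, ← Finset.sum_sub_distrib]
  refine Finset.sum_le_sum fun u _ => le_trans ?_ (hf.sub_le_sum_gain _ O)
  exact sub_le_sub_right (hf.monotone _ _ Finset.subset_union_right) _

/-- This bounds the first threshold of a stage by about `OPT / l`, so its contribution to the error
is small even after `l` stages. -/
theorem MonoSubmod.pickMean_singleton_le {f : Finset E → ℝ} (hf : MonoSubmod f)
    (I : κ → Finset E) (k : κ) (e : E) :
    pickMean f (Function.update I k {e}) - pickMean f (Function.update I k ∅) ≤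
      (f {e} - f ∅) / Fintype.card κ := by
  have : Nonempty κ := ⟨k⟩
  have h := pickMean_insert_sub_erase f I k ∅ e
  rw [Finset.erase_empty, insert_empty_eq] at h
  rw [h]
  refine div_le_div_of_nonneg_right ?_ (Nat.cast_nonneg _)
  have hpos : (0 : ℝ) < Fintype.card (E → κ) := by exact_mod_cast Fintype.card_pos
  rw [div_le_iff₀ hpos]
  have h1 : ∀ u : E → κ, gain f (pick (Function.update I k ∅) u) e ≤ f {e} - f ∅ := fun u => by
    refine (hf.gain_anti (Finset.empty_subset _) e).trans (le_of_eq ?_)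
    rw [gain_of_notMem (Finset.notMem_empty e), insert_empty_eq]
  refine (Finset.sum_le_sum fun u _ => h1 u).trans (le_of_eq ?_)
  simp
  ring

/-! ### The multilinear extension on the matroid polytope is at most the optimum -/
omit [DecidableEq κ] [Fintype κ] in
theorem pick_eq {I : κ → Finset E} {u : E → κ} {i j : E} {A : Finset E} (hi : i ∉ A) (hj : j ∉ A)
    (h : ∀ e, e ≠ i → e ≠ j → (e ∈ A ↔ e ∈ I (u e))) :
    pick I u = A ∪ (if i ∈ I (u i) then {i} else ∅) ∪ (if j ∈ I (u j) then {j} else ∅) := by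
  ext e
  rw [mem_pick]
  by_cases hei : e = i
  · subst hei
    by_cases hej : e = j
    · subst hej
      split_ifs <;> simp_all
    · split_ifs <;> simp_all
  · by_cases hej : e = j
    · subst hej
      split_ifs <;> simp_all
    · rw [← h e hei hej]
      split_ifs <;> simp [hei, hej]

set_option linter.unusedSimpArgs false in
/-- Exchanging `i` and `j` in one of two sets, chosen at random, does not decrease the expected
value. -/
theorem MonoSubmod.two_mul_pickMean_le {f : Finset E → ℝ} (hf : MonoSubmod f) {I : κ → Finset E}
    {p q : κ} {i j : E} (hip : i ∈ I p) (hiq : i ∉ I q) (hjq : j ∈ I q) (hjp : j ∉ I p) :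
    2 * pickMean f I ≤ pickMean f (Function.update I p (insert j ((I p).erase i))) +
      pickMean f (Function.update I q (insert i ((I q).erase j))) := by
  have hpq : p ≠ q := by rintro rfl; exact hiq hip
  have hij : i ≠ j := by rintro rfl; exact hiq hjq
  set I₁ := Function.update I p (insert j ((I p).erase i)) with hI₁
  set I₂ := Function.update I q (insert i ((I q).erase j)) with hI₂
  have hi₁ : ∀ c, i ∈ I₁ c ↔ i ∈ I c ∧ c ≠ p := fun c => by
    by_cases hc : c = p <;> simp [hI₁, hc, hij]
  have hj₁ : ∀ c, j ∈ I₁ c ↔ j ∈ I c ∨ c = p := fun c => by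
    by_cases hc : c = p <;> simp [hI₁, hc]
  have hi₂ : ∀ c, i ∈ I₂ c ↔ i ∈ I c ∨ c = q := fun c => by
    by_cases hc : c = q <;> simp [hI₂, hc]
  have hj₂ : ∀ c, j ∈ I₂ c ↔ j ∈ I c ∧ c ≠ q := fun c => by
    by_cases hc : c = q <;> simp [hI₂, hc, hij.symm]
  have he₁ : ∀ e, e ≠ i → e ≠ j → ∀ c, e ∈ I₁ c ↔ e ∈ I c := fun e hei hej c => by
    by_cases hc : c = p <;> simp [hI₁, hc, hei, hej]
  have he₂ : ∀ e, e ≠ i → e ≠ j → ∀ c, e ∈ I₂ c ↔ e ∈ I c := fun e hei hej c => by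
    by_cases hc : c = q <;> simp [hI₂, hc, hei, hej]
  set D : (E → κ) → ℝ := fun u => f (pick I₁ u) + f (pick I₂ u) - 2 * f (pick I u) with hD
  -- This is convexity in the exchange direction, checked on the four vectors obtained by swapping
  -- `p` and `q` at `i` and at `j`. If both `u i` and `u j` are in `{p, q}`, then `I` adds `∅`,
  -- `{i}`, `{j}`, `{i, j}` to `A` once each, while `I₁` always adds `{j}` and `I₂` always `{i}`;
  -- submodularity compares them. In all other cases the sum is 0.
  have hpoint : ∀ u : E → κ, 0 ≤ D u + D (coordSwap i p q u) + D (coordSwap j p q u) +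
      D (coordSwap i p q (coordSwap j p q u)) := by
    intro u
    set A := (pick I u).filter fun e => e ≠ i ∧ e ≠ j with hA
    have hiA : i ∉ A := by simp [hA]
    have hjA : j ∉ A := by simp [hA]
    have hpick : ∀ J : κ → Finset E, (∀ e, e ≠ i → e ≠ j → ∀ c, e ∈ J c ↔ e ∈ I c) →
        ∀ v : E → κ, (∀ e, e ≠ i → e ≠ j → v e = u e) → pick J v =
          A ∪ (if i ∈ J (v i) then {i} else ∅) ∪ (if j ∈ J (v j) then {j} else ∅) := by
      intro J hJ v hv
      refine pick_eq hiA hjA fun e hei hej => ?_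
      rw [hJ e hei hej, hv e hei hej, hA, Finset.mem_filter, mem_pick]
      simp [hei, hej]
    have hDv : ∀ v : E → κ, (∀ e, e ≠ i → e ≠ j → v e = u e) → D v =
        f (A ∪ (if i ∈ I (v i) ∧ v i ≠ p then {i} else ∅) ∪
          (if j ∈ I (v j) ∨ v j = p then {j} else ∅)) +
        f (A ∪ (if i ∈ I (v i) ∨ v i = q then {i} else ∅) ∪
          (if j ∈ I (v j) ∧ v j ≠ q then {j} else ∅)) -
        2 * f (A ∪ (if i ∈ I (v i) then {i} else ∅) ∪ (if j ∈ I (v j) then {j} else ∅)) := by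
      intro v hv
      simp only [hD, hpick I₁ he₁ v hv, hpick I₂ he₂ v hv,
        hpick I (fun _ _ _ _ => Iff.rfl) v hv, hi₁, hj₁, hi₂, hj₂]
    have hsub : f (A ∪ {i} ∪ {j}) + f (A ∪ ∅ ∪ ∅) ≤ f (A ∪ {i} ∪ ∅) + f (A ∪ ∅ ∪ {j}) := by
      have h := hf.submodular (A ∪ {i}) (A ∪ {j})
      have h1 : A ∪ {i} ∪ (A ∪ {j}) = A ∪ {i} ∪ {j} := by
        ext e; simp only [Finset.mem_union]; tauto
      have h2 : (A ∪ {i}) ∩ (A ∪ {j}) = A := by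
        ext e
        simp only [Finset.mem_inter, Finset.mem_union, Finset.mem_singleton]
        constructor
        · rintro ⟨h3 | h3, h4 | h4⟩
          all_goals first | assumption | exact (hij (h3.symm.trans h4)).elim
        · exact fun h => ⟨Or.inl h, Or.inl h⟩
      rw [h1, h2] at h
      simpa using h
    rw [hDv u fun _ _ _ => rfl, hDv (coordSwap i p q u) fun e hei _ => coordSwap_of_ne hei p q u,
      hDv (coordSwap j p q u) fun e _ hej => coordSwap_of_ne hej p q u,
      hDv (coordSwap i p q (coordSwap j p q u)) fun e hei hej => by
        rw [coordSwap_of_ne hei, coordSwap_of_ne hej]]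
    simp only [coordSwap_self, coordSwap_of_ne hij, coordSwap_of_ne hij.symm]
    generalize u i = a
    generalize u j = b
    by_cases hap : a = p
    · subst hap
      by_cases hba : b = a
      · subst hba
        simp only [Equiv.swap_apply_left, hip, hiq, hjq, hjp, hpq, hpq.symm, ne_eq, not_true_eq_false,
          not_false_eq_true, and_true, and_false, or_true, or_false, true_or, false_or, if_true,
          if_false, and_self, or_self]
        linarith
      by_cases hbq : b = q
      · subst hbq
        simp only [Equiv.swap_apply_left, Equiv.swap_apply_right, hip, hiq, hjq, hjp, hpq, hpq.symm,
          ne_eq, not_true_eq_false, not_false_eq_true, and_true, and_false, or_true, or_false,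
          true_or, false_or, if_true, if_false, and_self, or_self]
        linarith
      · simp only [Equiv.swap_apply_left, Equiv.swap_apply_of_ne_of_ne hba hbq, hip, hiq, hpq,
          hpq.symm, hba, hbq, ne_eq, not_true_eq_false, not_false_eq_true, and_true, and_false,
          or_true, or_false, true_or, false_or, if_true, if_false, and_self, or_self]
        linarith
    by_cases haq : a = q
    · subst haq
      by_cases hbp : b = p
      · subst hbp
        simp only [Equiv.swap_apply_left, Equiv.swap_apply_right, hip, hiq, hjq, hjp, hpq, hpq.symm,
          ne_eq, not_true_eq_false, not_false_eq_true, and_true, and_false, or_true, or_false,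
          true_or, false_or, if_true, if_false, and_self, or_self]
        linarith
      by_cases hba : b = a
      · subst hba
        simp only [Equiv.swap_apply_right, hip, hiq, hjq, hjp, hpq, hpq.symm, ne_eq,
          not_true_eq_false, not_false_eq_true, and_true, and_false, or_true, or_false, true_or,
          false_or, if_true, if_false, and_self, or_self]
        linarith
      · simp only [Equiv.swap_apply_right, Equiv.swap_apply_of_ne_of_ne hbp hba, hip, hiq, hpq,
          hpq.symm, hbp, hba, ne_eq, not_true_eq_false, not_false_eq_true, and_true, and_false,
          or_true, or_false, true_or, false_or, if_true, if_false, and_self, or_self]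
        linarith
    · by_cases hbp : b = p
      · subst hbp
        simp only [Equiv.swap_apply_left, Equiv.swap_apply_of_ne_of_ne hap haq, hjq, hjp, hpq,
          hpq.symm, hap, haq, ne_eq, not_true_eq_false, not_false_eq_true, and_true, and_false,
          or_true, or_false, true_or, false_or, if_true, if_false, and_self, or_self]
        linarith
      by_cases hbq : b = q
      · subst hbq
        simp only [Equiv.swap_apply_right, Equiv.swap_apply_of_ne_of_ne hap haq, hjq, hjp, hpq,
          hpq.symm, hap, haq, ne_eq, not_true_eq_false, not_false_eq_true, and_true, and_false,
          or_true, or_false, true_or, false_or, if_true, if_false, and_self, or_self]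
        linarith
      · simp only [Equiv.swap_apply_of_ne_of_ne hap haq, Equiv.swap_apply_of_ne_of_ne hbp hbq, hap,
          haq, hbp, hbq, ne_eq, not_false_eq_true, and_true, or_false]
        linarith
  have hsum : 0 ≤ ∑ u, D u := by
    have h := Finset.sum_nonneg fun u (_ : u ∈ Finset.univ) => hpoint u
    rw [Finset.sum_add_distrib, Finset.sum_add_distrib, Finset.sum_add_distrib,
      Equiv.sum_comp (coordSwap i p q) D, Equiv.sum_comp (coordSwap j p q) D,
      Equiv.sum_comp (coordSwap j p q) fun u => D (coordSwap i p q u),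
      Equiv.sum_comp (coordSwap i p q) D] at h
    linarith
  rw [hD, Finset.sum_sub_distrib, Finset.sum_add_distrib, ← Finset.mul_sum] at hsum
  rw [pickMean, pickMean, pickMean, ← mul_div_assoc, ← add_div]
  exact div_le_div_of_nonneg_right (by linarith) (Nat.cast_nonneg _)

/-- The number of sets of the family that contain `e`. -/
def coverCount (I : κ → Finset E) (e : E) : ℤ := ∑ k, if e ∈ I k then 1 else 0

omit [Fintype E] in
theorem coverCount_update (I : κ → Finset E) (p : κ) (T : Finset E) (e : E) :
    coverCount (Function.update I p T) e =
      coverCount I e - (if e ∈ I p then 1 else 0) + (if e ∈ T then 1 else 0) := by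
  rw [coverCount, coverCount, ← Finset.add_sum_erase _ _ (Finset.mem_univ p),
    ← Finset.add_sum_erase Finset.univ (fun k => if e ∈ I k then (1 : ℤ) else 0)
      (Finset.mem_univ p), Function.update_self]
  rw [Finset.sum_congr rfl fun k hk => by rw [Function.update_of_ne (Finset.ne_of_mem_erase hk)]]
  ring

theorem sum_sq_coverCount_exchange {I : κ → Finset E} {p : κ} {i j : E} (hip : i ∈ I p)
    (hjp : j ∉ I p) :
    ∑ e, coverCount (Function.update I p (insert j ((I p).erase i))) e ^ 2 =
      ∑ e, coverCount I e ^ 2 + 2 * (coverCount I j - coverCount I i) + 2 := by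
  have hij : i ≠ j := by rintro rfl; exact hjp hip
  have h : ∀ e, coverCount (Function.update I p (insert j ((I p).erase i))) e ^ 2 =
      coverCount I e ^ 2 + (if e = j then 2 * coverCount I e + 1 else 0) +
        (if e = i then 1 - 2 * coverCount I e else 0) := by
    intro e
    rw [coverCount_update]
    by_cases hei : e = i
    · subst hei
      simp only [hip, hij, Finset.mem_insert, Finset.mem_erase, if_true, if_false, ne_eq,
        not_true_eq_false, false_and, or_false]
      ring
    · by_cases hej : e = j
      · subst hej
        simp only [hjp, hei, Finset.mem_insert, if_true, if_false, true_or]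
        ring
      · simp [hei, hej]
  rw [Finset.sum_congr rfl fun e _ => h e, Finset.sum_add_distrib, Finset.sum_add_distrib]
  simp only [Finset.sum_ite_eq', Finset.mem_univ, if_true]
  ring

omit [DecidableEq κ] in
/-- For independent sets, the expected value of the set that is picked at random is at most the
largest value of an independent set. -/
theorem pickMean_le_opt [Nonempty κ] {f : Finset E → ℝ} (hf : MonoSubmod f) {M : Matroid E}
    {I : κ → Finset E} (hI : ∀ k, M.Indep (I k : Set E)) : pickMean f I ≤ opt M f := by
  classical
  have hbase : ∀ k, ∃ B : Finset E, M.IsBase (B : Set E) ∧ I k ⊆ B := fun k => by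
    obtain ⟨B, hB, hIB⟩ := (hI k).exists_isBase_superset
    refine ⟨B.toFinset, by rwa [Set.coe_toFinset], ?_⟩
    intro e he
    exact Set.mem_toFinset.2 (hIB he)
  choose B hB hIB using hbase
  refine (pickMean_mono hf.monotone hIB).trans ?_
  set s : Finset (κ → Finset E) := Finset.univ.filter fun J => ∀ k, M.IsBase (J k : Set E) with hs
  obtain ⟨J₀, hJ₀, hmax₀⟩ := s.exists_max_image (pickMean f) ⟨B, by simpa [hs] using hB⟩
  obtain ⟨J, hJ, hmax⟩ := (s.filter fun J => pickMean f J = pickMean f J₀).exists_max_image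
    (fun J => ∑ e, coverCount J e ^ 2) ⟨J₀, by simp [hJ₀]⟩
  obtain ⟨hJs, hJv⟩ := Finset.mem_filter.1 hJ
  have hJb : ∀ k, M.IsBase (J k : Set E) := (Finset.mem_filter.1 hJs).2
  have hupd : ∀ k (T : Finset E), M.IsBase (T : Set E) → Function.update J k T ∈ s := by
    intro k T hT
    refine Finset.mem_filter.2 ⟨Finset.mem_univ _, fun k' => ?_⟩
    by_cases hk : k' = k
    · subst hk; rwa [Function.update_self]
    · rw [Function.update_of_ne hk]; exact hJb k'
  -- If two bases of the family differ, the two opposite exchanges have average value at least the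
  -- maximum, so both attain it. Their changes to the sum of squared cover counts add up to 4, so
  -- one of them is an increase, against the second maximality of `J`.
  have hsub : ∀ p q, J p ⊆ J q := by
    intro p q i hip
    by_contra hiq
    obtain ⟨j, hjq, hjp, h1, h2⟩ := (hJb p).symm_exchange (hJb q)
      (Finset.mem_coe.2 hip) (mt Finset.mem_coe.1 hiq)
    rw [Finset.mem_coe] at hjq hjp
    have h1' := hupd p (insert j ((J p).erase i))
      (by rwa [Finset.coe_insert, Finset.coe_erase])
    have h2' := hupd q (insert i ((J q).erase j))
      (by rwa [Finset.coe_insert, Finset.coe_erase])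
    have h3 := hf.two_mul_pickMean_le hip hiq hjq hjp
    have h4 := hmax₀ _ h1'
    have h5 := hmax₀ _ h2'
    have h6 := hmax _ (Finset.mem_filter.2 ⟨h1', by linarith⟩)
    have h7 := hmax _ (Finset.mem_filter.2 ⟨h2', by linarith⟩)
    simp only [sum_sq_coverCount_exchange hip hjp, sum_sq_coverCount_exchange hjq hiq] at h6 h7
    linarith
  obtain ⟨k⟩ := ‹Nonempty κ›
  have hval : pickMean f J = f (J k) := by
    have : ∀ u : E → κ, pick J u = J k := fun u => by
      ext e
      rw [mem_pick]
      exact ⟨fun h => hsub _ _ h, fun h => hsub _ _ h⟩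
    have hpos : (Fintype.card (E → κ) : ℝ) ≠ 0 := by
      have : Nonempty κ := ⟨k⟩
      exact_mod_cast Fintype.card_ne_zero
    rw [pickMean, Finset.sum_congr rfl fun u _ => by rw [this u], Finset.sum_const,
      Finset.card_univ, nsmul_eq_mul, mul_div_cancel_left₀ _ hpos]
  calc pickMean f B ≤ pickMean f J₀ := hmax₀ B (by simpa [hs] using hB)
    _ = f (J k) := by rw [← hJv, hval]
    _ ≤ opt M f := (opt_isGreatest M f).2 ⟨J k, (hJb k).indep, rfl⟩

end

/-- The average of finitely many sets. -/
noncomputable def ConvexCombination.uniform {E : Type*} {l : ℕ} (hl : 0 < l)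
    (I : Fin l → Finset E) : ConvexCombination E where
  size := l
  sets := I
  weight := fun _ => 1 / l
  weight_nonneg := fun _ => by positivity
  weight_sum := by
    have : (l : ℝ) ≠ 0 := by exact_mod_cast hl.ne'
    simp [this]

/-- The picked set contains each `e` independently, with probability the fraction of the sets that
contain `e`. This fraction is the coordinate of the average, so the truncation at 1 is inactive. -/
theorem multilinear_uniform {E : Type*} [Fintype E] [DecidableEq E] {l : ℕ} (hl : 0 < l)
    (f : Finset E → ℝ) (I : Fin l → Finset E) :
    multilinear f (ConvexCombination.uniform hl I).point = pickMean f I := by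
  have hl0 : (0 : ℝ) < l := by exact_mod_cast hl
  have hpoint : ∀ e, (ConvexCombination.uniform hl I).point e =
      ((Finset.univ.filter fun k => e ∈ I k).card : ℝ) / l := by
    intro e
    change ∑ i : Fin l, 1 / (l : ℝ) * (if e ∈ I i then 1 else 0) = _
    rw [← Finset.mul_sum, Finset.sum_boole]
    ring
  have hmin : ∀ e, min ((ConvexCombination.uniform hl I).point e) 1 =
      ((Finset.univ.filter fun k => e ∈ I k).card : ℝ) / l := by
    intro e
    rw [hpoint, min_eq_left]
    rw [div_le_one hl0]
    have := Finset.card_le_univ (Finset.univ.filter fun k => e ∈ I k)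
    rw [Fintype.card_fin] at this
    exact_mod_cast this
  have hcompl : ∀ e, 1 - ((Finset.univ.filter fun k => e ∈ I k).card : ℝ) / l =
      ((Finset.univ.filter fun k => e ∉ I k).card : ℝ) / l := by
    intro e
    have h := Finset.card_filter_add_card_filter_not (s := (Finset.univ : Finset (Fin l)))
      (fun k => e ∈ I k)
    rw [Finset.card_univ, Fintype.card_fin] at h
    have h' : ((Finset.univ.filter fun k => e ∈ I k).card : ℝ) +
      (Finset.univ.filter fun k => e ∉ I k).card = l := by exact_mod_cast h
    rw [eq_div_iff hl0.ne', sub_mul, div_mul_cancel₀ _ hl0.ne']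
    linarith
  have hcount : ∀ S : Finset E, ((∏ e ∈ S, ((Finset.univ.filter fun k => e ∈ I k).card : ℝ) / l) *
      ∏ e ∈ Sᶜ, ((Finset.univ.filter fun k => e ∉ I k).card : ℝ) / l) =
      ((Finset.univ.filter fun u : E → Fin l => pick I u = S).card : ℝ) /
        Fintype.card (E → Fin l) := by
    intro S
    have h1 : (Finset.univ.filter fun u : E → Fin l => pick I u = S) =
        Fintype.piFinset fun e => if e ∈ S then Finset.univ.filter fun k => e ∈ I k
          else Finset.univ.filter fun k => e ∉ I k := by
      ext u
      simp only [Finset.mem_filter, Finset.mem_univ, true_and, Fintype.mem_piFinset,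
        Finset.ext_iff, mem_pick]
      refine forall_congr' fun e => ?_
      by_cases he : e ∈ S <;> simp [he]
    rw [h1, Fintype.card_piFinset, Nat.cast_prod, ← Finset.prod_mul_prod_compl S]
    have h2 : ∏ e ∈ S, ((if e ∈ S then Finset.univ.filter fun k => e ∈ I k
          else Finset.univ.filter fun k => e ∉ I k).card : ℝ) =
        ∏ e ∈ S, ((Finset.univ.filter fun k => e ∈ I k).card : ℝ) :=
      Finset.prod_congr rfl fun e he => by rw [if_pos he]
    have h3 : ∏ e ∈ Sᶜ, ((if e ∈ S then Finset.univ.filter fun k => e ∈ I k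
          else Finset.univ.filter fun k => e ∉ I k).card : ℝ) =
        ∏ e ∈ Sᶜ, ((Finset.univ.filter fun k => e ∉ I k).card : ℝ) :=
      Finset.prod_congr rfl fun e he => by rw [if_neg (Finset.mem_compl.1 he)]
    rw [h2, h3, Finset.prod_div_distrib, Finset.prod_div_distrib, div_mul_div_comm]
    congr 1
    rw [Finset.prod_const, Finset.prod_const, ← pow_add, Finset.card_add_card_compl]
    simp
  simp only [multilinear, hmin, hcompl, hcount]
  rw [pickMean, Finset.sum_div, ← Finset.sum_fiberwise (s := Finset.univ) (g := pick I)]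
  refine Finset.sum_congr rfl fun S _ => ?_
  rw [Finset.sum_congr rfl fun u hu => by rw [(Finset.mem_filter.1 hu).2], Finset.sum_const,
    nsmul_eq_mul]
  ring

/-! ## Concentration of empirical means -/

/-- The Chernoff bound in counting form, with exponential parameter `t/2`. The condition `t ≤ 2`
keeps the exponents in `[-1, 1]`, where `exp x ≤ 1 + x + x²`. -/
theorem card_sum_ge_le {U : Type*} [Fintype U] (h : U → ℝ) (hsum : ∑ u, h u = 0)
    (hb : ∀ u, |h u| ≤ 1) (N : ℕ) {t : ℝ} (ht : 0 ≤ t) (ht' : t ≤ 2) :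
    ((Finset.univ.filter fun ω : Fin N → U => N * t ≤ ∑ j, h (ω j)).card : ℝ) ≤
      Real.exp (-(N * t ^ 2 / 4)) * (Fintype.card U : ℝ) ^ N := by
  have h1 : ∑ u, Real.exp (t / 2 * h u) ≤ Fintype.card U * Real.exp (t ^ 2 / 4) := by
    have h2 : ∀ u, Real.exp (t / 2 * h u) ≤ t / 2 * h u + (1 + t ^ 2 / 4) := by
      intro u
      have h3 : |t / 2 * h u| ≤ 1 := by
        rw [abs_mul, abs_of_nonneg (by linarith : 0 ≤ t / 2)]
        calc t / 2 * |h u| ≤ 1 * 1 :=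
              mul_le_mul (by linarith) (hb u) (abs_nonneg _) zero_le_one
          _ = 1 := one_mul 1
      have h4 := (abs_le.1 (Real.abs_exp_sub_one_sub_id_le h3)).2
      have h5 : (t / 2 * h u) ^ 2 ≤ t ^ 2 / 4 := by
        have h6 : h u ^ 2 ≤ 1 := (sq_le_one_iff_abs_le_one _).2 (hb u)
        calc (t / 2 * h u) ^ 2 = t ^ 2 / 4 * h u ^ 2 := by ring
          _ ≤ t ^ 2 / 4 * 1 := mul_le_mul_of_nonneg_left h6 (by positivity)
          _ = _ := mul_one _
      linarith
    refine (Finset.sum_le_sum fun u _ => h2 u).trans ?_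
    rw [Finset.sum_add_distrib, ← Finset.mul_sum, hsum, mul_zero, zero_add, Finset.sum_const,
      nsmul_eq_mul, Finset.card_univ]
    refine mul_le_mul_of_nonneg_left ?_ (Nat.cast_nonneg _)
    linarith [Real.add_one_le_exp (t ^ 2 / 4)]
  have h2 : ∑ ω : Fin N → U, Real.exp (t / 2 * ∑ j, h (ω j)) =
      (∑ u, Real.exp (t / 2 * h u)) ^ N := by
    rw [Finset.sum_pow', Fintype.piFinset_univ]
    refine Finset.sum_congr rfl fun ω _ => ?_
    rw [Finset.mul_sum, Real.exp_sum]
  have h3 : ((Finset.univ.filter fun ω : Fin N → U => N * t ≤ ∑ j, h (ω j)).card : ℝ) *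
      Real.exp (t / 2 * (N * t)) ≤ ∑ ω : Fin N → U, Real.exp (t / 2 * ∑ j, h (ω j)) := by
    rw [← nsmul_eq_mul, ← Finset.sum_const]
    refine (Finset.sum_le_sum fun ω hω => ?_).trans (Finset.sum_le_univ_sum_of_nonneg
      (s := Finset.univ.filter fun ω : Fin N → U => N * t ≤ ∑ j, h (ω j))
      fun ω => (Real.exp_pos _).le)
    exact Real.exp_le_exp.2 (mul_le_mul_of_nonneg_left (Finset.mem_filter.1 hω).2 (by linarith))
  rw [h2] at h3
  have h4 : (∑ u, Real.exp (t / 2 * h u)) ^ N ≤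
      (Fintype.card U : ℝ) ^ N * Real.exp (N * (t ^ 2 / 4)) := by
    refine (pow_le_pow_left₀ (Finset.sum_nonneg fun u _ => (Real.exp_pos _).le) h1 N).trans
      (le_of_eq ?_)
    rw [mul_pow, ← Real.exp_nat_mul]
  rw [← le_div_iff₀ (Real.exp_pos _)] at h3
  refine h3.trans ((div_le_div_of_nonneg_right h4 (Real.exp_pos _).le).trans (le_of_eq ?_))
  rw [mul_div_assoc, ← Real.exp_sub, mul_comm]
  ring_nf

section

variable {E : Type*} [Fintype E] [DecidableEq E] {κ : Type*} [Fintype κ] {N : ℕ}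

/-- The empirical mean of `f` at the sets that are picked with the indices `ω j`. -/
noncomputable def sampleMean (f : Finset E → ℝ) (ω : Fin N → E → κ) (I : κ → Finset E) : ℝ :=
  (∑ j, f (pick I (ω j))) / N

theorem card_deviation_le [Nonempty κ] {f : Finset E → ℝ} {I : κ → Finset E} {B : ℝ}
    (h0 : ∀ u, 0 ≤ f (pick I u)) (hB : ∀ u, f (pick I u) ≤ B) (hN : 0 < N) {t : ℝ} (ht : 0 < t)
    (ht' : t ≤ 2) :
    ((Finset.univ.filter fun ω : Fin N → E → κ =>
      t * B < |sampleMean f ω I - pickMean f I|).card : ℝ) ≤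
      2 * Real.exp (-(N * t ^ 2 / 4)) * Fintype.card (Fin N → E → κ) := by
  have hcard : (0 : ℝ) < Fintype.card (E → κ) := by exact_mod_cast Fintype.card_pos
  have hN' : (0 : ℝ) < N := by exact_mod_cast hN
  have hm0 : 0 ≤ pickMean f I := div_nonneg (Finset.sum_nonneg fun u _ => h0 u) hcard.le
  have hmB : pickMean f I ≤ B := by
    rw [pickMean, div_le_iff₀ hcard]
    refine (Finset.sum_le_sum fun u _ => hB u).trans (le_of_eq ?_)
    rw [Finset.sum_const, nsmul_eq_mul, mul_comm, Finset.card_univ]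
  -- The summands are normalized by `B`, so `B = 0`, where all values vanish, is separate.
  obtain hB0 | hB0 := (hm0.trans hmB).eq_or_lt
  · rw [Finset.filter_false_of_mem, Finset.card_empty, Nat.cast_zero]
    · positivity
    · intro ω _
      have h1 : ∀ u, f (pick I u) = 0 := fun u => le_antisymm (hB0 ▸ hB u) (h0 u)
      have h2 : pickMean f I = 0 := le_antisymm (hB0 ▸ hmB) hm0
      have h3 : sampleMean f ω I = 0 := by simp [sampleMean, h1]
      simp [h2, h3, ← hB0]
  have hsum : ∑ u : E → κ, (f (pick I u) - pickMean f I) / B = 0 := by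
    rw [← Finset.sum_div, Finset.sum_sub_distrib, Finset.sum_const, nsmul_eq_mul, Finset.card_univ,
      pickMean, mul_div_cancel₀ _ hcard.ne', sub_self, zero_div]
  have habs : ∀ u : E → κ, |(f (pick I u) - pickMean f I) / B| ≤ 1 := fun u => by
    rw [abs_div, abs_of_pos hB0, div_le_one hB0, abs_le]
    exact ⟨by linarith [h0 u], by linarith [hB u]⟩
  have hsample : ∀ ω : Fin N → E → κ, ∑ j, (f (pick I (ω j)) - pickMean f I) / B =
      N * ((sampleMean f ω I - pickMean f I) / B) := fun ω => by
    rw [← Finset.sum_div, Finset.sum_sub_distrib, Finset.sum_const, nsmul_eq_mul, Finset.card_univ,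
      Fintype.card_fin, sampleMean]
    field_simp
  have h1 := card_sum_ge_le _ hsum habs N ht.le ht'
  have h2 := card_sum_ge_le (fun u => -((f (pick I u) - pickMean f I) / B))
    (by rw [Finset.sum_neg_distrib, hsum, neg_zero]) (fun u => by rw [abs_neg]; exact habs u) N
    ht.le ht'
  have hc : (Fintype.card (Fin N → E → κ) : ℝ) = (Fintype.card (E → κ) : ℝ) ^ N := by
    rw [Fintype.card_fun, Fintype.card_fin, Nat.cast_pow]
  classical
  have hsub : (Finset.univ.filter fun ω : Fin N → E → κ =>
      t * B < |sampleMean f ω I - pickMean f I|) ⊆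
      (Finset.univ.filter fun ω : Fin N → E → κ =>
        N * t ≤ ∑ j, (f (pick I (ω j)) - pickMean f I) / B) ∪
      (Finset.univ.filter fun ω : Fin N → E → κ =>
        N * t ≤ ∑ j, -((f (pick I (ω j)) - pickMean f I) / B)) := by
    intro ω hω
    rw [Finset.mem_filter] at hω
    rw [Finset.mem_union, Finset.mem_filter, Finset.mem_filter, Finset.sum_neg_distrib, hsample,
      ← mul_neg, mul_le_mul_iff_right₀ hN', mul_le_mul_iff_right₀ hN', le_div_iff₀ hB0, ← neg_div,
      le_div_iff₀ hB0]
    exact (lt_abs.1 hω.2).imp (fun h => ⟨Finset.mem_univ _, h.le⟩) fun h => ⟨Finset.mem_univ _, h.le⟩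
  have h3 := (Nat.cast_le (α := ℝ)).2 ((Finset.card_le_card hsub).trans (Finset.card_union_le _ _))
  rw [hc]
  push_cast at h3
  linarith

/-- The empirical means approximate the expected values for all families of sets without loops. -/
def GoodSample (M : Matroid E) (f : Finset E → ℝ) (η : ℝ) (ω : Fin N → E → κ) : Prop :=
  ∀ I : κ → Finset E, (∀ k, ∀ e ∈ I k, e ∉ M.closure ∅) →
    |sampleMean f ω I - pickMean f I| ≤ η

omit [Fintype E] in
theorem IsMonotoneSubmodular.monoSubmod {f : Finset E → ℝ} (hf : IsMonotoneSubmodular f) :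
    MonoSubmod f := ⟨hf.monotone, hf.submodular⟩

omit [Fintype E] in
theorem IsMonotoneSubmodular.nonneg {f : Finset E → ℝ} (hf : IsMonotoneSubmodular f)
    (S : Finset E) : 0 ≤ f S :=
  hf.normalized ▸ hf.monotone ∅ S (Finset.empty_subset S)

omit [DecidableEq E] in
theorem le_opt {M : Matroid E} {f : Finset E → ℝ} {I : Finset E} (h : M.Indep (I : Set E)) :
    f I ≤ opt M f :=
  (opt_isGreatest M f).2 ⟨I, h, rfl⟩

theorem singleton_le_opt {M : Matroid E} (hM : M.E = Set.univ) (f : Finset E → ℝ) {e : E}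
    (he : e ∉ M.closure ∅) : f {e} ≤ opt M f := by
  refine le_opt ?_
  have h := Matroid.Indep.insert_finset hM (S := ∅) (by simp) (a := e) (by simpa using he)
  simpa using h

/-- A nonloop is an independent singleton, hence worth at most `OPT`. The value of a loop is not
controlled by `OPT`, which is why `GoodSample` excludes loops. -/
theorem IsMonotoneSubmodular.le_card_mul_opt {M : Matroid E} (hM : M.E = Set.univ)
    {f : Finset E → ℝ} (hf : IsMonotoneSubmodular f) {S : Finset E}
    (hS : ∀ e ∈ S, e ∉ M.closure ∅) : f S ≤ Fintype.card E * opt M f := by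
  have h0 : 0 ≤ opt M f := (hf.nonneg ∅).trans (le_opt (by simp))
  have h1 := hf.monoSubmod.sub_le_sum_gain ∅ S
  rw [Finset.empty_union, hf.normalized, sub_zero] at h1
  refine h1.trans ((Finset.sum_le_card_nsmul S _ (opt M f) fun e he => ?_).trans ?_)
  · rw [gain_of_notMem (Finset.notMem_empty e), hf.normalized, sub_zero, insert_empty_eq]
    exact singleton_le_opt hM f (hS e he)
  · rw [nsmul_eq_mul]
    exact mul_le_mul_of_nonneg_right (by exact_mod_cast S.card_le_univ) h0

-- A union bound over at most `2^(n|κ|) ≤ exp (n|κ|)` families. The choice of `N` leaves `2 exp (-1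
-- - 1/δ) ≤ exp (-1/δ) ≤ δ`.
open Classical in
theorem card_not_goodSample_le [Nonempty κ] {M : Matroid E} (hM : M.E = Set.univ)
    {f : Finset E → ℝ} (hf : IsMonotoneSubmodular f) {t δ : ℝ} (ht : 0 < t) (ht' : t ≤ 2)
    (hδ : 0 < δ)
    (hN : 4 / t ^ 2 * (Fintype.card E * Fintype.card κ + 1 + 1 / δ) ≤ N) :
    ((Finset.univ.filter fun ω : Fin N → E → κ =>
      ¬ GoodSample M f (t * (Fintype.card E * opt M f)) ω).card : ℝ) ≤
      δ * Fintype.card (Fin N → E → κ) := by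
  have hN0 : 0 < N := by
    have : (0 : ℝ) < N := lt_of_lt_of_le (by positivity) hN
    exact_mod_cast this
  set s : Finset (κ → Finset E) := Finset.univ.filter fun I => ∀ k, ∀ e ∈ I k, e ∉ M.closure ∅
  have hsub : (Finset.univ.filter fun ω : Fin N → E → κ =>
      ¬ GoodSample M f (t * (Fintype.card E * opt M f)) ω) ⊆
      s.biUnion fun I => Finset.univ.filter fun ω : Fin N → E → κ =>
        t * (Fintype.card E * opt M f) < |sampleMean f ω I - pickMean f I| := by
    intro ω hω
    have h := (Finset.mem_filter.1 hω).2
    rw [GoodSample] at h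
    push Not at h
    obtain ⟨I, hI, hI'⟩ := h
    exact Finset.mem_biUnion.2 ⟨I, Finset.mem_filter.2 ⟨Finset.mem_univ _, hI⟩,
      Finset.mem_filter.2 ⟨Finset.mem_univ _, hI'⟩⟩
  have hdev : ∀ I ∈ s, ((Finset.univ.filter fun ω : Fin N → E → κ =>
      t * (Fintype.card E * opt M f) < |sampleMean f ω I - pickMean f I|).card : ℝ) ≤
      2 * Real.exp (-(N * t ^ 2 / 4)) * Fintype.card (Fin N → E → κ) := by
    intro I hI
    refine card_deviation_le (fun u => hf.nonneg _) (fun u => hf.le_card_mul_opt hM ?_) hN0 ht ht'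
    exact fun e he => (Finset.mem_filter.1 hI).2 _ e (mem_pick.1 he)
  have h1 : ((Finset.univ.filter fun ω : Fin N → E → κ =>
      ¬ GoodSample M f (t * (Fintype.card E * opt M f)) ω).card : ℝ) ≤
      s.card * (2 * Real.exp (-(N * t ^ 2 / 4)) * Fintype.card (Fin N → E → κ)) := by
    refine le_trans ?_ ((Finset.sum_le_sum hdev).trans (le_of_eq (by
      rw [Finset.sum_const, nsmul_eq_mul])))
    exact_mod_cast (Finset.card_le_card hsub).trans Finset.card_biUnion_le
  refine h1.trans ?_
  rw [← mul_assoc]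
  refine mul_le_mul_of_nonneg_right ?_ (Nat.cast_nonneg _)
  have hs : (s.card : ℝ) ≤ Real.exp (Fintype.card E * Fintype.card κ) := by
    have h2 : s.card ≤ 2 ^ (Fintype.card E * Fintype.card κ) := by
      refine s.card_le_univ.trans (le_of_eq ?_)
      rw [Fintype.card_fun, Fintype.card_finset, pow_mul]
    have h3 : (2 : ℝ) ≤ Real.exp 1 := by linarith [Real.add_one_le_exp (1 : ℝ)]
    calc (s.card : ℝ) ≤ 2 ^ (Fintype.card E * Fintype.card κ) := by exact_mod_cast h2
      _ ≤ Real.exp 1 ^ (Fintype.card E * Fintype.card κ) := pow_le_pow_left₀ (by norm_num) h3 _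
      _ = _ := by rw [← Real.exp_nat_mul]; push_cast; rw [mul_one]
  have h2 : (2 : ℝ) ≤ Real.exp 1 := by linarith [Real.add_one_le_exp (1 : ℝ)]
  have h3 : (Fintype.card E * Fintype.card κ + 1 + 1 / δ : ℝ) ≤ N * t ^ 2 / 4 := by
    rw [le_div_iff₀ (by norm_num)]
    have h4 := mul_le_mul_of_nonneg_right hN (sq_nonneg t)
    have h5 : 4 / t ^ 2 * (Fintype.card E * Fintype.card κ + 1 + 1 / δ) * t ^ 2 =
      (Fintype.card E * Fintype.card κ + 1 + 1 / δ : ℝ) * 4 := by field_simp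
    linarith
  calc (s.card : ℝ) * (2 * Real.exp (-(N * t ^ 2 / 4)))
      ≤ Real.exp (Fintype.card E * Fintype.card κ) * (Real.exp 1 * Real.exp (-(N * t ^ 2 / 4))) := by
        gcongr
    _ = Real.exp (Fintype.card E * Fintype.card κ + 1 - N * t ^ 2 / 4) := by
        rw [← Real.exp_add, ← Real.exp_add]; ring_nf
    _ ≤ Real.exp (-(1 / δ)) := Real.exp_le_exp.2 (by linarith)
    _ ≤ δ := by
        rw [Real.exp_neg, inv_le_comm₀ (Real.exp_pos _) hδ, ← one_div]
        linarith [Real.add_one_le_exp (1 / δ)]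

end

/-! ## The parallel continuous greedy algorithm -/

namespace AdaptiveAlgorithm

variable {E : Type u} [Fintype E] [DecidableEq E] {l N : ℕ}

/-- The sets at which `f` has to be evaluated in order to learn the empirical mean when the set
with index `k` is replaced. -/
def stageSets (ω : Fin N → E → Fin l) (I : Fin l → Finset E) (k : Fin l) (j : Fin N)
    (T : Finset E) : Finset E :=
  pick (Function.update I k T) (ω j)

theorem avg_stageSets (ω : Fin N → E → Fin l) (I : Fin l → Finset E) (k : Fin l)
    (f : Finset E → ℝ) (T : Finset E) :
    avg (stageSets ω I k) f T = sampleMean f ω (Function.update I k T) := by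
  rw [avg, sampleMean, Fintype.card_fin]
  rfl

/-- For fixed samples, `T ↦ stageSets ω I k j T` preserves unions and intersections, so
submodularity is inherited exactly and the greedy analysis sees no sampling error. -/
theorem monoSubmod_avg_stageSets (ω : Fin N → E → Fin l) (I : Fin l → Finset E) (k : Fin l)
    {f : Finset E → ℝ} (hf : MonoSubmod f) : MonoSubmod (avg (stageSets ω I k) f) := by
  constructor
  · intro S T h
    refine div_le_div_of_nonneg_right (Finset.sum_le_sum fun j _ => hf.monotone _ _ fun e he => ?_)
      (Nat.cast_nonneg _)
    rw [stageSets, mem_pick] at he ⊢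
    by_cases hk : ω j e = k
    · rw [hk, Function.update_self] at he ⊢
      exact h he
    · rwa [Function.update_of_ne hk] at he ⊢
  · intro S T
    rw [avg, avg, avg, avg, ← add_div, ← add_div, ← Finset.sum_add_distrib,
      ← Finset.sum_add_distrib]
    refine div_le_div_of_nonneg_right (Finset.sum_le_sum fun j _ => ?_) (Nat.cast_nonneg _)
    have h1 : stageSets ω I k j (S ∪ T) = stageSets ω I k j S ∪ stageSets ω I k j T := by
      ext e
      by_cases hk : ω j e = k <;> simp [stageSets, mem_pick, hk]
    have h2 : stageSets ω I k j (S ∩ T) = stageSets ω I k j S ∩ stageSets ω I k j T := by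
      ext e
      by_cases hk : ω j e = k <;> simp [stageSets, mem_pick, hk]
    rw [h1, h2]
    exact hf.submodular _ _

/-- Choose the set with index `i` by the parallel greedy algorithm. -/
noncomputable def stage (δ : ℝ) (ω : Fin N → E → Fin l) (i : ℕ) (I : Fin l → Finset E) :
    AdaptiveAlgorithm E (Fin l → Finset E) :=
  if h : i < l then
    (parallelGreedy (stageSets ω I ⟨i, h⟩) δ).bind fun S => output (Function.update I ⟨i, h⟩ S)
  else output I

/-- Choose the `l` sets one after the other. -/
noncomputable def continuousGreedy (δ : ℝ) (ω : Fin N → E → Fin l) :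
    AdaptiveAlgorithm E (Fin l → Finset E) :=
  loop (stage δ ω) l fun _ => ∅

theorem cost_stage (hn : 2 ≤ Fintype.card E) {δ : ℝ} (hδ : 0 < δ) (hδ' : δ < 1)
    (ω : Fin N → E → Fin l) (i : ℕ) (I : Fin l → Finset E) :
    (stage δ ω i I).Cost (greedyQueries (Fintype.card E) N) (greedyRounds (Fintype.card E) δ) := by
  rw [stage]
  split_ifs with h
  · have := cost_parallelGreedy hn (stageSets ω I ⟨i, h⟩) hδ hδ'
    rw [Fintype.card_fin] at this
    exact this.bind (r' := 0) fun _ => trivial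
  · trivial

theorem cost_continuousGreedy (hn : 2 ≤ Fintype.card E) {δ : ℝ} (hδ : 0 < δ) (hδ' : δ < 1)
    (ω : Fin N → E → Fin l) :
    (continuousGreedy δ ω).Cost (greedyQueries (Fintype.card E) N)
      (l * greedyRounds (Fintype.card E) δ) :=
  Cost.loop (cost_stage hn hδ hδ' ω) _ _

variable {M : Matroid E} {f : Finset E → ℝ}

theorem always_stage (hn : 2 ≤ Fintype.card E) (hM : M.E = Set.univ) (hf : MonoSubmod f) {δ : ℝ}
    (hδ : 0 < δ) (hδ' : δ < 1) (ω : Fin N → E → Fin l) (i : ℕ) {I : Fin l → Finset E}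
    (hI : (∀ k, M.Indep (I k : Set E)) ∧ ∀ k : Fin l, i ≤ k → I k = ∅) :
    (stage δ ω i I).Always M f fun J =>
      (∀ k, M.Indep (J k : Set E)) ∧ ∀ k : Fin l, i + 1 ≤ k → J k = ∅ := by
  rw [stage]
  split_ifs with h
  · rw [always_bind]
    refine (guarantee_parallelGreedy hn hM
      (monoSubmod_avg_stageSets ω I ⟨i, h⟩ hf) hδ hδ').1.mono fun S hS => ?_
    refine ⟨fun k => ?_, fun k hk => ?_⟩
    · by_cases hk : k = ⟨i, h⟩
      · rw [hk, Function.update_self]; exact hS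
      · rw [Function.update_of_ne hk]; exact hI.1 k
    · rw [Function.update_of_ne (by rintro rfl; exact absurd hk (by simp))]
      exact hI.2 k (by omega)
  · exact ⟨hI.1, fun k hk => hI.2 k (by omega)⟩

theorem always_continuousGreedy (hn : 2 ≤ Fintype.card E) (hM : M.E = Set.univ)
    (hf : MonoSubmod f) {δ : ℝ} (hδ : 0 < δ) (hδ' : δ < 1) (ω : Fin N → E → Fin l) :
    (continuousGreedy δ ω).Always M f fun I => ∀ k, M.Indep (I k : Set E) :=
  (Always.loop (P := fun i (J : Fin l → Finset E) =>
      (∀ k, M.Indep (J k : Set E)) ∧ ∀ k : Fin l, i ≤ k → J k = ∅)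
    ⟨fun _ => by simp, fun _ _ => rfl⟩
    fun i _ _ hI => always_stage hn hM hf hδ hδ' ω i hI).mono fun _ h => h.1

omit [Fintype E] [DecidableEq E] in
theorem notMem_closure_empty_of_indep {I : Finset E} (hI : M.Indep (I : Set E)) {e : E}
    (he : e ∈ I) : e ∉ M.closure ∅ := fun h =>
  hI.notMem_closure_sdiff_of_mem (Finset.mem_coe.2 he) (M.closure_subset_closure (by simp) h)

/-- With `b = (1-δ)²`, the greedy guarantee bounds the increase of the value from below by `b` times
the gains of an optimal `O` at the final set, hence by `b/l` times the remaining distance to `OPT`,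
up to errors. The gap is measured after the stage, so it shrinks by the factor `1 + b/l`. The shift
`2 δ OPT` absorbs the errors, which amount to at most `2 δ OPT b/l`. -/
theorem le_mean_stage (hn : 2 ≤ Fintype.card E) (hM : M.E = Set.univ)
    (hf : IsMonotoneSubmodular f) {δ η : ℝ} (hδ : 0 < δ) (hδ' : δ < 1)
    (hη : l * ((2 * Fintype.card E + 3) * η) ≤ δ * opt M f) {ω : Fin N → E → Fin l}
    (hω : GoodSample M f η ω) {i : ℕ} (hi : i < l) {I : Fin l → Finset E}
    (hI : (∀ k, M.Indep (I k : Set E)) ∧ ∀ k : Fin l, i ≤ k → I k = ∅) :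
    sampleMean f ω I - opt M f + 2 * δ * opt M f ≤
      (stage δ ω i I).mean M f fun J => (1 + (1 - δ) ^ 2 / l) *
        (sampleMean f ω J - opt M f + 2 * δ * opt M f) := by
  set k : Fin l := ⟨i, hi⟩ with hk
  have hl : (0 : ℝ) < l := by exact_mod_cast (Nat.zero_le i).trans_lt hi
  have hl1 : (1 : ℝ) ≤ l := by exact_mod_cast (Nat.zero_le i).trans_lt hi
  have hη0 : 0 ≤ η := (abs_nonneg _).trans (hω (fun _ => ∅) (by simp))
  set b := (1 - δ) ^ 2 with hb
  have hb0 : 0 ≤ b := sq_nonneg _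
  set OPT := opt M f with hOPT
  set n : ℝ := (Fintype.card E : ℝ) with hn'
  have hg := monoSubmod_avg_stageSets ω I k hf.monoSubmod
  obtain ⟨hind, hval⟩ := guarantee_parallelGreedy hn hM hg hδ hδ'
  obtain ⟨O, hO, hfO⟩ := (opt_isGreatest M f).1
  -- The set with index `k` is still empty, so the greedy value at `∅` is the value before the
  -- stage.
  have hupd : Function.update I k ∅ = I := by
    rw [← hI.2 k le_rfl, Function.update_eq_self]
  have hloop : ∀ T : Finset E, (∀ e ∈ T, e ∉ M.closure ∅) →
      ∀ k', ∀ e ∈ Function.update I k T k', e ∉ M.closure ∅ := by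
    intro T hT k' e he
    by_cases hk' : k' = k
    · rw [hk', Function.update_self] at he; exact hT e he
    · rw [Function.update_of_ne hk'] at he; exact notMem_closure_empty_of_indep (hI.1 k') he
  have hclose : ∀ T : Finset E, (∀ e ∈ T, e ∉ M.closure ∅) →
      |sampleMean f ω (Function.update I k T) - pickMean f (Function.update I k T)| ≤ η :=
    fun T hT => hω _ (hloop T hT)
  -- the first threshold
  have htop : M.topGain (avg (stageSets ω I k) f) ∅ ≤ OPT / l + 2 * η := by
    have hOPT0 : 0 ≤ OPT := (hf.nonneg ∅).trans (le_opt (by simp))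
    refine topGain_le (by positivity) fun e he => ?_
    rw [Finset.coe_empty] at he
    rw [avg_stageSets, avg_stageSets, insert_empty_eq]
    have h1 := (abs_le.1 (hclose {e} (by simpa using he))).2
    have h2 := (abs_le.1 (hclose ∅ (by simp))).1
    have h3 := hf.monoSubmod.pickMean_singleton_le I k e
    rw [hf.normalized, sub_zero, Fintype.card_fin] at h3
    have h4 : f {e} / l ≤ OPT / l :=
      div_le_div_of_nonneg_right (singleton_le_opt hM f he) hl.le
    linarith
  -- Each gain of an element of `O` costs `2η`, and the value at `S` another `η`. The first
  -- threshold adds `2η`, whence `2n + 3` in `hη`.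
  have hpoint : ∀ S : Finset E, M.Indep (S : Set E) →
      (OPT - sampleMean f ω (Function.update I k S)) / l - (2 * n + 1) * η ≤
        ∑ o ∈ O, gain (avg (stageSets ω I k) f) S o := by
    intro S hS
    have hS' : ∀ e ∈ S, e ∉ M.closure ∅ := fun e => notMem_closure_empty_of_indep hS
    have h1 := hf.monoSubmod.le_sum_pickMean I k S O
    have h2 : ∑ o ∈ O, (pickMean f (Function.update I k (insert o S)) -
        pickMean f (Function.update I k (S.erase o))) ≤
        ∑ o ∈ O, (gain (avg (stageSets ω I k) f) S o + 2 * η) := by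
      refine Finset.sum_le_sum fun o ho => ?_
      rw [gain, avg_stageSets, avg_stageSets]
      have h3 := (abs_le.1 (hclose (insert o S) fun e he => by
        obtain rfl | he := Finset.mem_insert.1 he
        · exact notMem_closure_empty_of_indep hO ho
        · exact hS' e he)).1
      have h4 := (abs_le.1 (hclose (S.erase o) fun e he => hS' e (Finset.mem_of_mem_erase he))).2
      linarith
    rw [Finset.sum_add_distrib, Finset.sum_const, nsmul_eq_mul] at h2
    have h5 : (O.card : ℝ) * (2 * η) ≤ n * (2 * η) :=
      mul_le_mul_of_nonneg_right (by rw [hn']; exact_mod_cast O.card_le_univ) (by linarith)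
    have h6 : (OPT - sampleMean f ω (Function.update I k S)) / l - η ≤
        (f O - pickMean f (Function.update I k S)) / (Fintype.card (Fin l) : ℝ) := by
      rw [Fintype.card_fin, sub_le_iff_le_add, div_add' _ _ _ hl.ne']
      refine div_le_div_of_nonneg_right ?_ hl.le
      have h7 := (abs_le.1 (hclose S hS')).1
      rw [hfO]
      nlinarith
    linarith
  have hmono := hind.mean_le_mean (cost_parallelGreedy hn (stageSets ω I k) hδ hδ')
    (h := fun S => avg (stageSets ω I k) f S -
      b * ∑ o ∈ O, gain (avg (stageSets ω I k) f) S o)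
    (h' := fun S => 1 * ((1 + b / l) * (sampleMean f ω (Function.update I k S) - OPT +
      2 * δ * OPT)) + (OPT - 2 * δ * OPT * (1 + b / l) + b * ((2 * n + 1) * η))) (by
      intro S hS
      have h1 := mul_le_mul_of_nonneg_left (hpoint S hS) hb0
      rw [avg_stageSets]
      have h2 : b * ((OPT - sampleMean f ω (Function.update I k S)) / l - (2 * n + 1) * η) =
        b / l * (OPT - sampleMean f ω (Function.update I k S)) - b * ((2 * n + 1) * η) := by ring
      linarith)
  rw [mean_mul_add (cost_parallelGreedy hn (stageSets ω I k) hδ hδ')] at hmono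
  have h0 := hval O hO
  rw [avg_stageSets, hupd] at h0
  have hfinal : b * (δ * M.topGain (avg (stageSets ω I k) f) ∅) + b * ((2 * n + 1) * η) ≤
      2 * δ * OPT * (b / l) := by
    have h1 : δ * M.topGain (avg (stageSets ω I k) f) ∅ ≤ δ * (OPT / l + 2 * η) :=
      mul_le_mul_of_nonneg_left htop hδ.le
    have h2 : (2 * n + 3) * η ≤ δ * OPT / l := by
      rw [le_div_iff₀ hl]
      linarith
    have h3 : δ * η ≤ η := by nlinarith
    have h4 : δ * M.topGain (avg (stageSets ω I k) f) ∅ + (2 * n + 1) * η ≤ 2 * (δ * OPT / l) := by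
      have h5 : δ * (OPT / l + 2 * η) = δ * OPT / l + 2 * (δ * η) := by ring
      linarith
    have h5 := mul_le_mul_of_nonneg_left h4 hb0
    have h6 : b * (2 * (δ * OPT / l)) = 2 * δ * OPT * (b / l) := by ring
    linarith
  rw [stage, dif_pos hi, mean_bind]
  simp only [mean]
  linarith

/-- With `a = (1-δ)²/l ≤ δ`, the bound `1 + a ≥ exp (a - a²)` gives `(1 + a)^l ≥ exp (1 - 3δ)`. -/
theorem inv_one_add_pow_le {δ : ℝ} (hδ : 0 < δ) (hδ' : δ ≤ 1 / 16) {l : ℕ} (hl : 1 / δ ≤ l) :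
    1 ≤ (1 + (1 - δ) ^ 2 / l) ^ l * (Real.exp (-1) + 3 * δ) := by
  have hl0 : (0 : ℝ) < l := lt_of_lt_of_le (by positivity) hl
  set a := (1 - δ) ^ 2 / l with ha
  have ha0 : 0 ≤ a := by positivity
  have hb1 : (1 - δ) ^ 2 ≤ 1 := pow_le_one₀ (by linarith) (by linarith)
  have hal : l * a = (1 - δ) ^ 2 := by rw [ha]; field_simp
  have hl1 : 1 / (l : ℝ) ≤ δ := by
    rw [div_le_iff₀ hl0]
    rwa [div_le_iff₀' hδ] at hl
  have haδ : a ≤ δ := (div_le_div_of_nonneg_right hb1 hl0.le).trans hl1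
  have h1 : Real.exp (a - a ^ 2) ≤ 1 + a := by
    have h2 := Real.add_one_le_exp (-(a - a ^ 2))
    rw [Real.exp_neg, ← one_div] at h2
    have h4 : 0 < -(a - a ^ 2) + 1 := by nlinarith
    rw [le_div_iff₀ (Real.exp_pos _)] at h2
    have h5 : 1 ≤ (1 + a) * (-(a - a ^ 2) + 1) := by
      have : 0 ≤ a ^ 3 := by positivity
      linarith
    nlinarith [Real.exp_pos (a - a ^ 2)]
  have h2 : Real.exp (1 - 3 * δ) ≤ (1 + a) ^ l := by
    refine le_trans ?_ (pow_le_pow_left₀ (Real.exp_pos _).le h1 l)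
    rw [← Real.exp_nat_mul]
    refine Real.exp_le_exp.2 ?_
    have h3 : (l : ℝ) * (a - a ^ 2) = (1 - δ) ^ 2 - (1 - δ) ^ 2 * a := by rw [← hal]; ring
    rw [h3]
    have h4 : (1 - δ) ^ 2 * a ≤ 1 * δ := mul_le_mul hb1 haδ ha0 zero_le_one
    nlinarith
  have h3 : Real.exp (-(1 - 3 * δ)) ≤ Real.exp (-1) + 3 * δ := by
    have h4 : Real.exp (3 * δ) ≤ 1 + 6 * δ := by
      have h5 := (abs_le.1 (Real.abs_exp_sub_one_sub_id_le
        (by rw [abs_of_pos (by linarith)]; linarith : |3 * δ| ≤ 1))).2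
      nlinarith
    have h5 : Real.exp (-1) ≤ 1 / 2 := by
      rw [Real.exp_neg, inv_le_comm₀ (Real.exp_pos _) (by norm_num)]
      linarith [Real.add_one_le_exp (1 : ℝ)]
    calc Real.exp (-(1 - 3 * δ)) = Real.exp (-1) * Real.exp (3 * δ) := by
          rw [← Real.exp_add]; ring_nf
      _ ≤ Real.exp (-1) * (1 + 6 * δ) := mul_le_mul_of_nonneg_left h4 (Real.exp_pos _).le
      _ ≤ _ := by nlinarith
  calc (1 : ℝ) = Real.exp (1 - 3 * δ) * Real.exp (-(1 - 3 * δ)) := by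
        rw [← Real.exp_add, add_neg_cancel, Real.exp_zero]
    _ ≤ (1 + a) ^ l * (Real.exp (-1) + 3 * δ) :=
        mul_le_mul h2 h3 (Real.exp_pos _).le (by positivity)

/-- The gap to `(1-2δ) OPT` shrinks by `1 + a` per stage in expectation, so `(1 + a)^i` times the
shifted value is a submartingale. The final loss is `2δ` from the shift and `3δ` from the
approximation of `1/e`. -/
theorem le_mean_continuousGreedy (hn : 2 ≤ Fintype.card E) (hM : M.E = Set.univ)
    (hf : IsMonotoneSubmodular f) {δ η : ℝ} (hδ : 0 < δ) (hδ' : δ ≤ 1 / 16) (hl : 1 / δ ≤ l)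
    (hη : l * ((2 * Fintype.card E + 3) * η) ≤ δ * opt M f) {ω : Fin N → E → Fin l}
    (hω : GoodSample M f η ω) :
    (1 - Real.exp (-1) - 5 * δ) * opt M f ≤ (continuousGreedy δ ω).mean M f (sampleMean f ω) := by
  have hδ1 : δ < 1 := by linarith
  set OPT := opt M f with hOPT
  have hOPT0 : 0 ≤ OPT := (hf.nonneg ∅).trans (le_opt (by simp))
  set a := (1 - δ) ^ 2 / l with ha
  have ha0 : 0 ≤ a := by positivity
  have h := le_mean_loop (M := M) (f := f) (k := l) (s := fun _ => (∅ : Finset E))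
    (P := fun i (J : Fin l → Finset E) =>
      (∀ k, M.Indep (J k : Set E)) ∧ ∀ k : Fin l, i ≤ k → J k = ∅)
    (Ψ := fun i J => (1 + a) ^ i * (sampleMean f ω J - OPT + 2 * δ * OPT) + 0)
    (cost_stage hn hδ hδ1 ω) ⟨fun _ => by simp, fun _ _ => rfl⟩
    (fun i _ _ hI => always_stage hn hM hf.monoSubmod hδ hδ1 ω i hI) (by
      intro i hi I hI
      have h1 := le_mean_stage hn hM hf hδ hδ1 hη hω hi hI
      have h2 := mul_le_mul_of_nonneg_left h1 (pow_nonneg (by linarith : 0 ≤ 1 + a) i)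
      rw [← add_zero ((1 + a) ^ i * mean M f _ _),
        ← mean_mul_add (cost_stage hn hδ hδ1 ω i I)] at h2
      simp only [add_zero] at h2 ⊢
      refine h2.trans_eq ?_
      congr 1
      funext J
      rw [pow_succ, ha]
      ring)
  have h0 : sampleMean f ω (fun _ => ∅) = 0 := by
    have : ∀ u : E → Fin l, pick (fun _ => ∅) u = ∅ := fun u => by simp [pick]
    simp [sampleMean, this, hf.normalized]
  have h1 : (fun J : Fin l → Finset E =>
      (1 + a) ^ l * (sampleMean f ω J - OPT + 2 * δ * OPT) + 0) =
      fun J => (1 + a) ^ l * sampleMean f ω J + (1 + a) ^ l * (-OPT + 2 * δ * OPT) := by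
    funext J; ring
  rw [h1, h0] at h
  rw [show loop (stage δ ω) l (fun _ => ∅) = continuousGreedy δ ω from rfl,
    mean_mul_add (cost_continuousGreedy hn hδ hδ1 ω)] at h
  have h2 := inv_one_add_pow_le hδ hδ' hl
  rw [← ha] at h2
  have hp : 0 < (1 + a) ^ l := by positivity
  have h3 := mul_le_mul_of_nonneg_right h2 hOPT0
  have h4 : 0 ≤ (1 + a) ^ l * ((continuousGreedy δ ω).mean M f (sampleMean f ω) -
      (1 - Real.exp (-1) - 5 * δ) * OPT) := by
    have h5 : 0 ≤ 2 * δ * OPT := by positivity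
    simp only [pow_zero, one_mul] at h
    linarith
  exact sub_nonneg.1 (nonneg_of_mul_nonneg_right h4 hp)

end AdaptiveAlgorithm

/-! ## The algorithms -/

namespace AdaptiveAlgorithm

variable {E : Type u} [Fintype E] [DecidableEq E] {α : Type v} {M : Matroid E}
  {f : Finset E → ℝ}

omit [Fintype E] [DecidableEq E] in
open Classical in
theorem le_mean_unif {Ω : Type u} [Fintype Ω] {hs : (Finset.univ : Finset Ω).Nonempty}
    {next : Ω → AdaptiveAlgorithm E α} {h : α → ℝ} {G : Ω → Prop} {c d δ : ℝ} (hd : 0 ≤ d)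
    (hbad : ((Finset.univ.filter fun ω => ¬ G ω).card : ℝ) ≤ δ * Fintype.card Ω)
    (hgood : ∀ ω, G ω → c ≤ (next ω).mean M f h) (hall : ∀ ω, c - d ≤ (next ω).mean M f h) :
    c - δ * d ≤ (unif Finset.univ hs next).mean M f h := by
  have hpos : (0 : ℝ) < (Finset.univ : Finset Ω).card := by exact_mod_cast hs.card_pos
  rw [mean_unif, le_div_iff₀ hpos]
  have h1 : ∀ ω ∈ (Finset.univ : Finset Ω), c - (if ¬ G ω then d else 0) ≤
      (next ω).mean M f h := by
    intro ω _
    by_cases hω : G ω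
    · rw [if_neg (not_not.2 hω), sub_zero]; exact hgood ω hω
    · rw [if_pos hω]; exact hall ω
  refine le_trans ?_ (Finset.sum_le_sum h1)
  rw [Finset.sum_sub_distrib, ← Finset.sum_filter, Finset.sum_const, Finset.sum_const,
    nsmul_eq_mul, nsmul_eq_mul]
  have h2 := mul_le_mul_of_nonneg_right hbad hd
  rw [Finset.card_univ] at hpos ⊢
  linarith

/-- Sample the indices, run the continuous greedy algorithm, and finish with `fin`. -/
noncomputable def sampledGreedy (l N : ℕ) [NeZero l] (δ : ℝ)
    (fin : (Fin N → E → Fin l) → (Fin l → Finset E) → AdaptiveAlgorithm E α) :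
    AdaptiveAlgorithm E α :=
  unif (Finset.univ : Finset (Fin N → E → Fin l)) Finset.univ_nonempty fun ω =>
    (continuousGreedy δ ω).bind (fin ω)

theorem cost_sampledGreedy (hn : 2 ≤ Fintype.card E) {δ : ℝ} (hδ : 0 < δ) (hδ' : δ < 1) {l N : ℕ}
    [NeZero l] {fin : (Fin N → E → Fin l) → (Fin l → Finset E) → AdaptiveAlgorithm E α} {r : ℕ}
    (hfin : ∀ ω I, (fin ω I).Cost (greedyQueries (Fintype.card E) N) r) :
    (sampledGreedy l N δ fin).Cost (greedyQueries (Fintype.card E) N)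
      (l * greedyRounds (Fintype.card E) δ + r) :=
  ⟨inferInstance, fun ω => (cost_continuousGreedy hn hδ hδ' ω).bind (hfin ω)⟩

open Classical in
/-- Estimate the value of the solution that has been found, with a safety margin. -/
noncomputable def estimateStep {l N : ℕ} (δ : ℝ) (ω : Fin N → E → Fin l) (I : Fin l → Finset E) :
    AdaptiveAlgorithm E ℝ≥0 :=
  ask (Finset.univ.image fun j => .value (pick I (ω j))) fun f₀ _ =>
    output (sampleMean f₀ ω I / (1 + δ)).toNNReal

theorem cost_estimateStep {l N : ℕ} (δ : ℝ) (ω : Fin N → E → Fin l) (I : Fin l → Finset E) :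
    (estimateStep δ ω I).Cost (greedyQueries (Fintype.card E) N) 1 := by
  classical
  refine Cost.ask (r := 0) (Finset.card_image_le.trans ?_) fun _ _ => trivial
  rw [Finset.card_univ, Fintype.card_fin]
  calc N ≤ N + 1 := Nat.le_succ N
    _ ≤ (N + 1) * (Fintype.card E + 1) := Nat.le_mul_of_pos_right _ (Nat.succ_pos _)
    _ ≤ _ := Nat.le_mul_of_pos_left _ (Nat.succ_pos _)

theorem mean_estimateStep {l N : ℕ} (δ : ℝ) (ω : Fin N → E → Fin l) (I : Fin l → Finset E)
    (h : ℝ≥0 → ℝ) :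
    (estimateStep δ ω I).mean M f h = h (sampleMean f ω I / (1 + δ)).toNNReal := by
  classical
  rw [estimateStep, mean_ask, mean]
  have : ∀ j, known (Finset.univ.image fun j => Query.value (pick I (ω j))) f (pick I (ω j)) =
      f (pick I (ω j)) := fun j => if_pos (Finset.mem_image_of_mem _ (Finset.mem_univ j))
  simp only [sampleMean]
  rw [Finset.sum_congr rfl fun j _ => this j]

/-- The number of sets in the convex combination. -/
noncomputable abbrev numSets (δ : ℝ) : ℕ := ⌈1 / δ⌉₊

/-- The accuracy of the empirical means. -/
noncomputable abbrev accuracy (n : ℕ) (δ : ℝ) : ℝ := δ / (numSets δ * (n * (2 * n + 3)))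

/-- The number of samples. -/
noncomputable abbrev numSamples (n : ℕ) (δ : ℝ) : ℕ :=
  ⌈4 / accuracy n δ ^ 2 * (n * numSets δ + 1 + 1 / δ)⌉₊

theorem numSets_pos {δ : ℝ} (hδ : 0 < δ) : 0 < numSets δ := Nat.ceil_pos.2 (by positivity)

/-! ### Guarantees of the sampled continuous greedy algorithm -/

section

variable {δ : ℝ} {N : ℕ}

/-- With `η = accuracy n δ * (n * OPT)`, the deviation from `card_not_goodSample_le`, the error
condition of `le_mean_continuousGreedy` becomes an equality. -/
theorem accuracy_mul {n : ℕ} (hn : 2 ≤ n) (hδ : 0 < δ) (x : ℝ) :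
    numSets δ * ((2 * n + 3) * (accuracy n δ * (n * x))) = δ * x := by
  have h1 : (0 : ℝ) < numSets δ := by exact_mod_cast numSets_pos hδ
  have h2 : (0 : ℝ) < n := by exact_mod_cast (by omega : 0 < n)
  rw [accuracy]
  field_simp

theorem accuracy_pos {n : ℕ} (hn : 2 ≤ n) (hδ : 0 < δ) : 0 < accuracy n δ := by
  have h1 : (0 : ℝ) < numSets δ := by exact_mod_cast numSets_pos hδ
  have h2 : (0 : ℝ) < n := by exact_mod_cast (by omega : 0 < n)
  rw [accuracy]
  positivity

theorem accuracy_mul_le {n : ℕ} (hn : 2 ≤ n) (hδ : 0 < δ) {x : ℝ} (hx : 0 ≤ x) :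
    accuracy n δ * (n * x) ≤ δ * x := by
  have h1 : (1 : ℝ) ≤ numSets δ := by exact_mod_cast numSets_pos hδ
  have h2 : (0 : ℝ) ≤ n := Nat.cast_nonneg n
  have h3 : (1 : ℝ) ≤ numSets δ * (2 * n + 3) := by nlinarith
  have h4 := accuracy_pos hn hδ
  have h5 : accuracy n δ * (n * x) ≤ numSets δ * (2 * n + 3) * (accuracy n δ * (n * x)) :=
    le_mul_of_one_le_left (by positivity) h3
  rw [mul_assoc, accuracy_mul hn hδ] at h5
  exact h5

/-- Good samples contribute `c`. On the bad ones, a fraction of at most `δ`, only `0 ≤ h` is used,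
which costs at most `d ≥ c`. -/
theorem le_mean_sampledGreedy (hn : 2 ≤ Fintype.card E) (hM : M.E = Set.univ)
    (hf : IsMonotoneSubmodular f) (hδ : 0 < δ) (hδ' : δ ≤ 1 / 16) [NeZero (numSets δ)]
    {fin : (Fin (numSamples (Fintype.card E) δ) → E → Fin (numSets δ)) →
      (Fin (numSets δ) → Finset E) → AdaptiveAlgorithm E α} {h : α → ℝ} {c d : ℝ} (hd : 0 ≤ d)
    (hcd : c ≤ d) (hh : ∀ o, 0 ≤ h o)
    (hgood : ∀ ω, GoodSample M f
        (accuracy (Fintype.card E) δ * (Fintype.card E * opt M f)) ω →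
      c ≤ (continuousGreedy δ ω).mean M f fun I => (fin ω I).mean M f h) :
    c - δ * d ≤ (sampledGreedy (numSets δ) (numSamples (Fintype.card E) δ) δ fin).mean M f h := by
  classical
  have : Nonempty (Fin (numSets δ)) := ⟨0⟩
  refine le_mean_unif hd (card_not_goodSample_le hM hf (accuracy_pos hn hδ) ?_ hδ ?_)
    (fun ω hω => ?_) fun ω => ?_
  · have h1 := accuracy_mul_le hn hδ (zero_le_one' ℝ)
    have h2 : (1 : ℝ) ≤ Fintype.card E := by exact_mod_cast (by omega : 1 ≤ Fintype.card E)
    have h3 := accuracy_pos hn hδ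
    rw [mul_one, mul_one] at h1
    have h4 := le_mul_of_one_le_right h3.le h2
    linarith
  · rw [Fintype.card_fin]
    exact Nat.le_ceil _
  · rw [mean_bind]
    exact hgood ω hω
  · exact (sub_nonpos.2 hcd).trans (mean_nonneg _ hh)

theorem sampledGreedy_spec (hn : 2 ≤ Fintype.card E) (hM : M.E = Set.univ)
    (hf : IsMonotoneSubmodular f) (hδ : 0 < δ) (hδ' : δ ≤ 1 / 16)
    {ω : Fin N → E → Fin (numSets δ)}
    (hω : GoodSample M f (accuracy (Fintype.card E) δ * (Fintype.card E * opt M f)) ω) :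
    ((continuousGreedy δ ω).Always M f fun I =>
      |sampleMean f ω I - pickMean f I| ≤ δ * opt M f ∧ pickMean f I ≤ opt M f) ∧
    (1 - Real.exp (-1) - 5 * δ) * opt M f ≤ (continuousGreedy δ ω).mean M f (sampleMean f ω) := by
  have hOPT0 : 0 ≤ opt M f := (hf.nonneg ∅).trans (le_opt (by simp))
  have : Nonempty (Fin (numSets δ)) := ⟨⟨0, numSets_pos hδ⟩⟩
  refine ⟨(always_continuousGreedy hn hM hf.monoSubmod hδ (by linarith) ω).mono fun I hI =>
    ⟨(hω I fun k e => notMem_closure_empty_of_indep (hI k)).trans (accuracy_mul_le hn hδ hOPT0),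
      pickMean_le_opt hf.monoSubmod hI⟩, ?_⟩
  refine le_mean_continuousGreedy hn hM hf hδ hδ' (Nat.le_ceil _) ?_ hω
  exact (accuracy_mul hn hδ _).le

/-- The greedy analysis loses `5δ`, the passage from the empirical to the true mean `δ`, and bad
samples `δ`. The maximum with 0 is there because the transfer to `run` needs a function that is
nonnegative at all outputs. -/
theorem le_mean_combination (hn : 2 ≤ Fintype.card E) (hM : M.E = Set.univ)
    (hf : IsMonotoneSubmodular f) (hδ : 0 < δ) (hδ' : δ ≤ 1 / 16) [NeZero (numSets δ)] :
    (1 - Real.exp (-1) - 7 * δ) * opt M f ≤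
      (sampledGreedy (numSets δ) (numSamples (Fintype.card E) δ) δ fun _ I =>
        output (ConvexCombination.uniform (numSets_pos hδ) I)).mean M f
        fun c => max (multilinear f c.point) 0 := by
  have hOPT0 : 0 ≤ opt M f := (hf.nonneg ∅).trans (le_opt (by simp))
  have h := le_mean_sampledGreedy (M := M) (f := f) hn hM hf hδ hδ'
    (fin := fun _ I => output (ConvexCombination.uniform (numSets_pos hδ) I))
    (h := fun c => max (multilinear f c.point) 0) (c := (1 - Real.exp (-1) - 6 * δ) * opt M f)
    (d := opt M f) hOPT0 ?_ (fun c => le_max_right _ _) fun ω hω => ?_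
  · linarith
  · have := Real.exp_pos (-1)
    nlinarith
  · obtain ⟨h1, h2⟩ := sampledGreedy_spec hn hM hf hδ hδ' hω
    have h3 := h1.mean_le_mean (cost_continuousGreedy hn hδ (by linarith) ω)
      (h := fun I => 1 * sampleMean f ω I + -(δ * opt M f))
      (h' := fun I => max (pickMean f I) 0) fun I hI => by
        have := (abs_le.1 hI.1).2
        exact le_trans (by linarith) (le_max_left _ _)
    rw [mean_mul_add (cost_continuousGreedy hn hδ (by linarith) ω)] at h3
    simp only [mean, multilinear_uniform]
    linarith

/-- On a good sample the empirical value is at most `(1+δ) OPT`, so after division by `1+δ` the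
minimum with `OPT` cuts nothing off. The division is covered by a further `2δ`, bad samples by `δ`.
-/
theorem le_mean_estimate (hn : 2 ≤ Fintype.card E) (hM : M.E = Set.univ)
    (hf : IsMonotoneSubmodular f) (hδ : 0 < δ) (hδ' : δ ≤ 1 / 16) [NeZero (numSets δ)] :
    (1 - Real.exp (-1) - 8 * δ) * opt M f ≤
      (sampledGreedy (numSets δ) (numSamples (Fintype.card E) δ) δ (estimateStep δ)).mean M f
        fun v : ℝ≥0 => min (v : ℝ) (opt M f) := by
  have hOPT0 : 0 ≤ opt M f := (hf.nonneg ∅).trans (le_opt (by simp))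
  have h := le_mean_sampledGreedy (M := M) (f := f) hn hM hf hδ hδ'
    (fin := estimateStep δ)
    (h := fun v : ℝ≥0 => min (v : ℝ) (opt M f)) (c := (1 - Real.exp (-1) - 7 * δ) * opt M f)
    (d := opt M f) hOPT0 ?_ (fun v => le_min v.2 hOPT0) fun ω hω => ?_
  · linarith
  · have := Real.exp_pos (-1)
    nlinarith
  · obtain ⟨h1, h2⟩ := sampledGreedy_spec hn hM hf hδ hδ' hω
    have h3 := h1.mean_le_mean (cost_continuousGreedy hn hδ (by linarith) ω)
      (h := fun I => 1 * sampleMean f ω I + -(2 * δ * opt M f))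
      (h' := fun I => min (((sampleMean f ω I / (1 + δ)).toNNReal : ℝ≥0) : ℝ) (opt M f))
      fun I hI => by
        have h4 := (abs_le.1 hI.1).2
        have h5 : sampleMean f ω I ≤ (1 + δ) * opt M f := by linarith [hI.2]
        have h6 : 1 * sampleMean f ω I + -(2 * δ * opt M f) ≤ sampleMean f ω I / (1 + δ) := by
          rw [le_div_iff₀ (by linarith)]
          nlinarith [mul_nonneg hδ.le hOPT0]
        refine le_min (h6.trans (Real.le_coe_toNNReal _)) (h6.trans ?_)
        rw [div_le_iff₀' (by linarith)]
        exact h5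
    rw [mean_mul_add (cost_continuousGreedy hn hδ (by linarith) ω)] at h3
    simp only [mean_estimateStep]
    linarith

open Classical in
theorem le_mean_estimate_le_opt (hn : 2 ≤ Fintype.card E) (hM : M.E = Set.univ)
    (hf : IsMonotoneSubmodular f) (hδ : 0 < δ) (hδ' : δ ≤ 1 / 16) [NeZero (numSets δ)] :
    1 - δ ≤ (sampledGreedy (numSets δ) (numSamples (Fintype.card E) δ) δ (estimateStep δ)).mean M f
        fun v => if v ∈ {v : ℝ≥0 | opt M f < (v : ℝ)} then 0 else 1 := by
  have hOPT0 : 0 ≤ opt M f := (hf.nonneg ∅).trans (le_opt (by simp))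
  have h := le_mean_sampledGreedy (M := M) (f := f) hn hM hf hδ hδ'
    (fin := estimateStep δ)
    (h := fun v => if v ∈ {v : ℝ≥0 | opt M f < (v : ℝ)} then 0 else 1) (c := 1)
    (d := 1) zero_le_one le_rfl (fun v => by split_ifs <;> norm_num) fun ω hω => ?_
  · linarith
  · obtain ⟨h1, h2⟩ := sampledGreedy_spec hn hM hf hδ hδ' hω
    have h3 := h1.mean_le_mean (cost_continuousGreedy hn hδ (by linarith) ω)
      (h := fun I => 0 * sampleMean f ω I + 1)
      (h' := fun I => if (sampleMean f ω I / (1 + δ)).toNNReal ∈ {v : ℝ≥0 | opt M f < (v : ℝ)}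
        then 0 else 1)
      fun I hI => by
        have h4 := (abs_le.1 hI.1).2
        have h5 : sampleMean f ω I / (1 + δ) ≤ opt M f := by
          rw [div_le_iff₀' (by linarith)]
          linarith [hI.2]
        rw [if_neg]
        · linarith
        · rw [Set.mem_ofPred_eq, not_lt, Real.coe_toNNReal']
          exact max_le h5 hOPT0
    rw [mean_mul_add (cost_continuousGreedy hn hδ (by linarith) ω)] at h3
    simp only [mean_estimateStep]
    linarith

end

/-! ### The half approximation -/

/-- With `b = (1-δ)²`, the gains of an optimal set at `S` sum to at least `OPT - f S`, so the
guarantee reads `(1 + b) E[f S] ≥ b (1 - δ) OPT`. -/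
theorem le_mean_parallelGreedy (hn : 2 ≤ Fintype.card E) (hM : M.E = Set.univ)
    (hf : IsMonotoneSubmodular f) {δ : ℝ} (hδ : 0 < δ) (hδ' : δ ≤ 1 / 16) :
    (1 / 2 - 2 * δ) * opt M f ≤
      (parallelGreedy (fun _ : Unit => (id : Finset E → Finset E)) δ).mean M f f := by
  have hOPT0 : 0 ≤ opt M f := (hf.nonneg ∅).trans (le_opt (by simp))
  have havg : avg (fun _ : Unit => (id : Finset E → Finset E)) f = f := by
    funext T
    simp [avg]
  obtain ⟨hind, hval⟩ := guarantee_parallelGreedy (f := f)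
    (enc := fun _ : Unit => (id : Finset E → Finset E)) hn hM (by rw [havg]; exact hf.monoSubmod)
    hδ (by linarith)
  rw [havg] at hval
  obtain ⟨O, hO, hfO⟩ := (opt_isGreatest M f).1
  have h1 := hval O hO
  have hcost := cost_parallelGreedy hn (fun _ : Unit => (id : Finset E → Finset E)) hδ
    (by linarith)
  have h2 := hind.mean_le_mean hcost (h := fun S => f S - (1 - δ) ^ 2 * ∑ o ∈ O, gain f S o)
    (h' := fun S => (1 + (1 - δ) ^ 2) * f S + -((1 - δ) ^ 2 * opt M f)) fun S _ => by
      have h3 := hf.monoSubmod.sub_le_sum_gain S O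
      have h4 := hf.monotone O (S ∪ O) Finset.subset_union_right
      have h5 : opt M f - f S ≤ ∑ o ∈ O, gain f S o := by rw [← hfO]; linarith
      have h6 := mul_le_mul_of_nonneg_left h5 (sq_nonneg (1 - δ))
      linarith
  rw [mean_mul_add hcost] at h2
  have htop : M.topGain f ∅ ≤ opt M f := topGain_le hOPT0 fun e he => by
    rw [hf.normalized, sub_zero, insert_empty_eq]
    exact singleton_le_opt hM f (by simpa using he)
  rw [hf.normalized] at h1
  set x := (parallelGreedy (fun _ : Unit => (id : Finset E → Finset E)) δ).mean M f f
  set b := (1 - δ) ^ 2 with hb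
  have hb0 : 0 ≤ b := sq_nonneg _
  have h3 : b * (δ * M.topGain f ∅) ≤ b * (δ * opt M f) := by gcongr
  have h4 : b * (1 - δ) * opt M f ≤ (1 + b) * x := by linarith
  have h5 : (1 / 2 - 2 * δ) * (1 + b) ≤ b * (1 - δ) := by
    rw [hb]
    nlinarith [mul_pos hδ hδ, mul_pos (mul_pos hδ hδ) hδ]
  have h6 : (1 + b) * ((1 / 2 - 2 * δ) * opt M f) ≤ (1 + b) * x := by
    refine le_trans ?_ h4
    calc _ = (1 / 2 - 2 * δ) * (1 + b) * opt M f := by ring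
      _ ≤ _ := mul_le_mul_of_nonneg_right h5 hOPT0
  exact le_of_mul_le_mul_left h6 (by linarith)

end AdaptiveAlgorithm

/-! ## Resource bounds and the main theorem -/

namespace AdaptiveAlgorithm

section

variable {n : ℕ} {ε : ℝ}

theorem numSets_le (hε : 0 < ε) (hε' : ε < 1) : (numSets (ε / 16) : ℝ) ≤ 17 / ε := by
  have h := (Nat.ceil_lt_add_one (by positivity : (0 : ℝ) ≤ 1 / (ε / 16))).le
  have h1 : 1 / (ε / 16) = 16 / ε := by field_simp
  have h2 : 1 ≤ 1 / ε := by rw [le_div_iff₀ hε]; linarith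
  have h3 : 17 / ε = 16 / ε + 1 / ε := by ring
  rw [h1] at h
  rw [h3, numSets, h1]
  linarith

theorem greedyRounds_le (n : ℕ) (ε : ℝ) :
    (greedyRounds n (ε / 16) : ℝ) ≤ 16384 * (Real.log n ^ 2 / ε ^ 2) := by
  refine (Nat.floor_le (by positivity)).trans (le_of_eq ?_)
  rw [div_pow, div_div_eq_mul_div]
  ring

theorem bounds_of_ratio (hn : 2 ≤ n) (hε : 0 < ε) (hε' : ε < 1) :
    (n : ℝ) ≤ n / ε ∧ 1 / ε ≤ n / ε ∧ 2 ≤ n / ε := by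
  have h2 : (2 : ℝ) ≤ n := by exact_mod_cast hn
  have h1 : (n : ℝ) ≤ n / ε := by rw [le_div_iff₀ hε]; nlinarith
  exact ⟨h1, div_le_div_of_nonneg_right (by linarith) hε.le, h2.trans h1⟩

theorem greedyRounds_le_pow (hn : 2 ≤ n) (hε : 0 < ε) (hε' : ε < 1) :
    (greedyRounds n (ε / 16) : ℝ) ≤ 16384 * (n / ε) ^ 2 := by
  have hn0 : (0 : ℝ) < n := by exact_mod_cast (by omega : 0 < n)
  have hlog := log_two_bound hn
  refine (greedyRounds_le n ε).trans (mul_le_mul_of_nonneg_left ?_ (by norm_num))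
  rw [div_pow]
  have h1 : Real.log n ≤ n := (Real.log_le_sub_one_of_pos hn0).trans (by linarith)
  gcongr

theorem numSamples_le (hn : 2 ≤ n) (hε : 0 < ε) (hε' : ε < 1) :
    (numSamples n (ε / 16) : ℝ) ≤ 10 ^ 9 * (n / ε) ^ 10 := by
  obtain ⟨h1, h2, h3⟩ := bounds_of_ratio hn hε hε'
  have hl := numSets_le hε hε'
  have hl0 : (0 : ℝ) < numSets (ε / 16) := by
    exact_mod_cast numSets_pos (by positivity : 0 < ε / 16)
  have hn0 : (0 : ℝ) < n := by exact_mod_cast (by omega : 0 < n)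
  set X : ℝ := n / ε with hX
  have hl' : (numSets (ε / 16) : ℝ) ≤ 17 * X := by
    refine hl.trans ?_
    have : 17 / ε = 17 * (1 / ε) := by ring
    linarith
  have h16 : 1 / (ε / 16) = 16 * (1 / ε) := by field_simp
  have hacc : 1 / accuracy n (ε / 16) ≤ 1088 * X ^ 4 := by
    have h4 : 1 / accuracy n (ε / 16) =
        numSets (ε / 16) * (n * (2 * n + 3)) * (16 * (1 / ε)) := by
      rw [accuracy]
      field_simp
    rw [h4]
    have h5 : (2 * n + 3 : ℝ) ≤ 4 * X := by linarith
    calc (numSets (ε / 16) : ℝ) * (n * (2 * n + 3)) * (16 * (1 / ε))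
        ≤ (17 * X) * (X * (4 * X)) * (16 * X) := by gcongr
      _ = 1088 * X ^ 4 := by ring
  have h4 : 4 / accuracy n (ε / 16) ^ 2 ≤ 4 * (1088 * X ^ 4) ^ 2 := by
    have h5 : 4 / accuracy n (ε / 16) ^ 2 = 4 * (1 / accuracy n (ε / 16)) ^ 2 := by
      rw [one_div, inv_pow, ← div_eq_mul_inv]
    rw [h5]
    have h6 := accuracy_pos hn (by positivity : 0 < ε / 16)
    gcongr
  -- `n l ≤ 17 X²`, and `1 + 16 X ≤ 9 X²` because `X ≥ 2`.
  have h5 : n * numSets (ε / 16) + 1 + 1 / (ε / 16) ≤ 26 * X ^ 2 := by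
    have h6 : n * (numSets (ε / 16) : ℝ) ≤ X * (17 * X) := by gcongr
    rw [h16]
    nlinarith
  have h6 : 4 / accuracy n (ε / 16) ^ 2 * (n * numSets (ε / 16) + 1 + 1 / (ε / 16)) ≤
      4 * (1088 * X ^ 4) ^ 2 * (26 * X ^ 2) := by
    gcongr
  have h7 : (1 : ℝ) ≤ X ^ 10 := one_le_pow₀ (by linarith)
  have h8 := (Nat.ceil_lt_add_one (by positivity :
    (0 : ℝ) ≤ 4 / accuracy n (ε / 16) ^ 2 * (n * numSets (ε / 16) + 1 + 1 / (ε / 16)))).le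
  have h9 : 4 * (1088 * X ^ 4) ^ 2 * (26 * X ^ 2) = 123109376 * X ^ 10 := by ring
  rw [numSamples]
  linarith

theorem greedyQueries_le (hn : 2 ≤ n) (hε : 0 < ε) (hε' : ε < 1) {N : ℕ}
    (hN : (N : ℝ) ≤ 10 ^ 9 * (n / ε) ^ 10) :
    (greedyQueries n N : ℝ) ≤ 10 ^ 10 * (n / ε) ^ 12 := by
  obtain ⟨h1, h2, h3⟩ := bounds_of_ratio hn hε hε'
  set X : ℝ := n / ε with hX
  have h4 : (1 : ℝ) ≤ X ^ 10 := one_le_pow₀ (by linarith)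
  have h5 : (N + 1 : ℝ) ≤ 2 * 10 ^ 9 * X ^ 10 := by linarith
  have h6 : (n + 1 : ℝ) ≤ 2 * X := by linarith
  push_cast
  calc ((n : ℝ) + 1) * ((N + 1) * (n + 1)) ≤ 2 * X * (2 * 10 ^ 9 * X ^ 10 * (2 * X)) := by gcongr
    _ = 8 * 10 ^ 9 * X ^ 12 := by ring
    _ ≤ _ := by
      have : (0 : ℝ) ≤ X ^ 12 := by positivity
      linarith

theorem rounds_le (hn : 2 ≤ n) (hε : 0 < ε) (hε' : ε < 1) {r : ℕ} (hr : r ≤ 1) :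
    ((numSets (ε / 16) * greedyRounds n (ε / 16) + r : ℕ) : ℝ) ≤
      10 ^ 16 * (Real.log n ^ 2 / ε ^ 3) := by
  have h1 := numSets_le hε hε'
  have h2 := greedyRounds_le n ε
  have h3 : (r : ℝ) ≤ 1 := by exact_mod_cast hr
  have hlog := log_two_bound hn
  have h4 : 1 ≤ 4 * (Real.log n ^ 2 / ε ^ 3) := by
    have h5 : ε ^ 3 ≤ 1 := pow_le_one₀ hε.le hε'.le
    rw [← mul_div_assoc, le_div_iff₀ (by positivity)]
    nlinarith
  have h5 : (numSets (ε / 16) : ℝ) * greedyRounds n (ε / 16) ≤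
      17 / ε * (16384 * (Real.log n ^ 2 / ε ^ 2)) := by gcongr
  have h6 : 17 / ε * (16384 * (Real.log n ^ 2 / ε ^ 2)) =
      278528 * (Real.log n ^ 2 / ε ^ 3) := by
    field_simp
    norm_num
  push_cast
  linarith

theorem queries_le (hn : 2 ≤ n) (hε : 0 < ε) (hε' : ε < 1) {r : ℕ} (hr : r ≤ 1) :
    (((numSets (ε / 16) * greedyRounds n (ε / 16) + r) *
      greedyQueries n (numSamples n (ε / 16)) : ℕ) : ℝ) ≤ 10 ^ 16 * (n / ε) ^ 15 := by
  obtain ⟨h1, h2, h3⟩ := bounds_of_ratio hn hε hε'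
  have h4 := greedyQueries_le hn hε hε' (numSamples_le hn hε hε')
  have h5 := greedyRounds_le_pow hn hε hε'
  have h6 : (numSets (ε / 16) : ℝ) ≤ 17 * (n / ε) := by
    refine (numSets_le hε hε').trans ?_
    have : 17 / ε = 17 * (1 / ε) := by ring
    linarith
  have h7 : (r : ℝ) ≤ 1 := by exact_mod_cast hr
  rw [Nat.cast_mul, Nat.cast_add, Nat.cast_mul]
  set X : ℝ := n / ε with hX
  have h8 : (1 : ℝ) ≤ X ^ 3 := one_le_pow₀ (by linarith)
  have h9 : (numSets (ε / 16) : ℝ) * greedyRounds n (ε / 16) + r ≤ 10 ^ 6 * X ^ 3 := by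
    have h10 : (numSets (ε / 16) : ℝ) * greedyRounds n (ε / 16) ≤ 17 * X * (16384 * X ^ 2) := by
      gcongr
    have h11 : 17 * X * (16384 * X ^ 2) = 278528 * X ^ 3 := by ring
    linarith
  calc _ ≤ 10 ^ 6 * X ^ 3 * (10 ^ 10 * X ^ 12) := by gcongr
    _ = 10 ^ 16 * X ^ 15 := by ring

theorem half_queries_le (hn : 2 ≤ n) (hε : 0 < ε) (hε' : ε < 1) :
    ((greedyRounds n (ε / 16) * greedyQueries n 1 : ℕ) : ℝ) ≤ 10 ^ 16 * (n / ε) ^ 15 := by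
  obtain ⟨h1, h2, h3⟩ := bounds_of_ratio hn hε hε'
  have h0 : (1 : ℝ) ≤ (n / ε) ^ 10 := one_le_pow₀ (by linarith)
  have h4 := greedyQueries_le (N := 1) hn hε hε' (by push_cast; linarith)
  have h5 := greedyRounds_le_pow hn hε hε'
  rw [Nat.cast_mul]
  set X : ℝ := n / ε with hX
  have h6 : X ^ 14 ≤ X ^ 15 := pow_le_pow_right₀ (by linarith) (by norm_num)
  have h7 : (0 : ℝ) ≤ X ^ 15 := by positivity
  calc _ ≤ 16384 * X ^ 2 * (10 ^ 10 * X ^ 12) := by gcongr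
    _ = 16384 * 10 ^ 10 * X ^ 14 := by ring
    _ ≤ _ := by linarith

end

end AdaptiveAlgorithm

open AdaptiveAlgorithm in
theorem mainTheorem1 :
    ∃ (C : ℝ) (d : ℕ), ∀ (E : Type u) [Fintype E] [DecidableEq E] (n : ℕ) (ε : ℝ),
      Fintype.card E = n → 2 ≤ n → 0 < ε → ε < 1 →
      -- an independent set of expected value at least `(1/2 - ε) OPT`
      (∃ A : AdaptiveAlgorithm E (Finset E),
        ∀ (M : Matroid E) (f : Finset E → ℝ), M.E = Set.univ → IsMonotoneSubmodular f →
          (∀ r ∈ (A.run M f).support, M.Indep (r.output : Set E)) ∧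
          ENNReal.ofReal ((1 / 2 - ε) * opt M f) ≤
            (A.run M f).expect (fun r => ENNReal.ofReal (f r.output)) ∧
          (A.run M f).expect (fun r => (r.rounds : ℝ≥0∞)) ≤
            ENNReal.ofReal (C * (Real.log n ^ 2 / ε ^ 2)) ∧
          (A.run M f).expect (fun r => (r.queries : ℝ≥0∞)) ≤
            ENNReal.ofReal (C * (n / ε) ^ d)) ∧
      -- a convex combination of `O(1/ε)` independent sets with `E[F(x)] ≥ (1 - 1/e - ε) OPT`
      (∃ A : AdaptiveAlgorithm E (ConvexCombination E),
        ∀ (M : Matroid E) (f : Finset E → ℝ), M.E = Set.univ → IsMonotoneSubmodular f →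
          (∀ r ∈ (A.run M f).support, (r.output.size : ℝ) ≤ C / ε ∧
            ∀ i, M.Indep (r.output.sets i : Set E)) ∧
          ENNReal.ofReal ((1 - Real.exp (-1) - ε) * opt M f) ≤
            (A.run M f).expect (fun r => ENNReal.ofReal (multilinear f r.output.point)) ∧
          (A.run M f).expect (fun r => (r.rounds : ℝ≥0∞)) ≤
            ENNReal.ofReal (C * (Real.log n ^ 2 / ε ^ 3)) ∧
          (A.run M f).expect (fun r => (r.queries : ℝ≥0∞)) ≤
            ENNReal.ofReal (C * (n / ε) ^ d)) ∧
      -- a `(1 - 1/e - ε)`-approximation of the number `OPT`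
      (∃ A : AdaptiveAlgorithm E ℝ≥0,
        ∀ (M : Matroid E) (f : Finset E → ℝ), M.E = Set.univ → IsMonotoneSubmodular f →
          ENNReal.ofReal ((1 - Real.exp (-1) - ε) * opt M f) ≤
            (A.run M f).expect (fun r => ENNReal.ofReal (min (r.output : ℝ) (opt M f))) ∧
          (A.run M f).toOuterMeasure {r | opt M f < (r.output : ℝ)} ≤ ENNReal.ofReal ε ∧
          (A.run M f).expect (fun r => (r.rounds : ℝ≥0∞)) ≤
            ENNReal.ofReal (C * (Real.log n ^ 2 / ε ^ 3)) ∧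
          (A.run M f).expect (fun r => (r.queries : ℝ≥0∞)) ≤
            ENNReal.ofReal (C * (n / ε) ^ d)) := by
  -- The exponent 15 bounds the queries: `(n/ε)^3` for the rounds times `(n/ε)^12` for the queries
  -- in one round.
  refine ⟨10 ^ 16, 15, ?_⟩
  intro E _ _ n ε hcard hn hε hε'
  subst hcard
  -- The losses are at most `8δ`, and `ε < 1` yields the bound `δ ≤ 1/16` used by the estimates.
  set δ := ε / 16 with hδε
  have hδ : 0 < δ := by positivity
  have hδ' : δ ≤ 1 / 16 := by linarith
  have : NeZero (numSets δ) := ⟨(numSets_pos hδ).ne'⟩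
  have hopt : ∀ (M : Matroid E) (f : Finset E → ℝ), IsMonotoneSubmodular f → 0 ≤ opt M f :=
    fun M f hf => (hf.nonneg ∅).trans (le_opt (by simp))
  refine ⟨⟨parallelGreedy (fun _ : Unit => (id : Finset E → Finset E)) δ, ?_⟩,
    ⟨sampledGreedy (numSets δ) (numSamples (Fintype.card E) δ) δ fun _ I =>
      .output (ConvexCombination.uniform (numSets_pos hδ) I), ?_⟩,
    ⟨sampledGreedy (numSets δ) (numSamples (Fintype.card E) δ) δ (estimateStep δ), ?_⟩⟩
  · intro M f hM hf
    have hcost := cost_parallelGreedy hn (fun _ : Unit => (id : Finset E → Finset E)) hδ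
      (by linarith)
    have havg : avg (fun _ : Unit => (id : Finset E → Finset E)) f = f := by
      funext T
      simp [avg]
    have hind := (guarantee_parallelGreedy (f := f)
      (enc := fun _ : Unit => (id : Finset E → Finset E)) hn hM
      (by rw [havg]; exact hf.monoSubmod) hδ (by linarith)).1
    refine ⟨fun r hr => hind.of_mem_support hr, ?_, hcost.expect_rounds_le ?_,
      hcost.expect_queries_le ?_⟩
    · refine (ENNReal.ofReal_le_ofReal ?_).trans (ofReal_mean_le_expect _ hf.nonneg)
      refine le_trans ?_ (le_mean_parallelGreedy hn hM hf hδ hδ')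
      exact mul_le_mul_of_nonneg_right (by linarith) (hopt M f hf)
    · refine (greedyRounds_le _ _).trans (mul_le_mul_of_nonneg_right (by norm_num) ?_)
      positivity
    · rw [Fintype.card_unit]
      exact half_queries_le hn hε hε'
  · intro M f hM hf
    have hcost := cost_sampledGreedy (E := E) hn hδ (by linarith)
      (l := numSets δ) (N := numSamples (Fintype.card E) δ) (r := 0)
      (fin := fun _ I => .output (ConvexCombination.uniform (numSets_pos hδ) I))
      fun _ _ => trivial
    have halways : (sampledGreedy (numSets δ) (numSamples (Fintype.card E) δ) δ fun _ I =>
        .output (ConvexCombination.uniform (numSets_pos hδ) I)).Always M f fun c =>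
        (c.size : ℝ) ≤ 10 ^ 16 / ε ∧ ∀ i, M.Indep (c.sets i : Set E) := by
      refine always_unif.2 fun ω _ => always_bind.2 ?_
      refine (always_continuousGreedy hn hM hf.monoSubmod hδ (by linarith) ω).mono fun I hI => ?_
      refine ⟨(numSets_le hε hε').trans ?_, hI⟩
      exact div_le_div_of_nonneg_right (by norm_num) hε.le
    refine ⟨fun r hr => halways.of_mem_support hr, ?_, hcost.expect_rounds_le ?_,
      hcost.expect_queries_le ?_⟩
    · have h1 := ofReal_mean_le_expect (M := M) (f := f)
        (sampledGreedy (numSets δ) (numSamples (Fintype.card E) δ) δ fun _ I =>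
          .output (ConvexCombination.uniform (numSets_pos hδ) I))
        (h := fun c => max (multilinear f c.point) 0) fun c => le_max_right _ _
      have h2 : ∀ x : ℝ, ENNReal.ofReal (max x 0) = ENNReal.ofReal x := fun x => by
        rcases le_total x 0 with hx | hx
        · rw [max_eq_right hx, ENNReal.ofReal_zero, ENNReal.ofReal_of_nonpos hx]
        · rw [max_eq_left hx]
      simp only [h2] at h1
      refine (ENNReal.ofReal_le_ofReal ?_).trans h1
      refine le_trans ?_ (le_mean_combination hn hM hf hδ hδ')
      exact mul_le_mul_of_nonneg_right (by linarith) (hopt M f hf)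
    · exact rounds_le hn hε hε' zero_le_one
    · exact queries_le hn hε hε' zero_le_one
  · intro M f hM hf
    have hcost := cost_sampledGreedy (E := E) hn hδ (by linarith)
      (l := numSets δ) (N := numSamples (Fintype.card E) δ) (r := 1)
      (fin := estimateStep δ) (cost_estimateStep δ)
    refine ⟨?_, ?_, hcost.expect_rounds_le ?_, hcost.expect_queries_le ?_⟩
    · refine (ENNReal.ofReal_le_ofReal ?_).trans (ofReal_mean_le_expect _
        fun v : ℝ≥0 => le_min v.2 (hopt M f hf))
      refine le_trans ?_ (le_mean_estimate hn hM hf hδ hδ')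
      exact mul_le_mul_of_nonneg_right (by linarith) (hopt M f hf)
    · classical
      refine le_trans (toOuterMeasure_le_of_mean (s := {v : ℝ≥0 | opt M f < (v : ℝ)}) (ε := δ) ?_)
        (ENNReal.ofReal_le_ofReal (by linarith))
      convert le_mean_estimate_le_opt hn hM hf hδ hδ'
    · exact rounds_le hn hε hε' le_rfl
    · exact queries_le hn hε hε' le_rfl
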